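/- Let $M,K,N\ge 1$ be integers with $\gcd(M,K)=1$ and $\gcd(M+K,N)=1$. A *solution* is a pair of families of complex numbers $I_n^t\ne 0$, $V_n^t$ ($n,t\in\mathbb Z$), $N$-periodic in $n$, with $$I_n^t=I_{n-1}^{t-M}+V_n^{t-K}-V_{n-1}^t,\qquad V_n^t=\frac{I_n^{t-M}V_n^{t-K}}{I_n^t},$$ and with $\prod_{n=1}^N I_n^{t+M}=\prod_{n=1}^N I_n^t$ and $\prod_{n=1}^N V_n^{t+K}=\prod_{n=1}^N V_n^t$ for all $t$. Let $S=S(y)$ be the $N\times N$ matrix with $S_{i,i+1}=1$ $(1\le i<N)$, $S_{N,1}=y$ and all other entries $0$. Put $L_t(y)=\mathrm{diag}(V_1^t,\dots,V_N^t)+S$, $R_t(y)=\mathrm{diag}(I_1^t,\dots,I_N^t)+S$ and $$X_t(y)=L_{t-(K-1)M}\cdots L_{t-M}L_t\;R_tR_{t-K}\cdots R_{t-(M-1)K}.$$ Fix a polynomial $F(x,y)=\det(xE-X_{t}(y))$ arising from some solution and some $t$, and suppose that the affine curve $\widetilde C=\{F=0\}\subset\mathbb C^2$ is smooth. Let $\mathcal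 T_C$ (the isolevel set) be the set of all matrices $X_t(y)$, for all solutions and all $t\in\mathbb Z$, with $\det(xE-X_t(y))=F$. Then $F$ is irreducible. Let $C$ (the spectral curve) be the smooth completion of $\widetilde C$, and let $g$ be its genus. For $X\in\mathcal T_C$ choose $\mathbf v=(v_1,\dots,v_N)^T\neq 0$ with entries in the function field of $C$ and $X(y)\mathbf v=x\mathbf v$; let $\Psi_X=(v_1:\dots:v_N):C\to\mathbb P^{N-1}$ be the corresponding morphism, and let $\varphi_C(X)$ be the divisor class of $\Psi_X^*\mathcal O(1)$. This is independent of the choice of $\mathbf v$ and defines a map $\varphi_C:\mathcal T_C\to\mathrm{Pic}^{g+N-1}(C)$, where $\mathrm{Pic}^d(C)$ is the set of divisors of degree $d$ modulo linear equivalence. There is exactly one point $P$ of $C$ with $(x,y)=(\infty,\infty)$. Moreover, for every solution and every $t$ with $X_t\in\mathcal T_C$: * **(I)** There is exactly one point $Q_1\in C$ with $(x,y)=(U_1,0)$, $U_1=\prod_{k=0}^{K-1}V_1^{t-kM}\prod_{k=0}^{M-1}I_1^{t-kK}$. The matrix $\sigma(X_t)=SX_tS^{-1}$ is the matrix $X_t$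 of the solution shifted by $n\mapsto n+1$, it lies in $\mathcal T_C$, and $$\varphi_C(\sigma(X_t))=\varphi_C(X_t)+[P-Q_1].$$ * **(II)$_1$** If $0\le j\le M-1$ and $t\equiv-(j+1)K \pmod M$, then there is exactly one point $A_j\in C$ with $(x,y)=\bigl(0,(-1)^N\prod_{n=1}^N I_n^{-jK}\bigr)$. The matrix $\mu_K(X_t)=R_{t-(M-1)K}\,X_t\,R_{t-(M-1)K}^{-1}$ equals $X_{t+K}$, it lies in $\mathcal T_C$, and $$\varphi_C(\mu_K(X_t))=\varphi_C(X_t)+[P-A_j].$$ * **(II)$_2$** If $0\le j\le K-1$ and $t\equiv-jM \pmod K$, then there is exactly one point $B_j\in C$ with $(x,y)=\bigl(0,(-1)^N\prod_{n=1}^N V_n^{-jM}\bigr)$. The matrix $\mu_{-M}(X_t)=L_{t-MK}\,X_t\,L_{t-MK}^{-1}$ equals $X_{t-M}$, it lies in $\mathcal T_C$, and $$\varphi_C(\mu_{-M}(X_t))=\varphi_C(X_t)+[P-B_j].$$ -/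

import Mathlib

open Polynomial WithZero

noncomputable section

namespace RndKP

/-! ### Divisors on the smooth complete curve with a given function field -/

section Curve

variable (𝕂 : Type*) [Field 𝕂] [Algebra ℂ 𝕂]

/-- The points of the smooth complete curve over `ℂ` whose function field is `𝕂`: the discrete
valuation rings of `𝕂` (with fraction field `𝕂`) that contain `ℂ`. -/
structure Point where
  /-- the local ring at the point -/
  ring : ValuationSubring 𝕂
  algebraMap_mem : ∀ c : ℂ, algebraMap ℂ 𝕂 c ∈ ring
  dvr : IsDiscreteValuationRing ring

variable {𝕂}

namespace Point

/-- The normalised multiplicative valuation at a point, `exp (-ord_p f)`. -/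
def val (p : Point 𝕂) : Valuation 𝕂 ℤᵐ⁰ :=
  letI := p.dvr
  (IsDiscreteValuationRing.maximalIdeal p.ring).valuation 𝕂

/-- Order of vanishing of a nonzero function (the value at `0` is irrelevant). -/
def ord (p : Point 𝕂) (f : 𝕂) : ℤ := -log (p.val f)

/-- Order of a nonzero vector function: the minimum of the orders of its nonzero entries. -/
def ordVec (p : Point 𝕂) {N : ℕ} (v : Fin N → 𝕂) : ℤ :=
  -log (Finset.univ.sup fun i => p.val (v i))

/-- `f` is regular at `p` and `f(p) = c`. -/
def HasValue (p : Point 𝕂) (f : 𝕂) (c : ℂ) : Prop := p.val (f - algebraMap ℂ 𝕂 c) < 1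

/-- `f(p) = ∞`. -/
def HasPole (p : Point 𝕂) (f : 𝕂) : Prop := 1 < p.val f

end Point

variable (𝕂)

/-- Divisors. -/
abbrev Divisor := Point 𝕂 →₀ ℤ

/-- The group of principal divisors `(f) = ∑ ord_p(f) p`, `f ≠ 0`. -/
def principal : AddSubgroup (Divisor 𝕂) where
  carrier := {D | ∃ f : 𝕂, f ≠ 0 ∧ ∀ p, D p = p.ord f}
  zero_mem' := ⟨1, one_ne_zero, fun p => by simp [Point.ord]⟩
  add_mem' := by
    rintro D E ⟨f, hf, hD⟩ ⟨g, hg, hE⟩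
    refine ⟨f * g, mul_ne_zero hf hg, fun p => ?_⟩
    have h1 : p.val f ≠ 0 := (Valuation.ne_zero_iff _).2 hf
    have h2 : p.val g ≠ 0 := (Valuation.ne_zero_iff _).2 hg
    rw [Finsupp.add_apply, hD, hE, Point.ord, Point.ord, Point.ord, map_mul, log_mul h1 h2]
    ring
  neg_mem' := by
    rintro D ⟨f, hf, hD⟩
    refine ⟨f⁻¹, inv_ne_zero hf, fun p => ?_⟩
    rw [Finsupp.neg_apply, hD, Point.ord, Point.ord, map_inv₀, log_inv]

/-- `Pic = Div / (linear equivalence)`. -/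
abbrev Pic := Divisor 𝕂 ⧸ principal 𝕂

variable {𝕂}

/-- The degree of a divisor. -/
def degree (D : Divisor 𝕂) : ℤ := D.sum fun _ n => n

/-- The class `[D]` of a divisor. -/
def cls (D : Divisor 𝕂) : Pic 𝕂 := QuotientAddGroup.mk D

/-- The divisor `p - q`. -/
def diff (p q : Point 𝕂) : Divisor 𝕂 := Finsupp.single p 1 - Finsupp.single q 1

variable (𝕂)

/-- `Pic^d`, the set of classes of divisors of degree `d`. -/
def PicDeg (d : ℤ) : Set (Pic 𝕂) := {c | ∃ D : Divisor 𝕂, degree D = d ∧ cls D = c}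

variable {𝕂}

/-- The Riemann-Roch space `{f | f = 0 or (f) + D ≥ 0}`. -/
def rrSpace (D : Divisor 𝕂) : Submodule ℂ 𝕂 where
  carrier := {f | ∀ p : Point 𝕂, p.val f ≤ exp (D p)}
  zero_mem' := fun p => by simp
  add_mem' := fun {f g} hf hg p => (p.val.map_add f g).trans (max_le (hf p) (hg p))
  smul_mem' := fun c f hf p => by
    have := p.dvr
    have h : p.val (algebraMap ℂ 𝕂 c) ≤ 1 :=
      (IsDiscreteValuationRing.maximalIdeal p.ring).valuation_le_one
        (K := 𝕂) ⟨algebraMap ℂ 𝕂 c, p.algebraMap_mem c⟩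
    rw [Algebra.smul_def, map_mul]
    exact (mul_le_of_le_one_left' h).trans (hf p)

variable (𝕂)

/-- The genus, as the maximum over all divisors `D` of `deg D + 1 - ℓ(D)`. -/
def genus : ℤ :=
  sSup {n : ℤ | ∃ D : Divisor 𝕂, n = degree D + 1 - Module.finrank ℂ (rrSpace D)}

end Curve

/-! ### The discrete system and its Lax matrices -/

/-- `I n t`, `V n t` (meaning `I_n^t`, `V_n^t`) is an `N`-periodic solution of the `(M,K)`-reduced
non-autonomous discrete KP equation, subject to the constraint on the products over a period that
selects the nontrivial evolution. -/
structure IsSolution (M K N : ℕ) (I V : ℤ → ℤ → ℂ) : Prop where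
  periodic_I : ∀ n t, I (n + N) t = I n t
  periodic_V : ∀ n t, V (n + N) t = V n t
  I_ne_zero : ∀ n t, I n t ≠ 0
  eq_I : ∀ n t, I n t = I (n - 1) (t - M) + V n (t - K) - V (n - 1) t
  eq_V : ∀ n t, V n t = I n (t - M) * V n (t - K) / I n t
  prod_I : ∀ t, ∏ n ∈ Finset.Icc (1 : ℤ) N, I n (t + M) = ∏ n ∈ Finset.Icc (1 : ℤ) N, I n t
  prod_V : ∀ t, ∏ n ∈ Finset.Icc (1 : ℤ) N, V n (t + K) = ∏ n ∈ Finset.Icc (1 : ℤ) N, V n t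

/-- The matrix `S(y)`: ones on the superdiagonal and `y` in the lower left corner. -/
def shiftMatrix (N : ℕ) : Matrix (Fin N) (Fin N) ℂ[X] :=
  Matrix.of fun i j =>
    if (i : ℕ) + 1 = j then 1 else if (i : ℕ) + 1 = N ∧ (j : ℕ) = 0 then X else 0

/-- `diag(d_1, …, d_N) + S(y)`. With `d_n = V_n^t` this is `L_t(y)`, with `d_n = I_n^t` it is
`R_t(y)`. -/
def laxFactor (N : ℕ) (d : ℤ → ℂ) : Matrix (Fin N) (Fin N) ℂ[X] :=
  Matrix.diagonal (fun i : Fin N => C (d ((i : ℕ) + 1))) + shiftMatrix N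

/-- `L_t(y)`. -/
def laxL (N : ℕ) (V : ℤ → ℤ → ℂ) (t : ℤ) : Matrix (Fin N) (Fin N) ℂ[X] :=
  laxFactor N fun n => V n t

/-- `R_t(y)`. -/
def laxR (N : ℕ) (I : ℤ → ℤ → ℂ) (t : ℤ) : Matrix (Fin N) (Fin N) ℂ[X] :=
  laxFactor N fun n => I n t

/-- `X_t(y) = L_{t-(K-1)M} ⋯ L_{t-M} L_t R_t R_{t-K} ⋯ R_{t-(M-1)K}`. -/
def laxX (M K N : ℕ) (I V : ℤ → ℤ → ℂ) (t : ℤ) : Matrix (Fin N) (Fin N) ℂ[X] :=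
  ((List.range K).reverse.map fun k => laxL N V (t - k * M)).prod *
    ((List.range M).map fun k => laxR N I (t - k * K)).prod

/-- The conjugate `A X A⁻¹`, as a matrix over `ℂ(y)`. -/
def conj {N : ℕ} (A X : Matrix (Fin N) (Fin N) ℂ[X]) : Matrix (Fin N) (Fin N) (RatFunc ℂ) :=
  A.map (algebraMap ℂ[X] (RatFunc ℂ)) * X.map (algebraMap ℂ[X] (RatFunc ℂ)) *
    (A.map (algebraMap ℂ[X] (RatFunc ℂ)))⁻¹

/-- The isolevel set: the matrices `X_t(y)` of solutions with spectral polynomial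
`F(x, y) = det(x E - X_t(y))`. -/
def isolevelSet (M K N : ℕ) (F : ℂ[X][X]) : Set (Matrix (Fin N) (Fin N) ℂ[X]) :=
  {A | ∃ I V : ℤ → ℤ → ℂ, ∃ t : ℤ, IsSolution M K N I V ∧ A = laxX M K N I V t ∧ A.charpoly = F}

/-! ### The spectral curve. A polynomial in `x, y` is an element of `ℂ[X][X]`; the outer variable
is `x` and the inner variable is `y`. -/

/-- The affine curve `F(x, y) = 0` has no singular point. -/
def IsSmoothAffine (F : ℂ[X][X]) : Prop :=
  ∀ a b : ℂ, F.evalEval b a = 0 →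
    (F.map (evalRingHom b)).derivative.eval a ≠ 0 ∨ (F.eval (C a)).derivative.eval b ≠ 0

section FunctionField

variable (F : ℂ[X][X]) [IsDomain (AdjoinRoot F)]

/-- The function field of the curve `F(x, y) = 0`: the fraction field of `ℂ[y][x] / (F)`. -/
abbrev FunField := FractionRing (AdjoinRoot F)

/-- The coordinate function `x`. -/
def xFun : FunField F := algebraMap (AdjoinRoot F) (FunField F) (AdjoinRoot.root F)

/-- The coordinate function `y`. -/
def yFun : FunField F := algebraMap (AdjoinRoot F) (FunField F) (AdjoinRoot.of F X)

variable {F}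

/-- The point `p` of the spectral curve lies over `(x, y) = (a, b)`. -/
def IsOver (p : Point (FunField F)) (a b : ℂ) : Prop :=
  p.HasValue (xFun F) a ∧ p.HasValue (yFun F) b

/-- The point `p` of the spectral curve lies over `(x, y) = (∞, ∞)`. -/
def IsAtInfinity (p : Point (FunField F)) : Prop :=
  p.HasPole (xFun F) ∧ p.HasPole (yFun F)

variable (F)

/-- `v` is an eigenvector function: `v ≠ 0` and `A(y) v = x v` on the spectral curve. It represents
the morphism `Ψ_A` from the curve to projective space. -/
def IsEigenvector {N : ℕ} (A : Matrix (Fin N) (Fin N) ℂ[X]) (v : Fin N → FunField F) : Prop :=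
  v ≠ 0 ∧ (A.map (aeval (yFun F))).mulVec v = xFun F • v

/-- `c` is the class of the pull-back, under the morphism `Ψ_A = (v_1 : ⋯ : v_N)` given by an
eigenvector, of a hyperplane `∑ aᵢ Xᵢ = 0` that does not contain the image; that is, `c` is the
class of the invertible sheaf `Ψ_A^* O(1)`. -/
def IsEigenvectorClass {N : ℕ} (A : Matrix (Fin N) (Fin N) ℂ[X]) (c : Pic (FunField F)) : Prop :=
  ∃ v : Fin N → FunField F, IsEigenvector F A v ∧
    ∃ a : Fin N → ℂ, ∑ i, a i • v i ≠ 0 ∧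
      ∃ D : Divisor (FunField F), (∀ p, D p = p.ord (∑ i, a i • v i) - p.ordVec v) ∧ cls D = c

end FunctionField

end RndKP

end

open Polynomial RndKP

open Polynomial WithZero

noncomputable section

namespace RndKP

/-! ### Points of the curve as normalised discrete valuations -/

section Points

variable {𝕂 : Type*} [Field 𝕂] [Algebra ℂ 𝕂]

namespace Point

/-! Each of the three moves interchanges two factors. For a constant c and a Lax factor A = diag(d)
+ S one has X_t = c + BA, and the transformed matrix is Y = c + AB. For the shift, A = S and c =
U_1, because at y = 0 the first basis vector is an eigenvector of X_t with eigenvalue U_1. For the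
time shifts, c = 0 and A is a factor R or L standing at the right end of X_t, if need be after
exchanges L_t R_t = R_{t-M} L_{t-K}; this relation comes from the discrete system.

Hence YA = AX, so A carries an eigenvector v of X to an eigenvector Av of Y, and it remains to
compare the divisors of v and Av (`exists_point_interchange`). Let b be the zero of det A. Since BAv
= (x - c)v and adj(A)Av = ±(y - b)v, nothing changes at affine points other than Q = (c, b). At Q
smoothness makes the c-eigenspace of X(b) a line, so it is ker A(b) and Av acquires a zero; the zero
is simple because x - c or y - b is a local parameter. At infinity A raises the order of the pole by
one.

The situation at infinity is governed by m = M + K being prime to N. The Newton polygon of F is the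
triangle (0,0), (N,0), (0,m) (`isTriangular_charpoly`), and the monomials x^i y^j with i < N have
distinct weights mi + Nj. A Puiseux solution y = τ^(-N), x = τ^(-m) z found by Hensel's lemma
therefore embeds the coordinate ring in a field, which gives irreducibility. Every valuation at
infinity is a multiple of the same weight, so there is one point P (`isAtInfinity_unique`).
Extending an eigenvector by v_{i+N} = y v_i, the pole order of v_i at P grows by exactly one with i
(`val_eigenvector`).

For the degree, normalise the first entry of v to 1 and let E be the polar divisor of v minus (N -
1)P. Functions whose affine poles are bounded by v are ℂ[y]-combinations of its entries, so L(E - P)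
= 0, while the extended entries have the pole orders 0, 1, 2, … at P. The quantity deg D + 1 - ℓ(D)
does not decrease under D ↦ D + P and has a limit along D + nP that is independent of D; evaluated
on E, the limit is deg E, whence g = deg E (`genus_eq`) and the class has degree g + N - 1. -/

lemma val_surjective (p : Point 𝕂) : Function.Surjective p.val := by
  let := p.dvr
  obtain ⟨u, hu⟩ := (IsDiscreteValuationRing.maximalIdeal p.ring).valuation_exists_uniformizer 𝕂
  intro x
  by_cases hx : x = 0
  · exact ⟨0, by simp [hx]⟩
  · refine ⟨u ^ (-log x), ?_⟩
    have hu' : p.val u = exp (-1) := hu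
    rw [map_zpow₀, hu', ← exp_zsmul]
    simp [exp_log hx]

lemma exists_uniformizer (p : Point 𝕂) : ∃ u : 𝕂, p.val u = exp (-1) := p.val_surjective _

lemma ne_zero_of_val_eq_exp (p : Point 𝕂) {f : 𝕂} {n : ℤ} (h : p.val f = exp n) : f ≠ 0 :=
  (p.val.ne_zero_iff).1 (h ▸ exp_ne_zero)

lemma val_le_one_iff (p : Point 𝕂) (f : 𝕂) : p.val f ≤ 1 ↔ f ∈ p.ring := by
  let := p.dvr
  constructor
  · intro h
    obtain ⟨a, rfl⟩ := IsDiscreteValuationRing.exists_lift_of_le_one h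
    exact a.2
  · intro h
    exact (IsDiscreteValuationRing.maximalIdeal p.ring).valuation_le_one (K := 𝕂) ⟨f, h⟩

lemma val_algebraMap_le_one (p : Point 𝕂) (c : ℂ) : p.val (algebraMap ℂ 𝕂 c) ≤ 1 :=
  (p.val_le_one_iff _).2 (p.algebraMap_mem c)

lemma val_algebraMap (p : Point 𝕂) {c : ℂ} (hc : c ≠ 0) : p.val (algebraMap ℂ 𝕂 c) = 1 := by
  refine le_antisymm (p.val_algebraMap_le_one c) ?_
  have h := p.val_algebraMap_le_one c⁻¹
  rw [map_inv₀, map_inv₀] at h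
  exact (inv_le_one₀ (zero_lt_iff.2 (by simpa using hc))).1 h

lemma val_smul_le (p : Point 𝕂) (c : ℂ) (f : 𝕂) : p.val (c • f) ≤ p.val f := by
  rw [Algebra.smul_def, map_mul]
  exact mul_le_of_le_one_left' (p.val_algebraMap_le_one c)

lemma ext_ring {p q : Point 𝕂} (h : p.ring = q.ring) : p = q := by
  cases p; cases q; cases h; rfl

/-- A discrete valuation ring is a maximal proper subring. -/
lemma eq_of_le {p q : Point 𝕂} (h : ∀ f, p.val f ≤ 1 → q.val f ≤ 1) : p = q := by
  obtain ⟨u, hu⟩ := p.exists_uniformizer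
  have hu0 : u ≠ 0 := p.ne_zero_of_val_eq_exp hu
  have h1 : ∀ f, p.val f = 1 → q.val f = 1 := by
    intro f hf
    have hf0 : f ≠ 0 := by rintro rfl; simp at hf
    refine le_antisymm (h f hf.le) ?_
    have := h f⁻¹ (by simp [hf])
    rw [map_inv₀] at this
    exact (inv_le_one₀ (zero_lt_iff.2 (by simpa using hf0))).1 this
  -- Units for `p` are units for `q`, so `q.val` is determined by its value at a uniformizer of `p`.
  have h2 : ∀ f, f ≠ 0 → q.val f = q.val u ^ (-log (p.val f)) := by
    intro f hf
    have hpf : p.val f ≠ 0 := by simpa using hf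
    have : p.val (f * u ^ (log (p.val f))) = 1 := by
      rw [map_mul, map_zpow₀, hu, ← exp_zsmul]
      conv_lhs => rw [← exp_log hpf]
      rw [← exp_add]; simp
    have := h1 _ this
    rw [map_mul, map_zpow₀] at this
    rw [zpow_neg]
    exact eq_inv_of_mul_eq_one_left this
  -- If `q.val u` were 1, the valuation `q.val` would be trivial and could not have a uniformizer.
  have hqu : q.val u < 1 := by
    refine lt_of_le_of_ne (h u (by rw [hu]; exact exp_le_exp.2 (by norm_num))) fun h3 => ?_
    obtain ⟨w, hw⟩ := q.exists_uniformizer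
    have := h2 w (q.ne_zero_of_val_eq_exp hw)
    rw [h3, one_zpow, hw] at this
    exact absurd this (by simp [-exp_zero])
  apply ext_ring
  ext f
  rw [← val_le_one_iff, ← val_le_one_iff]
  refine ⟨h f, fun hf => ?_⟩
  by_cases hf0 : f = 0
  · simp [hf0]
  rw [h2 f hf0] at hf
  have hpf : p.val f ≠ 0 := by simpa using hf0
  by_contra! h4
  rw [← exp_log hpf, ← exp_zero, exp_lt_exp] at h4
  have hq0 : 0 < q.val u := zero_lt_iff.2 (by simpa using hu0)
  rw [zpow_neg, inv_le_one₀ (zpow_pos hq0 _)] at hf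
  exact absurd hf (not_le.2 (zpow_lt_one₀ hq0 hqu h4))

/-- The point defined by a normalised discrete valuation that is trivial on the constants. -/
def ofValuation (w : Valuation 𝕂 ℤᵐ⁰) (hw : Function.Surjective w)
    (hC : ∀ c : ℂ, w (algebraMap ℂ 𝕂 c) ≤ 1) : Point 𝕂 where
  ring := w.valuationSubring
  algebraMap_mem := hC
  dvr := by
    have : Nontrivial (MonoidWithZeroHom.valueGroup (.ofClass w)) := by
      obtain ⟨u, hu⟩ := hw (exp (-1))
      rw [Subgroup.nontrivial_iff_exists_ne_one]
      refine ⟨Units.mk0 (w u) (by simp [hu]), ?_, ?_⟩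
      · apply MonoidWithZeroHom.mem_valueGroup
        exact ⟨u, by simp⟩
      · intro h
        have := congrArg Units.val h
        simp [hu, -exp_zero] at this
    exact Valuation.valuationSubring_isDiscreteValuationRing w

lemma ofValuation_val_le_one (w : Valuation 𝕂 ℤᵐ⁰) (hw : Function.Surjective w)
    (hC : ∀ c : ℂ, w (algebraMap ℂ 𝕂 c) ≤ 1) (f : 𝕂) :
    (ofValuation w hw hC).val f ≤ 1 ↔ w f ≤ 1 := by
  rw [val_le_one_iff]; rfl

/-- Two valuations with the same valuation ring order the functions in the same way. Both are onto
`ℤᵐ⁰`, so a uniformizer for one has value `exp (-1)` for the other, and equivalence becomes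
equality. -/
lemma ofValuation_val (w : Valuation 𝕂 ℤᵐ⁰) (hw : Function.Surjective w)
    (hC : ∀ c : ℂ, w (algebraMap ℂ 𝕂 c) ≤ 1) (f : 𝕂) : (ofValuation w hw hC).val f = w f := by
  set p := ofValuation w hw hC with hp
  have h : ∀ f, p.val f ≤ 1 ↔ w f ≤ 1 := ofValuation_val_le_one w hw hC
  have key : ∀ f g, p.val f ≤ p.val g ↔ w f ≤ w g := by
    intro f g
    by_cases hg : g = 0
    · simp [hg]
    have := h (f / g)
    rw [map_div₀, map_div₀, div_le_one₀ (zero_lt_iff.2 (by simpa using hg)),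
      div_le_one₀ (zero_lt_iff.2 (by simpa using hg))] at this
    exact this
  have keylt : ∀ f g, p.val f < p.val g ↔ w f < w g := fun f g => by
    rw [← not_le, ← not_le, key]
  have keyeq : ∀ f g, p.val f = p.val g ↔ w f = w g := fun f g => by
    rw [le_antisymm_iff, le_antisymm_iff, key, key]
  obtain ⟨u, hu⟩ := p.exists_uniformizer
  obtain ⟨t, ht⟩ := hw (exp (-1))
  have lt_iff : ∀ z : ℤᵐ⁰, z < 1 ↔ z ≤ exp (-1) := by
    intro z
    by_cases hz : z = 0
    · simp [hz]
    rw [← exp_log hz, ← exp_zero, exp_lt_exp, exp_le_exp]; omega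
  have h1 : w u = exp (-1) := by
    apply le_antisymm
    · rw [← lt_iff, ← map_one w, ← keylt, map_one, lt_iff, hu]
    · rw [← ht, ← key, hu, ← lt_iff, ← map_one p.val, keylt, map_one, lt_iff, ht]
  by_cases hf : f = 0
  · simp [hf]
  have hpf : p.val f ≠ 0 := by simpa using hf
  have h2 : p.val f = p.val (u ^ (-log (p.val f))) := by
    rw [map_zpow₀, hu, ← exp_zsmul]
    simp [exp_log hpf]
  have h3 := (keyeq _ _).1 h2
  rw [map_zpow₀, h1] at h3
  rw [h3, ← exp_zsmul]; simp [exp_log hpf]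

lemma HasValue.val_le_one {p : Point 𝕂} {f : 𝕂} {c : ℂ} (h : p.HasValue f c) : p.val f ≤ 1 := by
  have := p.val.map_add (f - algebraMap ℂ 𝕂 c) (algebraMap ℂ 𝕂 c)
  rw [sub_add_cancel] at this
  exact this.trans (max_le h.le (p.val_algebraMap_le_one c))

lemma HasValue.add {p : Point 𝕂} {f g : 𝕂} {c d : ℂ} (hf : p.HasValue f c)
    (hg : p.HasValue g d) : p.HasValue (f + g) (c + d) := by
  have : f + g - algebraMap ℂ 𝕂 (c + d) = (f - algebraMap ℂ 𝕂 c) + (g - algebraMap ℂ 𝕂 d) := by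
    rw [map_add]; ring
  rw [HasValue, this]
  exact p.val.map_add_lt hf hg

lemma HasValue.mul {p : Point 𝕂} {f g : 𝕂} {c d : ℂ} (hf : p.HasValue f c)
    (hg : p.HasValue g d) : p.HasValue (f * g) (c * d) := by
  have : f * g - algebraMap ℂ 𝕂 (c * d) =
      (f - algebraMap ℂ 𝕂 c) * g + algebraMap ℂ 𝕂 c * (g - algebraMap ℂ 𝕂 d) := by
    rw [map_mul]; ring
  rw [HasValue, this]
  apply p.val.map_add_lt
  · rw [map_mul]
    exact mul_lt_one_of_lt_of_le hf hg.val_le_one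
  · rw [map_mul]
    exact mul_lt_one_of_nonneg_of_lt_one_right (p.val_algebraMap_le_one c) zero_le hg

lemma hasValue_algebraMap (p : Point 𝕂) (c : ℂ) : p.HasValue (algebraMap ℂ 𝕂 c) c := by
  simp [HasValue]

lemma hasValue_zero_iff (p : Point 𝕂) (f : 𝕂) : p.HasValue f 0 ↔ p.val f < 1 := by
  simp [HasValue]

lemma hasValue_zero (p : Point 𝕂) : p.HasValue (0 : 𝕂) 0 := by simp [HasValue]

lemma HasValue.neg {p : Point 𝕂} {f : 𝕂} {c : ℂ} (hf : p.HasValue f c) :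
    p.HasValue (-f) (-c) := by
  have := (p.hasValue_algebraMap (-1)).mul hf
  simpa using this

lemma HasValue.sub {p : Point 𝕂} {f g : 𝕂} {c d : ℂ} (hf : p.HasValue f c)
    (hg : p.HasValue g d) : p.HasValue (f - g) (c - d) := by
  simpa [sub_eq_add_neg] using hf.add hg.neg

lemma HasValue.sum {p : Point 𝕂} {ι : Type*} (s : Finset ι) {f : ι → 𝕂} {c : ι → ℂ}
    (h : ∀ i ∈ s, p.HasValue (f i) (c i)) : p.HasValue (∑ i ∈ s, f i) (∑ i ∈ s, c i) := by
  classical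
  induction s using Finset.induction_on with
  | empty => simpa using p.hasValue_zero
  | insert a s ha ih =>
    rw [Finset.sum_insert ha, Finset.sum_insert ha]
    exact (h a (by simp)).add (ih fun i hi => h i (by simp [hi]))

lemma HasValue.unique {p : Point 𝕂} {f : 𝕂} {c d : ℂ} (hc : p.HasValue f c)
    (hd : p.HasValue f d) : c = d := by
  have h := hc.sub hd
  rw [sub_self, HasValue, zero_sub, Valuation.map_neg] at h
  by_contra hne
  rw [p.val_algebraMap (sub_ne_zero.2 hne)] at h
  exact lt_irrefl _ h

lemma HasValue.inv {p : Point 𝕂} {f : 𝕂} {c : ℂ} (hf : p.HasValue f c) (hc : c ≠ 0) :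
    p.HasValue f⁻¹ c⁻¹ := by
  have hf1 : p.val f = 1 := by
    refine le_antisymm hf.val_le_one (not_lt.1 fun h => ?_)
    exact hc (hf.unique ((p.hasValue_zero_iff f).2 h))
  have hf0 : f ≠ 0 := by rintro rfl; simp at hf1
  have hc' : algebraMap ℂ 𝕂 c ≠ 0 := by simpa using hc
  have : f⁻¹ - algebraMap ℂ 𝕂 c⁻¹ = -(f⁻¹ * algebraMap ℂ 𝕂 c⁻¹ * (f - algebraMap ℂ 𝕂 c)) := by
    rw [map_inv₀]; field_simp; ring
  rw [HasValue, this, Valuation.map_neg, map_mul, map_mul, map_inv₀, hf1,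
    p.val_algebraMap (inv_ne_zero hc)]
  simpa using! hf

lemma HasValue.val_eq_one {p : Point 𝕂} {f : 𝕂} {c : ℂ} (hf : p.HasValue f c) (hc : c ≠ 0) :
    p.val f = 1 := by
  refine le_antisymm hf.val_le_one (not_lt.1 fun h => ?_)
  exact hc (hf.unique ((p.hasValue_zero_iff f).2 h))

lemma HasValue.aeval {p : Point 𝕂} {f : 𝕂} {c : ℂ} (hf : p.HasValue f c) (q : ℂ[X]) :
    p.HasValue (aeval f q) (q.eval c) := by
  induction q using Polynomial.induction_on' with
  | add q r hq hr => simpa using hq.add hr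
  | monomial n a =>
    rw [aeval_monomial, eval_monomial]
    refine (p.hasValue_algebraMap a).mul ?_
    induction n with
    | zero => simpa using p.hasValue_algebraMap 1
    | succ n ih => rw [pow_succ, pow_succ]; exact ih.mul hf

end Point

/-- The value of a sum of terms with distinct values. -/
lemma valuation_sum_eq_sup {R : Type*} [Ring R] (v : Valuation R ℤᵐ⁰)
    {ι : Type*} (s : Finset ι) (f : ι → R)
    (h : ∀ i ∈ s, ∀ j ∈ s, v (f i) = v (f j) → v (f i) ≠ 0 → i = j) :
    v (∑ i ∈ s, f i) = s.sup fun i => v (f i) := by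
  classical
  induction s using Finset.induction_on with
  | empty => simp
  | insert a s ha ih =>
    have ih' := ih fun i hi j hj => h i (by simp [hi]) j (by simp [hj])
    rw [Finset.sum_insert ha, Finset.sup_insert, ← ih']
    by_cases h0 : v (f a) = v (∑ i ∈ s, f i)
    · by_cases h1 : v (f a) = 0
      · rw [← h0, h1, sup_idem]
        have := v.map_add (f a) (∑ i ∈ s, f i)
        rw [← h0, h1, max_self] at this
        exact le_zero_iff.1 this
      · exfalso
        have hs : s.Nonempty := by
          rw [Finset.nonempty_iff_ne_empty]; rintro rfl; simp at h0; exact h1 h0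
        obtain ⟨j, hj, hj'⟩ := Finset.exists_mem_eq_sup s hs fun i => v (f i)
        rw [ih', hj'] at h0
        exact ha ((h a (by simp) j (by simp [hj]) h0 h1) ▸ hj)
    · exact v.map_add_of_distinct_val h0

end Points

/-! ### Triangular Newton polygons and the Puiseux solution at infinity -/

/-- The numerical data of a spectral polynomial: monic of degree `N` in `x`, with Newton polygon
the triangle with vertices `(0, 0)`, `(N, 0)`, `(0, m)`. -/
structure IsTriangular (m N : ℕ) (F : ℂ[X][X]) : Prop where
  m_pos : 0 < m
  N_pos : 0 < N
  coprime : Nat.Coprime m N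
  monic : F.Monic
  natDegree : F.natDegree = N
  weight : ∀ i j, (F.coeff i).coeff j ≠ 0 → m * i + N * j ≤ m * N
  lead : (F.coeff 0).coeff m ≠ 0

namespace IsTriangular

variable {m N : ℕ} {F : ℂ[X][X]}

lemma natDegree_coeff_le (h : IsTriangular m N F) (i : ℕ) : (F.coeff i).natDegree ≤ m := by
  rw [Polynomial.natDegree_le_iff_coeff_eq_zero]
  intro j hj
  by_contra hne
  have := h.weight i j hne
  have h2 : N * (m + 1) ≤ N * j := Nat.mul_le_mul_left _ hj
  have := h.N_pos
  nlinarith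

lemma coeff_top (h : IsTriangular m N F) : F.coeff N = 1 := by
  have := h.monic; rw [Monic, leadingCoeff, h.natDegree] at this; exact this

/-- Expansion of `F(x, y)` into monomials. -/
lemma eval₂_eq_sum (h : IsTriangular m N F) {L : Type*} [Field L] [Algebra ℂ L] (x y : L) :
    F.eval₂ (aeval y : ℂ[X] →ₐ[ℂ] L).toRingHom x =
      ∑ i ∈ Finset.range (N + 1), ∑ j ∈ Finset.range (m + 1),
        algebraMap ℂ L ((F.coeff i).coeff j) * y ^ j * x ^ i := by
  rw [eval₂_eq_sum_range, h.natDegree]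
  refine Finset.sum_congr rfl fun i _ => ?_
  rw [← Finset.sum_mul]
  congr 1
  have := h.natDegree_coeff_le i
  exact aeval_eq_sum_range' (Nat.lt_succ_of_le this) y |>.trans
    (Finset.sum_congr rfl fun j _ => by rw [Algebra.smul_def])

/-- Modulo `N` the weight is `m * i`, and `m` is invertible there. So the monomials x^i y^j with i <
N never share a weight, which excludes cancellation at infinity. -/
lemma eq_of_weight_eq (hmN : Nat.Coprime m N) {i j i' j' : ℕ} (hi : i < N) (hi' : i' < N)
    (h : m * i + N * j = m * i' + N * j') : i = i' := by
  have h1 : m * i ≡ m * i' [MOD N] := by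
    have : (m * i + N * j) % N = (m * i' + N * j') % N := by rw [h]
    simpa [Nat.ModEq] using this
  have h2 := Nat.ModEq.cancel_left_of_coprime (Nat.coprime_comm.1 hmN) h1
  exact Nat.ModEq.eq_of_lt_of_lt h2 hi hi'

/-- The hypotenuse of the Newton triangle contains no lattice points besides its two ends. -/
lemma weight_lt (h : IsTriangular m N F) {i j : ℕ} (hi : 0 < i) (hiN : i < N)
    (hc : (F.coeff i).coeff j ≠ 0) : m * i + N * j < m * N := by
  refine lt_of_le_of_ne (h.weight i j hc) fun he => ?_
  have := eq_of_weight_eq h.coprime (i := i) (j := j) (i' := 0) (j' := m) hiN h.N_pos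
    (by rw [he]; ring)
  omega

/-- The equation for `z`, where `y = τ⁻ᴺ` and `x = τ⁻ᵐ z`. -/
def henselPoly (m N : ℕ) (F : ℂ[X][X]) : (PowerSeries ℂ)[X] :=
  X ^ N + ∑ i ∈ Finset.range N, C (∑ j ∈ Finset.range (m + 1),
    PowerSeries.C ((F.coeff i).coeff j) * PowerSeries.X ^ (m * N - (m * i + N * j))) * X ^ i

lemma henselPoly_monic : (henselPoly m N F).Monic := by
  apply monic_X_pow_add
  rw [← Polynomial.mem_degreeLT]
  refine Submodule.sum_mem _ fun i hi => ?_
  rw [Polynomial.mem_degreeLT]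
  refine (degree_C_mul_X_pow_le _ _).trans_lt ?_
  exact_mod_cast Finset.mem_range.1 hi

/-- At τ = 0 only monomials on the hypotenuse survive, and these are its two ends. The constant left
over is nonzero by `lead`, so the reduction has simple roots, as Hensel's lemma requires. -/
lemma henselPoly_map (h : IsTriangular m N F) :
    (henselPoly m N F).map PowerSeries.constantCoeff = X ^ N + C ((F.coeff 0).coeff m) := by
  rw [henselPoly, Polynomial.map_add, Polynomial.map_pow, map_X, Polynomial.map_sum]
  congr 1
  rw [Finset.sum_eq_single 0]
  · rw [Polynomial.map_mul, map_C, map_sum, Finset.sum_eq_single m]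
    · simp [mul_comm]
    · intro j hj hne
      have : j < m := lt_of_le_of_ne (Nat.lt_succ_iff.1 (Finset.mem_range.1 hj)) hne
      have : m * N - (m * 0 + N * j) ≠ 0 := by
        have : N * j < N * m := Nat.mul_lt_mul_of_pos_left this h.N_pos
        rw [mul_comm m N]; omega
      rw [map_mul, map_pow, PowerSeries.constantCoeff_X, zero_pow this, mul_zero]
    · simp
  · intro i hi hne
    rw [Polynomial.map_mul, map_C, map_sum, Finset.sum_eq_zero]
    · simp
    intro j _
    by_cases hc : (F.coeff i).coeff j = 0
    · simp [hc]
    have := h.weight_lt (Nat.pos_of_ne_zero hne) (Finset.mem_range.1 hi) hc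
    have : m * N - (m * i + N * j) ≠ 0 := by omega
    simp [this]
  · intro h0; exact absurd (Finset.mem_range.2 h.N_pos) h0

lemma exists_henselPoly_root (h : IsTriangular m N F) :
    ∃ z : PowerSeries ℂ, (henselPoly m N F).eval z = 0 ∧ PowerSeries.constantCoeff z ≠ 0 := by
  obtain ⟨z₀, hz₀⟩ := IsAlgClosed.exists_pow_nat_eq (-(F.coeff 0).coeff m) h.N_pos
  have hz0 : z₀ ≠ 0 := by
    rintro rfl
    rw [zero_pow h.N_pos.ne'] at hz₀
    exact h.lead (by simpa using hz₀.symm)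
  have hev : ∀ (q : (PowerSeries ℂ)[X]), PowerSeries.constantCoeff (q.eval (PowerSeries.C z₀)) =
      (q.map PowerSeries.constantCoeff).eval z₀ := by
    intro q
    rw [eval_map, ← eval₂_hom]; simp
  obtain ⟨z, hz, hz'⟩ := HenselianRing.is_henselian (I := Ideal.span {PowerSeries.X})
    (henselPoly m N F) henselPoly_monic (PowerSeries.C z₀)
    (by
      rw [Ideal.mem_span_singleton, PowerSeries.X_dvd_iff, hev, h.henselPoly_map]
      simp [hz₀])
    (by
      refine IsUnit.map _ ?_
      rw [PowerSeries.isUnit_iff_constantCoeff, hev, ← derivative_map, h.henselPoly_map]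
      rw [derivative_add, derivative_C, add_zero, derivative_X_pow]
      simp [h.N_pos.ne', hz0])
  refine ⟨z, hz, ?_⟩
  rw [Ideal.mem_span_singleton, PowerSeries.X_dvd_iff, map_sub, sub_eq_zero] at hz'
  rw [hz']; simpa using hz0

/-- A place at infinity: a Puiseux solution of `F(x, y) = 0`. -/
lemma exists_laurent (h : IsTriangular m N F) : ∃ x y : LaurentSeries ℂ,
    F.eval₂ (aeval y : ℂ[X] →ₐ[ℂ] LaurentSeries ℂ).toRingHom x = 0 ∧
    (Valued.v x : ℤᵐ⁰) = exp (m : ℤ) ∧ (Valued.v y : ℤᵐ⁰) = exp (N : ℤ) := by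
  obtain ⟨z, hz, hz0⟩ := h.exists_henselPoly_root
  set τ : LaurentSeries ℂ := HahnSeries.ofPowerSeries ℤ ℂ PowerSeries.X with hτ
  have hvτ : ∀ n : ℕ, (Valued.v (τ ^ n) : ℤᵐ⁰) = exp (-(n : ℤ)) :=
    LaurentSeries.valuation_X_pow ℂ
  have hτ0 : τ ≠ 0 := by
    intro h0
    have := hvτ 1
    rw [h0] at this; simp at this
    exact exp_ne_zero this.symm
  set Z : LaurentSeries ℂ := HahnSeries.ofPowerSeries ℤ ℂ z with hZ
  have hvZ : (Valued.v Z : ℤᵐ⁰) = 1 := by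
    have hu := PowerSeries.isUnit_iff_constantCoeff.2 (isUnit_iff_ne_zero.2 hz0)
    obtain ⟨w, hw⟩ := hu.exists_right_inv
    have h1 : (Valued.v Z : ℤᵐ⁰) ≤ 1 := (LaurentSeries.val_le_one_iff_eq_coe ℂ _).2 ⟨z, rfl⟩
    have h2 : (Valued.v (HahnSeries.ofPowerSeries ℤ ℂ w) : ℤᵐ⁰) ≤ 1 :=
      (LaurentSeries.val_le_one_iff_eq_coe ℂ _).2 ⟨w, rfl⟩
    have h3 : (Valued.v Z : ℤᵐ⁰) * Valued.v (HahnSeries.ofPowerSeries ℤ ℂ w) = 1 := by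
      rw [← map_mul, hZ, ← map_mul, hw, map_one, map_one]
    refine le_antisymm h1 ?_
    rw [← h3]
    exact mul_le_of_le_one_right' h2
  refine ⟨(τ ^ m)⁻¹ * Z, (τ ^ N)⁻¹, ?_, ?_, ?_⟩
  · rw [h.eval₂_eq_sum]
    have hev := congrArg (HahnSeries.ofPowerSeries ℤ ℂ) hz
    rw [henselPoly, eval_add, eval_finsetSum, map_add, map_sum, map_zero] at hev
    have h4 : ∑ i ∈ Finset.range (N + 1), ∑ j ∈ Finset.range (m + 1),
        algebraMap ℂ (LaurentSeries ℂ) ((F.coeff i).coeff j) * (τ ^ N)⁻¹ ^ j *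
          ((τ ^ m)⁻¹ * Z) ^ i = (τ ^ (m * N))⁻¹ * 0 := by
      rw [← hev, Finset.sum_range_succ, add_comm, mul_add, Finset.mul_sum]
      congr 1
      · rw [Finset.sum_eq_single 0]
        · simp [h.coeff_top, ← hZ, mul_pow, pow_mul]
        · intro j _ hj
          simp [h.coeff_top, coeff_one, hj]
        · simp
      · refine Finset.sum_congr rfl fun i _ => ?_
        rw [eval_mul, eval_pow, eval_X, eval_C, map_mul, map_sum, Finset.sum_mul, Finset.mul_sum]
        refine Finset.sum_congr rfl fun j _ => ?_
        by_cases hc : (F.coeff i).coeff j = 0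
        · simp [hc]
        -- The weight bound makes the truncated subtraction in the exponent of `henselPoly` a
        -- genuine one.
        have hw := h.weight i j hc
        have h5 : τ ^ (m * N) = τ ^ (m * N - (m * i + N * j)) * (τ ^ m) ^ i * (τ ^ N) ^ j := by
          rw [← pow_mul, ← pow_mul, ← pow_add, ← pow_add]; congr 1; omega
        rw [h5, map_mul, map_pow, map_pow, ← hτ, ← hZ, HahnSeries.ofPowerSeries_C]
        have h6 : algebraMap ℂ (LaurentSeries ℂ) ((F.coeff i).coeff j) =
            HahnSeries.C ((F.coeff i).coeff j) := LaurentSeries.algebraMap_apply _ _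
        rw [h6, mul_pow, inv_pow, inv_pow]
        field_simp
    rw [h4, mul_zero]
  · rw [map_mul, hvZ, mul_one, map_inv₀, hvτ, ← exp_neg, neg_neg]
  · rw [map_inv₀, hvτ, ← exp_neg, neg_neg]

section Valuation

variable {L : Type*} [Field L] [Algebra ℂ L]

/-- For a valuation with a pole at `y`, a polynomial in `y` behaves as its leading term. -/
lemma valuation_aeval (v : Valuation L ℤᵐ⁰) (hv : ∀ c : ℂ, c ≠ 0 → v (algebraMap ℂ L c) = 1)
    {y : L} {k : ℤ} (hk : 0 < k) (hy : v y = exp k) {q : ℂ[X]} (hq : q ≠ 0) :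
    v (aeval y q) = exp (k * q.natDegree) := by
  have hterm : ∀ j, q.coeff j ≠ 0 → v (algebraMap ℂ L (q.coeff j) * y ^ j) = exp (k * j) := by
    intro j hj
    rw [map_mul, hv _ hj, one_mul, map_pow, hy, ← exp_nsmul]
    congr 1; simp [mul_comm]
  have hsum : aeval y q =
      ∑ j ∈ Finset.range (q.natDegree + 1), algebraMap ℂ L (q.coeff j) * y ^ j := by
    rw [aeval_eq_sum_range]
    exact Finset.sum_congr rfl fun j _ => by rw [Algebra.smul_def]
  rw [hsum, Finset.sum_range_succ, Valuation.map_add_eq_of_lt_right]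
  · exact hterm q.natDegree (by simpa using hq)
  · rw [hterm q.natDegree (by simpa using hq)]
    refine v.map_sum_lt exp_ne_zero fun j hj => ?_
    by_cases hc : q.coeff j = 0
    · simp [hc]
    rw [hterm _ hc, exp_lt_exp]
    have : (j : ℤ) < q.natDegree := by exact_mod_cast Finset.mem_range.1 hj
    nlinarith

/-- A valuation at infinity is determined, up to a scale factor, on polynomials of degree
less than `N` in `x`. -/
lemma exists_weight (hmN : Nat.Coprime m N) {g : ℂ[X][X]} (hg : g ≠ 0) (hgN : g.natDegree < N)
    (x y : L) :
    ∃ n : ℕ, ∀ (v : Valuation L ℤᵐ⁰), (∀ c : ℂ, c ≠ 0 → v (algebraMap ℂ L c) = 1) →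
      ∀ k : ℤ, 0 < k → v x = exp (m * k) → v y = exp (N * k) →
      v (g.eval₂ (aeval y : ℂ[X] →ₐ[ℂ] L).toRingHom x) = exp (k * n) := by
  obtain ⟨i₀, hi₀, hmax⟩ := Finset.exists_max_image g.support
    (fun i => m * i + N * (g.coeff i).natDegree) (by simpa using hg)
  -- The exponent is the largest weight of a monomial of `g`; it depends on `g` alone and not on the
  -- valuation.
  refine ⟨m * i₀ + N * (g.coeff i₀).natDegree, fun v hv k hk hx hy => ?_⟩
  have hN : 0 < N := by omega
  have hterm : ∀ i ∈ g.support, v (aeval y (g.coeff i) * x ^ i) =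
      exp (k * (m * i + N * (g.coeff i).natDegree : ℕ)) := by
    intro i hi
    rw [map_mul, valuation_aeval v hv (by positivity) hy (mem_support_iff.1 hi), map_pow, hx,
      ← exp_nsmul, ← exp_add]
    congr 1; push_cast; ring
  have hsum : g.eval₂ (aeval y : ℂ[X] →ₐ[ℂ] L).toRingHom x =
      ∑ i ∈ g.support, aeval y (g.coeff i) * x ^ i := Polynomial.eval₂_eq_sum
  rw [hsum, valuation_sum_eq_sup]
  · apply le_antisymm
    · refine Finset.sup_le fun i hi => ?_
      rw [hterm i hi, exp_le_exp]
      exact mul_le_mul_of_nonneg_left (by exact_mod_cast hmax i hi) hk.le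
    · rw [← hterm i₀ hi₀]
      exact Finset.le_sup (f := fun i => v (aeval y (g.coeff i) * x ^ i)) hi₀
  · intro i hi j hj hij _
    rw [hterm i hi, hterm j hj, exp_inj, mul_right_inj' hk.ne'] at hij
    have h1 := le_natDegree_of_mem_supp _ hi
    have h2 := le_natDegree_of_mem_supp _ hj
    exact eq_of_weight_eq hmN (by omega) (by omega) (by exact_mod_cast hij)

/-- No monomial of `F` strictly dominates the others at a zero of `F`. -/
lemma not_dominant (h : IsTriangular m N F) {x y : L}
    (hF : F.eval₂ (aeval y : ℂ[X] →ₐ[ℂ] L).toRingHom x = 0)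
    (v : Valuation L ℤᵐ⁰) (hv : ∀ c : ℂ, c ≠ 0 → v (algebraMap ℂ L c) = 1)
    {i₀ j₀ : ℕ} (hc : (F.coeff i₀).coeff j₀ ≠ 0) (hne : v (y ^ j₀ * x ^ i₀) ≠ 0)
    (hlt : ∀ i j, (F.coeff i).coeff j ≠ 0 → (i, j) ≠ (i₀, j₀) →
      v (y ^ j * x ^ i) < v (y ^ j₀ * x ^ i₀)) : False := by
  -- With one monomial strictly dominant, the vanishing sum would have the nonzero value of that
  -- monomial.
  rw [h.eval₂_eq_sum, ← Finset.sum_product'] at hF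
  have hmem : (i₀, j₀) ∈ Finset.range (N + 1) ×ˢ Finset.range (m + 1) := by
    have hw := h.weight _ _ hc
    have := h.m_pos
    have := h.N_pos
    simp only [Finset.mem_product, Finset.mem_range]
    constructor
    · by_contra hcon
      have : m * (N + 1) ≤ m * i₀ := Nat.mul_le_mul_left _ (by omega)
      nlinarith
    · by_contra hcon
      have : N * (m + 1) ≤ N * j₀ := Nat.mul_le_mul_left _ (by omega)
      nlinarith
  rw [← Finset.add_sum_erase _ _ hmem] at hF
  have h1 : v (algebraMap ℂ L ((F.coeff i₀).coeff j₀) * y ^ j₀ * x ^ i₀) =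
      v (y ^ j₀ * x ^ i₀) := by
    rw [mul_assoc, map_mul, hv _ hc, one_mul]
  have h2 := v.map_add_eq_of_lt_left (x := algebraMap ℂ L ((F.coeff i₀).coeff j₀) * y ^ j₀ * x ^ i₀)
    (y := ∑ p ∈ (Finset.range (N + 1) ×ˢ Finset.range (m + 1)).erase (i₀, j₀),
      algebraMap ℂ L ((F.coeff p.1).coeff p.2) * y ^ p.2 * x ^ p.1) (by
    rw [h1]
    refine v.map_sum_lt hne fun p hp => ?_
    by_cases hcp : (F.coeff p.1).coeff p.2 = 0
    · simp only [hcp, map_zero, zero_mul]; exact zero_lt_iff.2 hne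
    rw [mul_assoc, map_mul, hv _ hcp, one_mul]
    exact hlt _ _ hcp (Finset.ne_of_mem_erase hp))
  rw [hF, map_zero, h1] at h2
  exact hne h2.symm

end Valuation

end IsTriangular

/-! ### Irreducibility and the unique place at infinity -/

namespace IsTriangular

variable {m N : ℕ} {F : ℂ[X][X]}

lemma exists_rep (h : IsTriangular m N F) (a : AdjoinRoot F) :
    ∃ g : ℂ[X][X], g.natDegree < N ∧ AdjoinRoot.mk F g = a := by
  obtain ⟨g, rfl⟩ := AdjoinRoot.mk_surjective a
  refine ⟨g %ₘ F, ?_, ?_⟩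
  · have := natDegree_modByMonic_lt g h.monic (by
      rintro rfl
      have := h.natDegree
      rw [natDegree_one] at this
      exact h.N_pos.ne this)
    rwa [h.natDegree] at this
  · rw [AdjoinRoot.mk_eq_mk]
    rw [modByMonic_eq_sub_mul_div]
    exact ⟨-(g /ₘ F), by ring⟩

/-- Expansion at infinity of the regular functions on the affine curve. -/
lemma exists_embedding (h : IsTriangular m N F) :
    ∃ ι : AdjoinRoot F →+* LaurentSeries ℂ, Function.Injective ι ∧
      (Valued.v (ι (AdjoinRoot.root F)) : ℤᵐ⁰) = exp (m : ℤ) ∧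
      (Valued.v (ι (AdjoinRoot.of F X)) : ℤᵐ⁰) = exp (N : ℤ) ∧
      ∀ c : ℂ, ι (AdjoinRoot.of F (C c)) = HahnSeries.ofPowerSeries ℤ ℂ (PowerSeries.C c) := by
  obtain ⟨x, y, hF, hx, hy⟩ := h.exists_laurent
  have hC : ∀ c : ℂ, algebraMap ℂ (LaurentSeries ℂ) c =
      HahnSeries.ofPowerSeries ℤ ℂ (PowerSeries.C c) := by
    intro c
    rw [HahnSeries.ofPowerSeries_C]
    exact LaurentSeries.algebraMap_apply _ _
  have hv1 : ∀ c : ℂ, (Valued.v (algebraMap ℂ (LaurentSeries ℂ) c) : ℤᵐ⁰) ≤ 1 := fun c => by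
    rw [hC]; exact (LaurentSeries.val_le_one_iff_eq_coe ℂ _).2 ⟨_, rfl⟩
  have hv : ∀ c : ℂ, c ≠ 0 → (Valued.v (algebraMap ℂ (LaurentSeries ℂ) c) : ℤᵐ⁰) = 1 := by
    intro c hc
    refine le_antisymm (hv1 c) ?_
    have := hv1 c⁻¹
    rw [map_inv₀, map_inv₀] at this
    exact (inv_le_one₀ (zero_lt_iff.2 (by simpa using hc))).1 this
  refine ⟨AdjoinRoot.lift (aeval y : ℂ[X] →ₐ[ℂ] LaurentSeries ℂ).toRingHom x hF, ?_, ?_, ?_, ?_⟩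
  -- A nonzero class has a representative of degree less than `N` in x, whose expansion has an exact
  -- finite order by `exists_weight`.
  · rw [injective_iff_map_eq_zero]
    intro a ha
    obtain ⟨g, hgN, rfl⟩ := h.exists_rep a
    by_contra hne
    have hg : g ≠ 0 := by rintro rfl; simp at hne
    obtain ⟨n, hn⟩ := exists_weight h.coprime hg hgN x y
    have := hn Valued.v hv 1 one_pos (by simpa using hx) (by simpa using hy)
    rw [AdjoinRoot.lift_mk] at ha
    rw [ha, map_zero] at this
    exact exp_ne_zero this.symm
  · rw [AdjoinRoot.lift_root]; exact hx
  · rw [AdjoinRoot.lift_of]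
    simpa using hy
  · intro c
    rw [AdjoinRoot.lift_of]
    simpa using hC c

/-- Irreducibility of the curve: its coordinate ring embeds in the field of Laurent series. -/
lemma isDomain (h : IsTriangular m N F) : IsDomain (AdjoinRoot F) := by
  obtain ⟨ι, hι, -⟩ := h.exists_embedding
  exact hι.isDomain ι

variable [IsDomain (AdjoinRoot F)]

variable (F) in
omit [IsDomain (AdjoinRoot F)] in
lemma aeval_yFun (q : ℂ[X]) :
    aeval (yFun F) q = algebraMap (AdjoinRoot F) (FunField F) (AdjoinRoot.of F q) := by
  have h1 : (aeval (yFun F) : ℂ[X] →ₐ[ℂ] FunField F).toRingHom =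
      (algebraMap (AdjoinRoot F) (FunField F)).comp (AdjoinRoot.of F) := by
    apply Polynomial.ringHom_ext
    · intro c
      simp only [AlgHom.toRingHom_eq_coe, RingHom.coe_coe, aeval_C, RingHom.comp_apply]
      rw [IsScalarTower.algebraMap_apply ℂ (AdjoinRoot F) (FunField F)]
      rfl
    · simp [yFun]
  exact congrArg (fun f : ℂ[X] →+* FunField F => f q) h1

variable (F) in
omit [IsDomain (AdjoinRoot F)] in
lemma algebraMap_mk (g : ℂ[X][X]) :
    algebraMap (AdjoinRoot F) (FunField F) (AdjoinRoot.mk F g) =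
      g.eval₂ (aeval (yFun F) : ℂ[X] →ₐ[ℂ] FunField F).toRingHom (xFun F) := by
  have h1 : (aeval (yFun F) : ℂ[X] →ₐ[ℂ] FunField F).toRingHom =
      (algebraMap (AdjoinRoot F) (FunField F)).comp (AdjoinRoot.of F) :=
    RingHom.ext fun q => aeval_yFun F q
  rw [h1, xFun, ← hom_eval₂]
  congr 1
  conv_lhs => rw [← AdjoinRoot.aeval_eq]
  rfl

variable (F) in
omit [IsDomain (AdjoinRoot F)] in
lemma eval₂_eq_zero :
    F.eval₂ (aeval (yFun F) : ℂ[X] →ₐ[ℂ] FunField F).toRingHom (xFun F) = 0 := by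
  rw [← algebraMap_mk, AdjoinRoot.mk_self, map_zero]

/-- The place at infinity. -/
lemma exists_infinity (h : IsTriangular m N F) : ∃ P : Point (FunField F),
    P.val (xFun F) = exp (m : ℤ) ∧ P.val (yFun F) = exp (N : ℤ) ∧
    ∀ f, P.val f ≤ 1 → ∃ c, P.HasValue f c := by
  obtain ⟨ι, hι, hx, hy, hC⟩ := h.exists_embedding
  let J : FunField F →+* LaurentSeries ℂ := IsFractionRing.lift hι
  have hJ : ∀ a, J (algebraMap (AdjoinRoot F) (FunField F) a) = ι a := fun a =>
    IsFractionRing.lift_algebraMap hι a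
  have hJC : ∀ c : ℂ, J (algebraMap ℂ (FunField F) c) =
      HahnSeries.ofPowerSeries ℤ ℂ (PowerSeries.C c) := by
    intro c
    rw [IsScalarTower.algebraMap_apply ℂ (AdjoinRoot F) (FunField F), hJ, ← hC]
    rfl
  let w : Valuation (FunField F) ℤᵐ⁰ := (Valued.v (R := LaurentSeries ℂ)).comap J
  have hwx : w (xFun F) = exp (m : ℤ) := by
    rw [← hx, ← hJ]; rfl
  have hwy : w (yFun F) = exp (N : ℤ) := by
    rw [← hy, ← hJ]; rfl
  have hsurj : Function.Surjective w := by
    intro z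
    by_cases hz : z = 0
    · exact ⟨0, by simp [hz]⟩
    have hb := Nat.gcd_eq_gcd_ab m N
    rw [h.coprime.gcd_eq_one] at hb
    -- By Bézout for the coprime pair `m`, `N`, this monomial in x and y has a pole of order exactly
    -- one.
    refine ⟨(xFun F ^ (m.gcdA N) * yFun F ^ (m.gcdB N)) ^ log z, ?_⟩
    rw [map_zpow₀, map_mul, map_zpow₀, map_zpow₀, hwx, hwy, ← exp_zsmul, ← exp_zsmul, ← exp_add,
      ← exp_zsmul]
    conv_rhs => rw [← exp_log hz]
    congr 1
    simp only [smul_eq_mul]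
    push_cast at hb
    rw [mul_comm _ (m : ℤ), mul_comm _ (N : ℤ), ← hb, mul_one]
  have hwC : ∀ c : ℂ, w (algebraMap ℂ (FunField F) c) ≤ 1 := by
    intro c
    change (Valued.v (J _) : ℤᵐ⁰) ≤ 1
    rw [hJC]
    exact (LaurentSeries.val_le_one_iff_eq_coe ℂ _).2 ⟨_, rfl⟩
  refine ⟨Point.ofValuation w hsurj hwC, ?_, ?_, ?_⟩
  · rw [Point.ofValuation_val, hwx]
  · rw [Point.ofValuation_val, hwy]
  · intro f hf
    rw [Point.ofValuation_val] at hf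
    obtain ⟨G, hG⟩ := (LaurentSeries.val_le_one_iff_eq_coe ℂ (J f)).1 hf
    refine ⟨PowerSeries.constantCoeff G, ?_⟩
    rw [Point.HasValue, Point.ofValuation_val]
    change (Valued.v (J _) : ℤᵐ⁰) < 1
    rw [map_sub, hJC, ← hG, ← map_sub]
    obtain ⟨H, hH⟩ : PowerSeries.X ∣ G - PowerSeries.C (PowerSeries.constantCoeff G) := by
      rw [PowerSeries.X_dvd_iff]; simp
    rw [hH, map_mul, map_mul]
    have h1 := LaurentSeries.valuation_X_pow ℂ 1
    rw [pow_one] at h1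
    rw [h1]
    refine mul_lt_one_of_lt_of_le ?_ ((LaurentSeries.val_le_one_iff_eq_coe ℂ _).2 ⟨H, rfl⟩)
    rw [← exp_zero, exp_lt_exp]; norm_num

section Infinity

variable (h : IsTriangular m N F)
include h

/-- If y has a pole and x has none, y^m dominates every other monomial of `F`. In the converse
`hasPole_y_of_x` the dominant monomial is x^N. -/
lemma hasPole_x_of_y {p : Point (FunField F)} (hy : p.HasPole (yFun F)) :
    p.HasPole (xFun F) := by
  by_contra hx
  rw [Point.HasPole, not_lt] at hx
  have hy' : 1 < p.val (yFun F) := hy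
  have hy0 : p.val (yFun F) ≠ 0 := (zero_lt_one.trans hy').ne'
  refine h.not_dominant (eval₂_eq_zero F) p.val (fun c hc => p.val_algebraMap hc) h.lead ?_ ?_
  · simpa using fun h0 => absurd h0 (by simpa using hy0)
  · intro i j hc hij
    have hw := h.weight i j hc
    have hjm : j < m := by
      by_contra hcon
      have : N * m ≤ N * j := Nat.mul_le_mul_left _ (by omega)
      have h3 : m * i = 0 := by nlinarith
      have h4 : i = 0 := by simpa [h.m_pos.ne'] using h3
      subst h4
      have : j ≤ m := by
        have := h.N_pos
        by_contra hcon2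
        have : N * (m + 1) ≤ N * j := Nat.mul_le_mul_left _ (by omega)
        nlinarith
      exact hij (by rw [show j = m by omega])
    rw [pow_zero, mul_one, map_mul, map_pow, map_pow, map_pow]
    refine (mul_le_of_le_one_right' (pow_le_one' hx i)).trans_lt ?_
    exact pow_lt_pow_right₀ hy' hjm

lemma hasPole_y_of_x {p : Point (FunField F)} (hx : p.HasPole (xFun F)) :
    p.HasPole (yFun F) := by
  by_contra hy
  rw [Point.HasPole, not_lt] at hy
  have hx' : 1 < p.val (xFun F) := hx
  have hx0 : p.val (xFun F) ≠ 0 := (zero_lt_one.trans hx').ne'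
  refine h.not_dominant (i₀ := N) (j₀ := 0) (eval₂_eq_zero F) p.val
    (fun c hc => p.val_algebraMap hc) (by simp [h.coeff_top]) ?_ ?_
  · simpa using fun h0 => absurd h0 (by simpa using hx0)
  · intro i j hc hij
    have hw := h.weight i j hc
    have hiN : i < N := by
      by_contra hcon
      have : m * N ≤ m * i := Nat.mul_le_mul_left _ (by omega)
      have h3 : N * j = 0 := by nlinarith
      have h4 : j = 0 := by simpa [h.N_pos.ne'] using h3
      subst h4
      have : i ≤ N := by
        have := h.m_pos
        by_contra hcon2
        have : m * (N + 1) ≤ m * i := Nat.mul_le_mul_left _ (by omega)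
        nlinarith
      exact hij (by rw [show i = N by omega])
    rw [pow_zero, one_mul, map_mul, map_pow, map_pow, map_pow]
    refine (mul_le_of_le_one_left' (pow_le_one' hy j)).trans_lt ?_
    exact pow_lt_pow_right₀ hx' hiN

/-- The orders of the poles of `x` and `y` at a point at infinity. -/
lemma val_of_isAtInfinity {p : Point (FunField F)} (hp : IsAtInfinity p) :
    ∃ k : ℤ, 0 < k ∧ p.val (xFun F) = exp (m * k) ∧ p.val (yFun F) = exp (N * k) := by
  obtain ⟨hx, hy⟩ := hp
  have hx' : 1 < p.val (xFun F) := hx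
  have hy' : 1 < p.val (yFun F) := hy
  obtain ⟨a, ha⟩ : ∃ a, p.val (xFun F) = exp a :=
    ⟨_, (exp_log (zero_lt_one.trans hx').ne').symm⟩
  obtain ⟨b, hb⟩ : ∃ b, p.val (yFun F) = exp b :=
    ⟨_, (exp_log (zero_lt_one.trans hy').ne').symm⟩
  rw [ha, ← exp_zero, exp_lt_exp] at hx'
  rw [hb, ← exp_zero, exp_lt_exp] at hy'
  have hmon : ∀ i j : ℕ, p.val (yFun F ^ j * xFun F ^ i) = exp (b * j + a * i) := by
    intro i j
    rw [map_mul, map_pow, map_pow, ha, hb, ← exp_nsmul, ← exp_nsmul, ← exp_add]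
    congr 1; simp [mul_comm]
  have hm : (0 : ℤ) < m := by exact_mod_cast h.m_pos
  have hN : (0 : ℤ) < N := by exact_mod_cast h.N_pos
  -- Otherwise one of the end monomials y^m (value m b) and x^N (value N a) strictly dominates,
  -- since every other monomial lies on or below the segment joining them.
  have hab : (N : ℤ) * a = m * b := by
    rcases lt_trichotomy ((N : ℤ) * a) (m * b) with hlt | heq | hgt
    · exfalso
      refine h.not_dominant (eval₂_eq_zero F) p.val (fun c hc => p.val_algebraMap hc) h.lead
        (by rw [hmon]; exact exp_ne_zero) ?_
      intro i j hc hij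
      rw [hmon, hmon, exp_lt_exp]
      have hw : (m : ℤ) * i + N * j ≤ m * N := by exact_mod_cast h.weight i j hc
      rcases Nat.eq_zero_or_pos i with rfl | hi
      · have hjm : j ≠ m := fun hj => hij (by rw [hj])
        have hjm' : (j : ℤ) ≠ m := by exact_mod_cast hjm
        have : (j : ℤ) ≤ m := by push_cast at hw; nlinarith
        have : (j : ℤ) < m := lt_of_le_of_ne this hjm'
        push_cast; nlinarith
      · have hi' : (0 : ℤ) < i := by exact_mod_cast hi
        have h1 : N * (b * j + a * i) < N * (b * m) := by nlinarith
        push_cast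
        rw [mul_zero, add_zero]
        exact lt_of_mul_lt_mul_left h1 hN.le
    · exact heq
    · exfalso
      refine h.not_dominant (i₀ := N) (j₀ := 0) (eval₂_eq_zero F) p.val
        (fun c hc => p.val_algebraMap hc) (by simp [h.coeff_top])
        (by rw [hmon]; exact exp_ne_zero) ?_
      intro i j hc hij
      rw [hmon, hmon, exp_lt_exp]
      have hw : (m : ℤ) * i + N * j ≤ m * N := by exact_mod_cast h.weight i j hc
      rcases Nat.eq_zero_or_pos j with rfl | hj
      · have hjm : i ≠ N := fun hj => hij (by rw [hj])
        have hjm' : (i : ℤ) ≠ N := by exact_mod_cast hjm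
        have : (i : ℤ) ≤ N := by push_cast at hw; nlinarith
        have : (i : ℤ) < N := lt_of_le_of_ne this hjm'
        push_cast; nlinarith
      · have hj' : (0 : ℤ) < j := by exact_mod_cast hj
        have h1 : m * (b * j + a * i) < m * (a * N) := by nlinarith
        push_cast
        rw [mul_zero, zero_add]
        exact lt_of_mul_lt_mul_left h1 hm.le
  have hcop : IsCoprime (m : ℤ) N := Nat.isCoprime_iff_coprime.2 h.coprime
  obtain ⟨k, hk⟩ : (m : ℤ) ∣ a := hcop.dvd_of_dvd_mul_left ⟨b, hab⟩
  refine ⟨k, by nlinarith, by rw [ha, hk], ?_⟩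
  rw [hb]; congr 1
  have : (m : ℤ) * b = m * (N * k) := by rw [← hab, hk]; ring
  exact mul_left_cancel₀ hm.ne' this

/-- On the coordinate ring both valuations are positive multiples of one and the same weight, by
`exists_weight`. So functions integral at `p` are integral at `q`, and `Point.eq_of_le` applies. -/
lemma isAtInfinity_unique {p q : Point (FunField F)} (hp : IsAtInfinity p)
    (hq : IsAtInfinity q) : p = q := by
  obtain ⟨k, hk, hkx, hky⟩ := h.val_of_isAtInfinity hp
  obtain ⟨l, hl, hlx, hly⟩ := h.val_of_isAtInfinity hq
  apply Point.eq_of_le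
  intro f hf
  obtain ⟨s, t, ht, rfl⟩ := IsFractionRing.div_surjective (A := AdjoinRoot F) f
  have ht0 : t ≠ 0 := nonZeroDivisors.ne_zero ht
  by_cases hs0 : s = 0
  · simp [hs0]
  have hval : ∀ a : AdjoinRoot F, a ≠ 0 → ∃ n : ℕ,
      p.val (algebraMap _ (FunField F) a) = exp (k * n) ∧
      q.val (algebraMap _ (FunField F) a) = exp (l * n) := by
    intro a ha
    obtain ⟨g, hgN, rfl⟩ := h.exists_rep a
    have hg : g ≠ 0 := by rintro rfl; simp at ha
    obtain ⟨n, hn⟩ := exists_weight h.coprime hg hgN (xFun F) (yFun F)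
    refine ⟨n, ?_, ?_⟩ <;> rw [algebraMap_mk]
    · exact hn p.val (fun c hc => p.val_algebraMap hc) k hk hkx hky
    · exact hn q.val (fun c hc => q.val_algebraMap hc) l hl hlx hly
  obtain ⟨a, ha1, ha2⟩ := hval s hs0
  obtain ⟨b, hb1, hb2⟩ := hval t ht0
  rw [map_div₀, ha1, hb1, div_le_one₀ (by simp), exp_le_exp] at hf
  rw [map_div₀, ha2, hb2, div_le_one₀ (by simp), exp_le_exp]
  have : (a : ℤ) ≤ b := le_of_mul_le_mul_left hf hk
  exact mul_le_mul_of_nonneg_left this hl.le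

end Infinity

end IsTriangular

/-! ### Local rings of the smooth affine curve -/

/-- Evaluation of regular functions at a point of the affine curve. -/
def evalAt {F : ℂ[X][X]} {a b : ℂ} (hab : F.evalEval b a = 0) : AdjoinRoot F →+* ℂ :=
  AdjoinRoot.lift (evalRingHom b) a (by rw [eval₂_evalRingHom]; exact hab)

lemma evalAt_mk {F : ℂ[X][X]} {a b : ℂ} (hab : F.evalEval b a = 0) (g : ℂ[X][X]) :
    evalAt hab (AdjoinRoot.mk F g) = g.evalEval b a := by
  rw [evalAt, AdjoinRoot.lift_mk, eval₂_evalRingHom]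

/-- The relation `(x - a) Q + (y - b) R = 0`, where `Q` and `R` take the values `F_x`, `F_y`. -/
lemma exists_linear_relation {F : ℂ[X][X]} (hs : IsSmoothAffine F) {a b : ℂ}
    (hab : F.evalEval b a = 0) : ∃ Q R : AdjoinRoot F,
      (AdjoinRoot.root F - AdjoinRoot.of F (C a)) * Q + AdjoinRoot.of F (X - C b) * R = 0 ∧
      (evalAt hab Q ≠ 0 ∨ evalAt hab R ≠ 0) := by
  have h1 : F = (X - C (C a)) * (F /ₘ (X - C (C a))) + C (F.eval (C a)) := by
    conv_lhs => rw [← modByMonic_add_div F (X - C (C a))]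
    rw [modByMonic_X_sub_C_eq_C_eval, add_comm]
  obtain ⟨R, hR⟩ : (X - C b) ∣ F.eval (C a) := dvd_iff_isRoot.2 hab
  set Q := F /ₘ (X - C (C a)) with hQ
  refine ⟨AdjoinRoot.mk F Q, AdjoinRoot.of F R, ?_, ?_⟩
  · have h2 : (X - C (C a)) * Q + C ((X - C b) * R) = F := by rw [← hR]; exact h1.symm
    have := congrArg (AdjoinRoot.mk F) h2
    rw [AdjoinRoot.mk_self, map_add, map_mul, map_sub, AdjoinRoot.mk_X, AdjoinRoot.mk_C, AdjoinRoot.mk_C] at this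
    rw [← map_mul]; exact this
  · rcases hs a b hab with h | h
    · left
      rw [evalAt_mk]
      have h2 : F.map (evalRingHom b) = (X - C a) * Q.map (evalRingHom b) := by
        conv_lhs => rw [h1, hR]
        simp
      rw [h2, derivative_mul] at h
      simp only [derivative_sub, derivative_X, derivative_C, sub_zero, one_mul, eval_add,
        eval_mul, eval_sub, eval_X, eval_C, sub_self, zero_mul, add_zero] at h
      rwa [eval_map, eval₂_evalRingHom] at h
    · right
      rw [← AdjoinRoot.mk_C, evalAt_mk, evalEval_C]
      rw [hR, derivative_mul] at h
      simpa using h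

/-- The ideal of a point is generated by `x - a` and `y - b`. -/
lemma exists_decomp (F : ℂ[X][X]) (a b : ℂ) (g : ℂ[X][X]) : ∃ s t : AdjoinRoot F,
    AdjoinRoot.mk F g = (AdjoinRoot.root F - AdjoinRoot.of F (C a)) * s +
      AdjoinRoot.of F (X - C b) * t + AdjoinRoot.of F (C (g.evalEval b a)) := by
  have h1 : g = (X - C (C a)) * (g /ₘ (X - C (C a))) + C (g.eval (C a)) := by
    conv_lhs => rw [← modByMonic_add_div g (X - C (C a))]
    rw [modByMonic_X_sub_C_eq_C_eval, add_comm]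
  have h2 : g.eval (C a) = (X - C b) * (g.eval (C a) /ₘ (X - C b)) + C (g.evalEval b a) := by
    conv_lhs => rw [← modByMonic_add_div (g.eval (C a)) (X - C b)]
    rw [modByMonic_X_sub_C_eq_C_eval, add_comm]
  refine ⟨AdjoinRoot.mk F (g /ₘ (X - C (C a))), AdjoinRoot.of F (g.eval (C a) /ₘ (X - C b)), ?_⟩
  conv_lhs => rw [h1, h2]
  simp only [map_add, map_mul, map_sub, AdjoinRoot.mk_X, AdjoinRoot.mk_C]
  ring

section

variable {F : ℂ[X][X]} [IsDomain (AdjoinRoot F)]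

omit [IsDomain (AdjoinRoot F)] in
lemma algebraMap_of_C (c : ℂ) : algebraMap (AdjoinRoot F) (FunField F) (AdjoinRoot.of F (C c)) =
    algebraMap ℂ (FunField F) c := by
  rw [IsScalarTower.algebraMap_apply ℂ (AdjoinRoot F) (FunField F)]; rfl

lemma IsOver.hasValue_mk {p : Point (FunField F)} {a b : ℂ} (hp : IsOver p a b) (g : ℂ[X][X]) :
    p.HasValue (algebraMap (AdjoinRoot F) (FunField F) (AdjoinRoot.mk F g)) (g.evalEval b a) := by
  obtain ⟨s, t, hst⟩ := exists_decomp F a b g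
  have hreg : ∀ g : ℂ[X][X],
      p.val (algebraMap (AdjoinRoot F) (FunField F) (AdjoinRoot.mk F g)) ≤ 1 := by
    intro g
    rw [IsTriangular.algebraMap_mk, Polynomial.eval₂_eq_sum, Polynomial.sum]
    refine p.val.map_sum_le fun i _ => ?_
    rw [map_mul, map_pow]
    exact mul_le_one' (hp.2.aeval _).val_le_one (pow_le_one' hp.1.val_le_one _)
  have hreg' : ∀ s : AdjoinRoot F, p.val (algebraMap (AdjoinRoot F) (FunField F) s) ≤ 1 := by
    intro s
    obtain ⟨g, rfl⟩ := AdjoinRoot.mk_surjective s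
    exact hreg g
  rw [Point.HasValue, hst, map_add, algebraMap_of_C, add_sub_cancel_right, map_add, map_mul,
    map_mul]
  apply p.val.map_add_lt
  · rw [map_mul, map_sub, algebraMap_of_C]
    exact mul_lt_one_of_lt_of_le hp.1 (hreg' s)
  · rw [map_mul, map_sub, map_sub, algebraMap_of_C]
    exact mul_lt_one_of_lt_of_le hp.2 (hreg' t)

lemma IsOver.evalEval_eq_zero {p : Point (FunField F)} {a b : ℂ} (hp : IsOver p a b) :
    F.evalEval b a = 0 := by
  have h1 := hp.hasValue_mk F
  rw [AdjoinRoot.mk_self, map_zero] at h1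
  exact h1.unique p.hasValue_zero

lemma IsOver.hasValue {p : Point (FunField F)} {a b : ℂ} (hp : IsOver p a b)
    (hab : F.evalEval b a = 0) (s : AdjoinRoot F) :
    p.HasValue (algebraMap (AdjoinRoot F) (FunField F) s) (evalAt hab s) := by
  obtain ⟨g, rfl⟩ := AdjoinRoot.mk_surjective s
  rw [evalAt_mk]; exact hp.hasValue_mk g

/-- A smooth affine point is the centre of exactly one point, whose ring is the local ring. -/
lemma exists_point_over (hs : IsSmoothAffine F) {a b : ℂ} (hab : F.evalEval b a = 0)
    (hne : xFun F ≠ algebraMap ℂ _ a ∨ yFun F ≠ algebraMap ℂ _ b) :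
    ∃ p : Point (FunField F), IsOver p a b ∧ (∀ q, IsOver q a b → q = p) ∧
      (p.val (xFun F - algebraMap ℂ _ a) = exp (-1) ∨
        p.val (yFun F - algebraMap ℂ _ b) = exp (-1)) ∧
      ∀ f, p.val f ≤ 1 → ∃ s t : AdjoinRoot F, evalAt hab t ≠ 0 ∧
        f = algebraMap _ (FunField F) s / algebraMap _ (FunField F) t := by
  classical
  set M : Ideal (AdjoinRoot F) := RingHom.ker (evalAt hab) with hM
  have hMprime : M.IsPrime := RingHom.ker_isPrime _
  set ξ : AdjoinRoot F := AdjoinRoot.root F - AdjoinRoot.of F (C a) with hξ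
  set η : AdjoinRoot F := AdjoinRoot.of F (X - C b) with hη
  have hξ' : algebraMap _ (FunField F) ξ = xFun F - algebraMap ℂ _ a := by
    rw [hξ, map_sub, algebraMap_of_C]; rfl
  have hη' : algebraMap _ (FunField F) η = yFun F - algebraMap ℂ _ b := by
    rw [hη, map_sub, map_sub, algebraMap_of_C]; rfl
  have hξM : ξ ∈ M := by
    rw [hM, RingHom.mem_ker, hξ, ← AdjoinRoot.mk_X, ← AdjoinRoot.mk_C, ← map_sub, evalAt_mk]; simp
  have hηM : η ∈ M := by
    rw [hM, RingHom.mem_ker, hη, ← AdjoinRoot.mk_C, evalAt_mk, evalEval_C]; simp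
  have hMspan : M = Ideal.span {ξ, η} := by
    apply le_antisymm
    · intro s hs'
      obtain ⟨g, rfl⟩ := AdjoinRoot.mk_surjective s
      obtain ⟨s, t, hst⟩ := exists_decomp F a b g
      rw [hM, RingHom.mem_ker, evalAt_mk] at hs'
      rw [hst, hs', C_0, map_zero, add_zero, Ideal.mem_span_pair]
      exact ⟨s, t, by ring⟩
    · rw [Ideal.span_le]
      rintro z (rfl | rfl)
      exacts [hξM, hηM]
  have hMbot : M ≠ ⊥ := by
    intro h0
    rw [h0] at hξM hηM
    rw [Ideal.mem_bot] at hξM hηM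
    rw [hξM, map_zero] at hξ'
    rw [hηM, map_zero] at hη'
    rcases hne with h | h
    · exact h (sub_eq_zero.1 hξ'.symm)
    · exact h (sub_eq_zero.1 hη'.symm)
  -- The local ring of the affine curve at (a, b), realised inside the function field.
  set O := Localization.subalgebra.ofField (FunField F) M.primeCompl
    M.primeCompl_le_nonZeroDivisors with hO
  have hloc : IsLocalization.AtPrime O M :=
    Localization.subalgebra.isLocalization_ofField (FunField F) M.primeCompl _
  have : IsLocalRing O := IsLocalization.AtPrime.isLocalRing O M
  have : IsNoetherianRing (AdjoinRoot F) := inferInstance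
  have : IsNoetherianRing O := IsLocalization.isNoetherianRing M.primeCompl O this
  have hnf : ¬ IsField O := IsLocalization.AtPrime.not_isField (AdjoinRoot F) hMbot O
  have hmax : IsLocalRing.maximalIdeal O = Ideal.span {algebraMap _ O ξ, algebraMap _ O η} := by
    have h1 := IsLocalization.AtPrime.map_eq_maximalIdeal M O
    rw [← h1, hMspan, Ideal.map_span, Set.image_pair]
  obtain ⟨Q, R, hrel, hQR⟩ := exists_linear_relation hs hab
  have hunit : ∀ s, evalAt hab s ≠ 0 → IsUnit (algebraMap _ O s) := fun s hs' =>
    IsLocalization.map_units O (⟨s, hs'⟩ : M.primeCompl)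
  have hrelO : algebraMap _ O ξ * algebraMap _ O Q + algebraMap _ O η * algebraMap _ O R = 0 := by
    rw [← map_mul, ← map_mul, ← map_add, hrel, map_zero]
  -- By smoothness one coefficient of the linear relation between `ξ` and `η` is a unit, so one of
  -- the two generators of the maximal ideal is redundant. A Noetherian local domain with principal
  -- maximal ideal that is not a field is a discrete valuation ring.
  have hmax' : ∃ u, (u = ξ ∨ u = η) ∧
      IsLocalRing.maximalIdeal O = Ideal.span {algebraMap _ O u} := by
    rcases hQR with h | h
    · refine ⟨η, Or.inr rfl, ?_⟩
      obtain ⟨v, hv⟩ := (hunit Q h).exists_right_inv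
      have h2 : algebraMap _ O ξ = algebraMap _ O η * (-(algebraMap _ O R) * v) := by
        linear_combination v * hrelO - (algebraMap _ O ξ) * hv
      rw [hmax]
      apply le_antisymm
      · rw [Ideal.span_le]
        rintro z (rfl | rfl)
        · exact Ideal.mem_span_singleton.2 ⟨_, h2⟩
        · exact Ideal.mem_span_singleton_self _
      · exact Ideal.span_mono (by simp)
    · refine ⟨ξ, Or.inl rfl, ?_⟩
      obtain ⟨v, hv⟩ := (hunit R h).exists_right_inv
      have h2 : algebraMap _ O η = algebraMap _ O ξ * (-(algebraMap _ O Q) * v) := by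
        linear_combination v * hrelO - (algebraMap _ O η) * hv
      rw [hmax]
      apply le_antisymm
      · rw [Ideal.span_le]
        rintro z (rfl | rfl)
        · exact Ideal.mem_span_singleton_self _
        · exact Ideal.mem_span_singleton.2 ⟨_, h2⟩
      · exact Ideal.span_mono (by simp)
  obtain ⟨u, hu, hmaxu⟩ := hmax'
  have hdvr : IsDiscreteValuationRing O :=
    by
    have hpr : (IsLocalRing.maximalIdeal O).IsPrincipal := ⟨⟨_, hmaxu⟩⟩
    exact ((IsDiscreteValuationRing.TFAE O hnf).out 0 4).2 hpr
  set w := (IsDiscreteValuationRing.maximalIdeal O).valuation (FunField F) with hw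
  have hsurj : Function.Surjective w := by
    intro z
    obtain ⟨π, hπ⟩ := (IsDiscreteValuationRing.maximalIdeal O).valuation_exists_uniformizer
      (FunField F)
    by_cases hz : z = 0
    · exact ⟨0, by simp [hz]⟩
    refine ⟨π ^ (-log z), ?_⟩
    rw [map_zpow₀, hw, hπ]
    rw [← exp_zsmul]
    simp [exp_log hz]
  have hwO : ∀ s : AdjoinRoot F, w (algebraMap _ (FunField F) s) ≤ 1 := fun s =>
    (IsDiscreteValuationRing.maximalIdeal O).valuation_le_one (algebraMap _ O s)
  have hwM : ∀ s ∈ M, w (algebraMap _ (FunField F) s) < 1 := by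
    intro s hs'
    refine ((IsDiscreteValuationRing.maximalIdeal O).valuation_lt_one_iff_mem
      (algebraMap _ O s)).2 ?_
    change algebraMap _ O s ∈ IsLocalRing.maximalIdeal O
    rw [← IsLocalization.AtPrime.map_eq_maximalIdeal M O]
    exact Ideal.mem_map_of_mem _ hs'
  have hwC : ∀ c : ℂ, w (algebraMap ℂ (FunField F) c) ≤ 1 := fun c => by
    rw [← algebraMap_of_C]; exact hwO _
  set p := Point.ofValuation w hsurj hwC with hp
  have hpw : ∀ f, p.val f = w f := Point.ofValuation_val w hsurj hwC
  have hfrac : ∀ f, p.val f ≤ 1 → ∃ s t : AdjoinRoot F, evalAt hab t ≠ 0 ∧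
        f = algebraMap _ (FunField F) s / algebraMap _ (FunField F) t := by
    intro f hf
    rw [hpw] at hf
    obtain ⟨o, rfl⟩ := IsDiscreteValuationRing.exists_lift_of_le_one hf
    obtain ⟨⟨s, t⟩, hst⟩ := IsLocalization.surj M.primeCompl o
    refine ⟨s, t, t.2, ?_⟩
    have ht0 : algebraMap _ (FunField F) (t : AdjoinRoot F) ≠ 0 := by
      intro h0
      have : (t : AdjoinRoot F) = 0 := by simpa using h0
      exact t.2 (by rw [this]; exact M.zero_mem)
    rw [eq_div_iff ht0]
    exact congrArg (algebraMap O (FunField F)) hst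
  have hover : IsOver p a b := by
    constructor
    · rw [Point.HasValue, ← hξ', hpw]; exact hwM _ hξM
    · rw [Point.HasValue, ← hη', hpw]; exact hwM _ hηM
  refine ⟨p, hover, ?_, ?_, hfrac⟩
  -- The ring of any point over (a, b) contains `O`, because denominators do not vanish at (a, b); a
  -- discrete valuation ring is maximal, so the two rings agree.
  · intro q hq
    refine (Point.eq_of_le fun f hf => ?_).symm
    obtain ⟨s, t, ht, rfl⟩ := hfrac f hf
    have h1 := (hq.hasValue hab s).mul ((hq.hasValue hab t).inv ht)
    rw [div_eq_mul_inv]; exact h1.val_le_one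
  · have h1 : p.val (algebraMap _ (FunField F) u) = exp (-1) := by
      rw [hpw]
      have hu0 : algebraMap _ O u ≠ 0 := by
        intro h0
        rw [h0, Ideal.span_singleton_eq_bot.2 rfl, ← IsLocalRing.isField_iff_maximalIdeal_eq]
          at hmaxu
        exact hnf hmaxu
      have h2 := (IsDiscreteValuationRing.maximalIdeal O).intValuation_singleton hu0 hmaxu
      rw [← h2]
      exact (IsDiscreteValuationRing.maximalIdeal O).valuation_of_algebraMap (algebraMap _ O u)
    rcases hu with rfl | rfl
    · left; rw [← hξ']; exact h1
    · right; rw [← hη']; exact h1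

end

/-! ### Centres of points, zeros and poles, approximation -/

/-- A root of `q` among the constants is the value of a regular function annihilated by `q` at the
point `p`. -/
lemma Point.exists_root_hasValue {𝕂 : Type*} [Field 𝕂] [Algebra ℂ 𝕂] {p : Point 𝕂} {f : 𝕂}
    {q : ℂ[X]} (hq : q ≠ 0) (hf : p.val f ≤ 1) (h : p.val (aeval f q) < 1) :
    ∃ c, q.IsRoot c ∧ p.HasValue f c := by
  by_contra! hcon
  have hsp := (IsAlgClosed.splits q).eq_prod_roots
  rw [hsp, map_mul, aeval_C, map_mul, p.val_algebraMap (by simpa using hq), one_mul,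
    map_multiset_prod, map_multiset_prod, Multiset.map_map, Multiset.map_map] at h
  refine h.ne (Multiset.prod_eq_one fun z hz => ?_)
  obtain ⟨c, hc, rfl⟩ := Multiset.mem_map.1 hz
  have h1 := hcon c ((mem_roots hq).1 hc)
  rw [Point.HasValue, not_lt] at h1
  simp only [Function.comp_apply, map_sub, aeval_X, aeval_C]
  refine le_antisymm ?_ h1
  exact (p.val.map_sub _ _).trans (max_le hf (p.val_algebraMap_le_one c))

namespace IsTriangular

variable {m N : ℕ} {F : ℂ[X][X]}

/-- A regular function divides a nonzero polynomial in `y`. -/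
lemma exists_mul_eq_of (h : IsTriangular m N F) [IsDomain (AdjoinRoot F)] {f : AdjoinRoot F}
    (hf : f ≠ 0) : ∃ (g : AdjoinRoot F) (q : ℂ[X]), q ≠ 0 ∧ f * g = AdjoinRoot.of F q := by
  have hfin : Module.Finite ℂ[X] (AdjoinRoot F) := h.monic.finite_adjoinRoot
  have h1 := Ideal.comap_ne_bot_of_integral_mem (R := ℂ[X]) (I := Ideal.span {f}) hf
    (Ideal.mem_span_singleton_self f) (Algebra.IsIntegral.isIntegral f)
  obtain ⟨q, hq, hq0⟩ := Submodule.exists_mem_ne_zero_of_ne_bot h1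
  obtain ⟨g, hg⟩ := Ideal.mem_span_singleton.1 (Ideal.mem_comap.1 hq)
  exact ⟨g, q, hq0, hg.symm⟩

variable [IsDomain (AdjoinRoot F)] (h : IsTriangular m N F) (hs : IsSmoothAffine F)
include h

/-- The function y has a pole at infinity. This discharges the non-constancy hypothesis of
`exists_point_over`. -/
lemma yFun_ne (b : ℂ) : yFun F ≠ algebraMap ℂ _ b := by
  intro hb
  obtain ⟨P, -, hy, -⟩ := h.exists_infinity
  have := P.val_algebraMap_le_one b
  rw [← hb, hy, ← exp_zero, exp_le_exp] at this
  have := h.N_pos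
  omega

lemma val_le_one_of_not_isAtInfinity {p : Point (FunField F)} (hp : ¬ IsAtInfinity p) :
    p.val (xFun F) ≤ 1 ∧ p.val (yFun F) ≤ 1 := by
  constructor
  · by_contra hx
    exact hp ⟨not_le.1 hx, h.hasPole_y_of_x (not_le.1 hx)⟩
  · by_contra hy
    exact hp ⟨h.hasPole_x_of_y (not_le.1 hy), not_le.1 hy⟩

lemma val_regular_le_one {p : Point (FunField F)} (hp : ¬ IsAtInfinity p) (s : AdjoinRoot F) :
    p.val (algebraMap _ (FunField F) s) ≤ 1 := by
  obtain ⟨hx, hy⟩ := h.val_le_one_of_not_isAtInfinity hp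
  obtain ⟨g, rfl⟩ := AdjoinRoot.mk_surjective s
  rw [algebraMap_mk, Polynomial.eval₂_eq_sum, Polynomial.sum]
  refine p.val.map_sum_le fun i _ => ?_
  rw [map_mul, map_pow]
  refine mul_le_one' ?_ (pow_le_one' hx _)
  change p.val (aeval (yFun F) (g.coeff i)) ≤ 1
  rw [aeval_eq_sum_range]
  refine p.val.map_sum_le fun j _ => (p.val_smul_le _ _).trans ?_
  rw [map_pow]; exact pow_le_one' hy _

/-- Every point that is not at infinity lies over a point of the affine curve. -/
lemma exists_isOver {p : Point (FunField F)} (hp : ¬ IsAtInfinity p) :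
    ∃ a b : ℂ, IsOver p a b := by
  obtain ⟨hx, hy⟩ := h.val_le_one_of_not_isAtInfinity hp
  -- If y took no value in ℂ, every nonzero polynomial in y would be a unit at `p`. Each nonzero
  -- regular function divides such a polynomial, so the valuation would be trivial.
  obtain ⟨b, hb⟩ : ∃ b, p.HasValue (yFun F) b := by
    by_contra! hcon
    have hq1 : ∀ q : ℂ[X], q ≠ 0 → p.val (aeval (yFun F) q) = 1 := by
      intro q hq
      refine le_antisymm ?_ (not_lt.1 fun hlt => ?_)
      · rw [aeval_yFun]; exact h.val_regular_le_one hp _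
      · obtain ⟨c, -, hc⟩ := Point.exists_root_hasValue hq hy hlt
        exact hcon c hc
    have hf1 : ∀ f : AdjoinRoot F, f ≠ 0 → p.val (algebraMap _ (FunField F) f) = 1 := by
      intro f hf
      obtain ⟨g, q, hq, hg⟩ := h.exists_mul_eq_of hf
      have h1 := hq1 q hq
      rw [aeval_yFun, ← hg, map_mul, map_mul] at h1
      refine le_antisymm (h.val_regular_le_one hp f) ?_
      rw [← h1]
      exact mul_le_of_le_one_right' (h.val_regular_le_one hp g)
    obtain ⟨u, hu⟩ := p.exists_uniformizer
    obtain ⟨s, t, ht, rfl⟩ := IsFractionRing.div_surjective (A := AdjoinRoot F) u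
    have hs0 : s ≠ 0 := by
      rintro rfl
      rw [map_zero, zero_div, map_zero] at hu
      exact exp_ne_zero hu.symm
    rw [map_div₀, hf1 s hs0, hf1 t (nonZeroDivisors.ne_zero ht), div_one, ← exp_zero,
      exp_inj] at hu
    omega
  have hF0 : F.map (evalRingHom b) ≠ 0 := (h.monic.map _).ne_zero
  -- Replacing y by its value b in F(x, y) = 0 changes the left side by an element of the maximal
  -- ideal, so the value of x is a root of F(·, b).
  obtain ⟨a, -, ha⟩ := Point.exists_root_hasValue (p := p) (f := xFun F) hF0 hx (by
    have h1 := eval₂_eq_zero F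
    have h2 : aeval (xFun F) (F.map (evalRingHom b)) =
        F.eval₂ ((algebraMap ℂ (FunField F)).comp (evalRingHom b)) (xFun F) := by
      rw [aeval_def, eval₂_map]
    have h3 : aeval (xFun F) (F.map (evalRingHom b)) =
        - ∑ i ∈ F.support, (aeval (yFun F) (F.coeff i) - algebraMap ℂ _ ((F.coeff i).eval b)) *
          xFun F ^ i := by
      rw [h2, ← sub_zero (eval₂ _ _ _), ← h1, Polynomial.eval₂_eq_sum, Polynomial.eval₂_eq_sum,
        Polynomial.sum, Polynomial.sum, ← Finset.sum_sub_distrib, ← Finset.sum_neg_distrib]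
      refine Finset.sum_congr rfl fun i _ => ?_
      simp only [RingHom.comp_apply, coe_evalRingHom, AlgHom.toRingHom_eq_coe, RingHom.coe_coe]
      ring
    rw [h3, Valuation.map_neg]
    refine p.val.map_sum_lt one_ne_zero fun i _ => ?_
    rw [map_mul, map_pow]
    exact mul_lt_one_of_lt_of_le (hb.aeval _) (pow_le_one' hx i))
  exact ⟨a, b, ha, hb⟩

include hs

lemma isOver_unique {p q : Point (FunField F)} {a b : ℂ} (hp : IsOver p a b) (hq : IsOver q a b) :
    p = q := by
  obtain ⟨r, -, hr, -⟩ := exists_point_over hs hp.evalEval_eq_zero (Or.inr (h.yFun_ne b))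
  rw [hr p hp, hr q hq]

lemma exists_isOver_of_evalEval {a b : ℂ} (hab : F.evalEval b a = 0) :
    ∃ p : Point (FunField F), IsOver p a b := by
  obtain ⟨r, hr, -⟩ := exists_point_over hs hab (Or.inr (h.yFun_ne b))
  exact ⟨r, hr⟩

/-- One of the functions `x - a`, `y - b` is a uniformizer. -/
lemma uniformizer_of_isOver {p : Point (FunField F)} {a b : ℂ} (hp : IsOver p a b) :
    p.val (xFun F - algebraMap ℂ _ a) = exp (-1) ∨
      p.val (yFun F - algebraMap ℂ _ b) = exp (-1) := by
  obtain ⟨r, -, hr, hu, -⟩ := exists_point_over hs hp.evalEval_eq_zero (Or.inr (h.yFun_ne b))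
  rw [hr p hp]; exact hu

lemma exists_frac {p : Point (FunField F)} {a b : ℂ} (hp : IsOver p a b) {f : FunField F}
    (hf : p.val f ≤ 1) : ∃ s t : AdjoinRoot F, evalAt hp.evalEval_eq_zero t ≠ 0 ∧
        f = algebraMap _ (FunField F) s / algebraMap _ (FunField F) t := by
  obtain ⟨r, -, hr, -, hfr⟩ := exists_point_over hs hp.evalEval_eq_zero (Or.inr (h.yFun_ne b))
  rw [hr p hp] at hf; exact hfr f hf

/-- The residue fields are `ℂ`. -/
lemma exists_hasValue (p : Point (FunField F)) {f : FunField F} (hf : p.val f ≤ 1) :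
    ∃ c, p.HasValue f c := by
  by_cases hp : IsAtInfinity p
  · obtain ⟨P, hx, hy, hP⟩ := h.exists_infinity
    have hP' : IsAtInfinity P := by
      constructor
      · rw [Point.HasPole, hx, ← exp_zero, exp_lt_exp]; exact_mod_cast h.m_pos
      · rw [Point.HasPole, hy, ← exp_zero, exp_lt_exp]; exact_mod_cast h.N_pos
    rw [h.isAtInfinity_unique hp hP'] at hf ⊢
    exact hP f hf
  · obtain ⟨a, b, hab⟩ := h.exists_isOver hp
    obtain ⟨s, t, ht, rfl⟩ := h.exists_frac hs hab hf
    rw [div_eq_mul_inv]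
    exact ⟨_, (hab.hasValue hab.evalEval_eq_zero s).mul
      ((hab.hasValue hab.evalEval_eq_zero t).inv ht)⟩

/-- As `f` divides some nonzero q(y), the value of y at a zero of `f` is a root of q. Over each root
lie finitely many pairs (a, b), and each is the centre of at most one point. -/
lemma finite_zeros_regular {f : AdjoinRoot F} (hf : f ≠ 0) :
    {p : Point (FunField F) | ¬ IsAtInfinity p ∧ p.val (algebraMap _ (FunField F) f) < 1}.Finite := by
  obtain ⟨g, q, hq, hg⟩ := h.exists_mul_eq_of hf
  have hfin : ((q.roots.toFinset : Set ℂ) ×ˢ Set.univ ∩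
      {z : ℂ × ℂ | F.evalEval z.1 z.2 = 0}).Finite := by
    have : ((q.roots.toFinset : Set ℂ) ×ˢ Set.univ ∩ {z : ℂ × ℂ | F.evalEval z.1 z.2 = 0}) ⊆
        ⋃ b ∈ (q.roots.toFinset : Set ℂ),
          (fun a => (b, a)) '' ((F.map (evalRingHom b)).roots.toFinset : Set ℂ) := by
      rintro ⟨b, a⟩ ⟨⟨hb, -⟩, hab⟩
      simp only [Set.mem_iUnion]
      refine ⟨b, hb, a, ?_, rfl⟩
      have h0 : F.map (evalRingHom b) ≠ 0 := (h.monic.map _).ne_zero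
      simp only [Finset.mem_coe, Multiset.mem_toFinset, mem_roots h0, IsRoot, eval_map,
        eval₂_evalRingHom]
      exact hab
    refine Set.Finite.subset ?_ this
    exact (Finset.finite_toSet _).biUnion fun b _ => (Finset.finite_toSet _).image _
  classical
  have hchoice : ∀ z : ℂ × ℂ, ∃ S : Set (Point (FunField F)), S.Finite ∧
      ∀ p, IsOver p z.2 z.1 → p ∈ S := by
    intro z
    by_cases hz : ∃ p : Point (FunField F), IsOver p z.2 z.1
    · obtain ⟨p, hp⟩ := hz
      exact ⟨{p}, Set.finite_singleton p, fun r hr => h.isOver_unique hs hr hp⟩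
    · push Not at hz
      exact ⟨∅, Set.finite_empty, fun r hr => (hz r hr).elim⟩
  choose S hSfin hS using hchoice
  refine (hfin.biUnion fun z _ => hSfin z).subset ?_
  rintro p ⟨hp, hlt⟩
  obtain ⟨a, b, hab⟩ := h.exists_isOver hp
  simp only [Set.mem_iUnion]
  refine ⟨(b, a), ⟨⟨?_, Set.mem_univ _⟩, hab.evalEval_eq_zero⟩, hS (b, a) p hab⟩
  have h1 : p.val (aeval (yFun F) q) < 1 := by
    rw [aeval_yFun, ← hg, map_mul, map_mul]
    exact mul_lt_one_of_lt_of_le hlt (h.val_regular_le_one hp g)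
  have h2 := (hab.2.aeval q).unique ((p.hasValue_zero_iff _).2 h1)
  simp [hq, h2]

/-- A nonzero function has finitely many zeros and poles. -/
lemma finite_val_ne_one {f : FunField F} (hf : f ≠ 0) : {p : Point (FunField F) | p.val f ≠ 1}.Finite := by
  obtain ⟨s, t, ht, rfl⟩ := IsFractionRing.div_surjective (A := AdjoinRoot F) f
  have ht0 : t ≠ 0 := nonZeroDivisors.ne_zero ht
  have hs0 : s ≠ 0 := by rintro rfl; simp at hf
  have hinf : {p : Point (FunField F) | IsAtInfinity p}.Finite :=
    Set.Subsingleton.finite fun p hp q hq => h.isAtInfinity_unique hp hq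
  refine ((hinf.union (h.finite_zeros_regular hs hs0)).union
    (h.finite_zeros_regular hs ht0)).subset ?_
  intro p hp
  by_cases hpi : IsAtInfinity p
  · exact Or.inl (Or.inl hpi)
  by_cases h1 : p.val (algebraMap _ (FunField F) s) < 1
  · exact Or.inl (Or.inr ⟨hpi, h1⟩)
  by_cases h2 : p.val (algebraMap _ (FunField F) t) < 1
  · exact Or.inr ⟨hpi, h2⟩
  exfalso
  apply hp
  rw [map_div₀, le_antisymm (h.val_regular_le_one hpi s) (not_lt.1 h1),
    le_antisymm (h.val_regular_le_one hpi t) (not_lt.1 h2), div_one]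

/-- A regular function that separates a point from finitely many others. -/
lemma exists_separating {p : Point (FunField F)} (hp : ¬ IsAtInfinity p)
    (T : Finset (Point (FunField F))) (hT : ∀ q ∈ T, q ≠ p ∧ ¬ IsAtInfinity q)
    (n : Point (FunField F) → ℕ) :
    ∃ l : FunField F, p.val l = 1 ∧ (∀ q, ¬ IsAtInfinity q → q.val l ≤ 1) ∧
      ∀ q ∈ T, q.val l ≤ exp (-(n q : ℤ)) := by
  classical
  have hpair : ∀ q, q ≠ p → ¬ IsAtInfinity q → ∃ l : AdjoinRoot F,
      p.val (algebraMap _ (FunField F) l) = 1 ∧ q.val (algebraMap _ (FunField F) l) ≤ exp (-1) := by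
    intro q hqp hq
    obtain ⟨a, b, hab⟩ := h.exists_isOver hp
    obtain ⟨a', b', hab'⟩ := h.exists_isOver hq
    have lt_iff : ∀ z : ℤᵐ⁰, z < 1 → z ≤ exp (-1) := by
      intro z hz1
      by_cases hz : z = 0
      · simp [hz]
      rw [← exp_log hz, ← exp_zero, exp_lt_exp] at hz1
      rw [← exp_log hz, exp_le_exp]; omega
    by_cases ha : a = a'
    · have hb : b ≠ b' := by
        rintro rfl; subst ha; exact hqp (h.isOver_unique hs hab' hab)
      refine ⟨AdjoinRoot.of F (X - C b'), ?_, lt_iff _ ?_⟩ <;>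
        rw [map_sub, map_sub, algebraMap_of_C]
      · exact (hab.2.sub (p.hasValue_algebraMap b')).val_eq_one (sub_ne_zero.2 hb)
      · exact hab'.2
    · refine ⟨AdjoinRoot.root F - AdjoinRoot.of F (C a'), ?_, lt_iff _ ?_⟩ <;>
        rw [map_sub, algebraMap_of_C]
      · exact (hab.1.sub (p.hasValue_algebraMap a')).val_eq_one (sub_ne_zero.2 ha)
      · exact hab'.1
  induction T using Finset.induction_on with
  | empty => exact ⟨1, by simp, by simp, by simp⟩
  | insert q T hqT ih =>
    obtain ⟨l, hl1, hl2, hl3⟩ := ih fun r hr => hT r (by simp [hr])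
    obtain ⟨k, hk1, hk2⟩ := hpair q (hT q (by simp)).1 (hT q (by simp)).2
    refine ⟨(algebraMap _ (FunField F) k) ^ n q * l, by simp [hk1, hl1], ?_, ?_⟩
    · intro r hr
      rw [map_mul, map_pow]
      exact mul_le_one' (pow_le_one' (h.val_regular_le_one hr k) _) (hl2 r hr)
    · intro r hr
      rw [map_mul, map_pow]
      rcases Finset.mem_insert.1 hr with rfl | hr'
      · refine (mul_le_of_le_one_right' (hl2 r (hT r hr).2)).trans ?_
        refine (pow_le_pow_left' hk2 _).trans ?_
        rw [← exp_nsmul]; simp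
      · refine (mul_le_of_le_one_left' ?_).trans (hl3 r hr')
        exact pow_le_one' (h.val_regular_le_one (hT r hr).2 k) _

/-- A function with prescribed order at one point and prescribed bounds at all others, except at
infinity. -/
lemma exists_exact_order {p : Point (FunField F)} (hp : ¬ IsAtInfinity p)
    (D : Divisor (FunField F)) : ∃ g : FunField F, p.val g = exp (D p) ∧
      ∀ q, ¬ IsAtInfinity q → q.val g ≤ exp (D q) := by
  classical
  obtain ⟨u, hu⟩ := p.exists_uniformizer
  have hu0 : u ≠ 0 := p.ne_zero_of_val_eq_exp hu
  set g₀ := u ^ (-(D p)) with hg₀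
  have hg0 : g₀ ≠ 0 := zpow_ne_zero _ hu0
  have hpg : p.val g₀ = exp (D p) := by
    rw [hg₀, map_zpow₀, hu, ← exp_zsmul]; simp
  -- The affine points other than `p` where `g₀` may violate the bound; the factor `l` supplies
  -- enough zeros there without disturbing `p`.
  set T := (((h.finite_val_ne_one hs hg0).toFinset ∪ D.support).erase p).filter
    fun q : Point (FunField F) => ¬ IsAtInfinity q with hT
  obtain ⟨l, hl1, hl2, hl3⟩ := h.exists_separating hs hp T
    (fun q hq => by
      rw [hT, Finset.mem_filter] at hq
      exact ⟨Finset.ne_of_mem_erase hq.1, hq.2⟩)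
    (fun q => (log (q.val g₀) - D q).toNat)
  refine ⟨g₀ * l, by rw [map_mul, hl1, hpg, mul_one], fun q hq => ?_⟩
  rw [map_mul]
  by_cases hqp : q = p
  · rw [hqp, hl1, hpg, mul_one]
  by_cases hqT : q ∈ T
  · have h1 := hl3 q hqT
    have hq0 : q.val g₀ ≠ 0 := by simpa using hg0
    obtain ⟨c, hc⟩ : ∃ c, q.val g₀ = exp c := ⟨_, (exp_log hq0).symm⟩
    rw [hc, log_exp] at h1
    rw [hc]
    refine (mul_le_mul_right h1 _).trans ?_
    rw [← exp_add, exp_le_exp]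
    have := Int.self_le_toNat (c - D q)
    omega
  · have h1 : q ∉ ((h.finite_val_ne_one hs hg0).toFinset ∪ D.support) := by
      intro hmem
      exact hqT (Finset.mem_filter.2 ⟨Finset.mem_erase.2 ⟨hqp, hmem⟩, hq⟩)
    simp only [Finset.mem_union, Set.Finite.mem_toFinset, Set.mem_ofPred_eq, Finsupp.mem_support_iff,
      not_or, not_not] at h1
    rw [h1.1, h1.2, one_mul, exp_zero]
    exact hl2 q hq

omit hs in
/-- A proper ideal containing a nonzero element vanishes at some point. -/
lemma exists_point_of_ne_top {I : Ideal (AdjoinRoot F)} (hI : I ≠ ⊤) {f : AdjoinRoot F}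
    (hf : f ≠ 0) (hfI : f ∈ I) : ∃ (a b : ℂ) (hab : F.evalEval b a = 0),
      ∀ s ∈ I, evalAt hab s = 0 := by
  obtain ⟨M, hM, hIM⟩ := Ideal.exists_le_maximal I hI
  have hMp := hM.isPrime
  -- A Nullstellensatz by hand: over ℂ a polynomial splits, so a prime ideal containing its image
  -- contains the image of a linear factor.
  have hroot : ∀ (φ : ℂ[X] →+* AdjoinRoot F) (q : ℂ[X]), q ≠ 0 →
      (∀ c : ℂ, c ≠ 0 → φ (C c) ∉ M) → φ q ∈ M → ∃ c, φ (X - C c) ∈ M := by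
    intro φ q hq hc hqM
    have hsp := (IsAlgClosed.splits q).eq_prod_roots
    rw [hsp, map_mul, map_multiset_prod, Multiset.map_map] at hqM
    rcases hMp.mem_or_mem hqM with h1 | h1
    · exact (hc _ (by simpa using hq) h1).elim
    · obtain ⟨z, hz, hzM⟩ := (hMp.multiset_prod_mem_iff_exists_mem _).1 h1
      obtain ⟨c, -, rfl⟩ := Multiset.mem_map.1 hz
      exact ⟨c, hzM⟩
  have hconst : ∀ c : ℂ, c ≠ 0 → AdjoinRoot.of F (C c) ∉ M := by
    intro c hc hcM
    refine hM.ne_top (M.eq_top_of_isUnit_mem hcM ?_)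
    exact ((isUnit_C.2 (isUnit_iff_ne_zero.2 hc)).map (AdjoinRoot.of F))
  obtain ⟨g, q, hq, hg⟩ := h.exists_mul_eq_of hf
  obtain ⟨b, hb⟩ := hroot (AdjoinRoot.of F) q hq hconst (by
    rw [← hg]; exact M.mul_mem_right _ (hIM hfI))
  -- Substitution of x for the variable. Since F(x, b) ≡ F(x, y) = 0 modulo y - b, the element F(x,
  -- b) lies in `M`.
  set ψ : ℂ[X] →+* AdjoinRoot F := (AdjoinRoot.mk F).comp (mapRingHom C) with hψ
  have hψC : ∀ c : ℂ, ψ (C c) = AdjoinRoot.of F (C c) := by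
    intro c; simp [hψ]
  have hψX : ψ X = AdjoinRoot.root F := by simp [hψ]
  obtain ⟨a, ha⟩ := hroot ψ (F.map (evalRingHom b)) (h.monic.map _).ne_zero
    (fun c hc => by rw [hψC]; exact hconst c hc) (by
      have h1 : AdjoinRoot.mk F ((F.map (evalRingHom b)).map C) =
          AdjoinRoot.mk F (((F.map (evalRingHom b)).map C) - F) := by
        rw [map_sub, AdjoinRoot.mk_self, sub_zero]
      have h2 : (C (X - C b) : ℂ[X][X]) ∣ ((F.map (evalRingHom b)).map C) - F := by
        rw [C_dvd_iff_dvd_coeff]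
        intro i
        rw [coeff_sub, coeff_map, coeff_map, ← dvd_neg, neg_sub, coe_evalRingHom]
        exact X_sub_C_dvd_sub_C_eval
      obtain ⟨G, hG⟩ := h2
      change AdjoinRoot.mk F ((F.map (evalRingHom b)).map C) ∈ M
      rw [h1, hG, map_mul, AdjoinRoot.mk_C]
      exact M.mul_mem_right _ hb)
  rw [map_sub, hψC, hψX] at ha
  have hmem : ∀ g : ℂ[X][X], AdjoinRoot.mk F g ∈ M → g.evalEval b a = 0 := by
    intro g hgM
    obtain ⟨s, t, hst⟩ := exists_decomp F a b g
    by_contra hne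
    refine hconst _ hne ?_
    have h3 : AdjoinRoot.of F (C (g.evalEval b a)) = AdjoinRoot.mk F g -
        ((AdjoinRoot.root F - AdjoinRoot.of F (C a)) * s + AdjoinRoot.of F (X - C b) * t) := by
      rw [hst]; ring
    rw [h3]
    exact M.sub_mem hgM (M.add_mem (M.mul_mem_right _ ha) (M.mul_mem_right _ hb))
  refine ⟨a, b, hmem F (by rw [AdjoinRoot.mk_self]; exact M.zero_mem), fun s hsI => ?_⟩
  obtain ⟨g, rfl⟩ := AdjoinRoot.mk_surjective s
  rw [evalAt_mk]
  exact hmem g (hIM hsI)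

end IsTriangular

/-! ### Riemann–Roch spaces and the genus -/

section

variable {𝕂 : Type*} [Field 𝕂] [Algebra ℂ 𝕂]

lemma degree_add (D E : Divisor 𝕂) : degree (D + E) = degree D + degree E :=
  Finsupp.sum_add_index' (fun _ => rfl) (fun _ _ _ => rfl)

lemma degree_single (p : Point 𝕂) (n : ℤ) : degree (Finsupp.single p n) = n :=
  Finsupp.sum_single_index rfl

lemma rrSpace_mono {D E : Divisor 𝕂} (h : D ≤ E) : rrSpace D ≤ rrSpace E := fun _ hf p =>
  (hf p).trans (exp_le_exp.2 (h p))

lemma lt_exp_add_one_iff {z : ℤᵐ⁰} {n : ℤ} : z < exp (n + 1) ↔ z ≤ exp n := by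
  by_cases hz : z = 0
  · subst hz; simp
  rw [← exp_log hz, exp_lt_exp, exp_le_exp]; omega

/-- `deg D + 1 - ℓ(D)`. -/
def defect (D : Divisor 𝕂) : ℤ := degree D + 1 - Module.finrank ℂ (rrSpace D)

lemma mem_rrSpace_of_add_single {D : Divisor 𝕂} {p : Point 𝕂} {f : 𝕂}
    (hf : f ∈ rrSpace (D + Finsupp.single p 1)) (hp : p.val f ≤ exp (D p)) : f ∈ rrSpace D := by
  classical
  intro q
  by_cases hq : q = p
  · rw [hq]; exact hp
  · have := hf q
    rwa [Finsupp.add_apply, Finsupp.single_eq_of_ne hq, add_zero] at this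

/-- If the residue field is `ℂ`, allowing one more pole adds at most one dimension. -/
lemma rrSpace_add_single {D : Divisor 𝕂} {p : Point 𝕂}
    (hp : ∀ f, p.val f ≤ 1 → ∃ c, p.HasValue f c) {g : 𝕂}
    (hg : g ∈ rrSpace (D + Finsupp.single p 1)) (hgp : p.val g = exp (D p + 1)) :
    rrSpace (D + Finsupp.single p 1) = rrSpace D ⊔ Submodule.span ℂ {g} := by
  classical
  apply le_antisymm
  · intro f hf
    have hg0 : g ≠ 0 := p.ne_zero_of_val_eq_exp hgp
    obtain ⟨c, hc⟩ := hp (f / g) (by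
      rw [map_div₀, div_le_one₀ (zero_lt_iff.2 (by simpa using hg0)), hgp]
      simpa using hf p)
    have h1 : f - c • g ∈ rrSpace D := by
      refine mem_rrSpace_of_add_single (p := p)
        (Submodule.sub_mem _ hf (Submodule.smul_mem _ _ hg)) ?_
      have h2 : f - c • g = (f / g - algebraMap ℂ 𝕂 c) * g := by
        rw [Algebra.smul_def]; field_simp
      rw [← lt_exp_add_one_iff, h2, map_mul, hgp]
      exact mul_lt_of_lt_one_left (zero_lt_iff.2 exp_ne_zero) hc
    rw [← sub_add_cancel f (c • g)]
    exact Submodule.add_mem_sup h1 (Submodule.smul_mem _ _ (Submodule.mem_span_singleton_self g))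
  · refine sup_le (rrSpace_mono ?_) ?_
    · simp
    · rw [Submodule.span_singleton_le_iff_mem]; exact hg

lemma finiteDimensional_of_le {W W' : Submodule ℂ 𝕂} (h : W ≤ W') (hW' : FiniteDimensional ℂ W') :
    FiniteDimensional ℂ W :=
  Submodule.finiteDimensional_of_le h

lemma finrank_rrSpace_add_single {D : Divisor 𝕂} {p : Point 𝕂}
    (hp : ∀ f, p.val f ≤ 1 → ∃ c, p.HasValue f c) {g : 𝕂}
    (hg : g ∈ rrSpace (D + Finsupp.single p 1)) (hgp : p.val g = exp (D p + 1))
    [FiniteDimensional ℂ (rrSpace D)] :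
    FiniteDimensional ℂ (rrSpace (D + Finsupp.single p 1)) ∧
    Module.finrank ℂ (rrSpace (D + Finsupp.single p 1)) = Module.finrank ℂ (rrSpace D) + 1 := by
  rw [rrSpace_add_single hp hg hgp]
  refine ⟨inferInstance, ?_⟩
  have h1 := Submodule.finrank_sup_add_finrank_inf_eq (rrSpace D) (Submodule.span ℂ {g})
  have h2 : rrSpace D ⊓ Submodule.span ℂ {g} = ⊥ := by
    rw [Submodule.eq_bot_iff]
    rintro f ⟨hf, hfg⟩
    obtain ⟨c, rfl⟩ := Submodule.mem_span_singleton.1 hfg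
    by_contra hne
    have hc : c ≠ 0 := by rintro rfl; simp at hne
    have := hf p
    rw [Algebra.smul_def, map_mul, p.val_algebraMap hc, one_mul, hgp, exp_le_exp] at this
    omega
  have hg0 : g ≠ 0 := p.ne_zero_of_val_eq_exp hgp
  rw [h2, finrank_bot, finrank_span_singleton hg0] at h1
  omega

lemma defect_add_single {D : Divisor 𝕂} {p : Point 𝕂}
    (hp : ∀ f, p.val f ≤ 1 → ∃ c, p.HasValue f c) {g : 𝕂}
    (hg : g ∈ rrSpace (D + Finsupp.single p 1)) (hgp : p.val g = exp (D p + 1))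
    [FiniteDimensional ℂ (rrSpace D)] : defect (D + Finsupp.single p 1) = defect D := by
  rw [defect, defect, (finrank_rrSpace_add_single hp hg hgp).2, degree_add, degree_single]
  push_cast; ring

/-- One more allowed pole raises the degree by one and the dimension by at most one. -/
lemma defect_le_add_single {D : Divisor 𝕂} {p : Point 𝕂}
    (hp : ∀ f, p.val f ≤ 1 → ∃ c, p.HasValue f c)
    [FiniteDimensional ℂ (rrSpace D)] : defect D ≤ defect (D + Finsupp.single p 1) := by
  by_cases hex : ∃ g, g ∈ rrSpace (D + Finsupp.single p 1) ∧ p.val g = exp (D p + 1)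
  · obtain ⟨g, hg, hgp⟩ := hex
    exact (defect_add_single hp hg hgp).ge
  · push Not at hex
    have : rrSpace (D + Finsupp.single p 1) = rrSpace D := by
      apply le_antisymm
      · intro f hf
        refine mem_rrSpace_of_add_single hf ?_
        rw [← lt_exp_add_one_iff]
        refine lt_of_le_of_ne ?_ (hex f hf)
        simpa using hf p
      · exact rrSpace_mono (by simp)
    rw [defect, defect, this, degree_add, degree_single]
    omega

/-- The spaces `L(D + nP)` are finite dimensional, and the defect of `D + nP` is eventually `c`. -/
def HasLimitDefect (P : Point 𝕂) (c : ℤ) (D : Divisor 𝕂) : Prop :=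
  (∀ n : ℤ, FiniteDimensional ℂ (rrSpace (D + Finsupp.single P n))) ∧
    ∃ n₀ : ℤ, ∀ n, n₀ ≤ n → defect (D + Finsupp.single P n) = c

end

namespace IsTriangular

variable {m N : ℕ} {F : ℂ[X][X]} [IsDomain (AdjoinRoot F)] (h : IsTriangular m N F)
  (hs : IsSmoothAffine F) {P : Point (FunField F)} (hP : IsAtInfinity P)
include h hs hP

/-- For `p = P` only the index n is shifted. For any other `p`, `exists_exact_order` gives a
function attaining the newly allowed order at `p`; its pole at `P` is permitted once n is large, so
degree and dimension grow together. -/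
lemma hasLimitDefect_add_single (p : Point (FunField F)) (c : ℤ) (D : Divisor (FunField F)) :
    HasLimitDefect P c (D + Finsupp.single p 1) ↔ HasLimitDefect P c D := by
  by_cases hp : IsAtInfinity p
  · have hpP := h.isAtInfinity_unique hp hP
    subst hpP
    have key : ∀ n : ℤ, D + Finsupp.single p 1 + Finsupp.single p n =
        D + Finsupp.single p (n + 1) := by
      intro n; rw [add_assoc, ← Finsupp.single_add, add_comm 1 n]
    constructor
    · rintro ⟨h1, n₀, h2⟩
      refine ⟨fun n => ?_, n₀ + 1, fun n hn => ?_⟩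
      · have := h1 (n - 1)
        rwa [key, sub_add_cancel] at this
      · have := h2 (n - 1) (by omega)
        rwa [key, sub_add_cancel] at this
    · rintro ⟨h1, n₀, h2⟩
      refine ⟨fun n => ?_, n₀ - 1, fun n hn => ?_⟩
      · rw [key]; exact h1 _
      · rw [key]; exact h2 _ (by omega)
  · have hpP : p ≠ P := fun h' => hp (h' ▸ hP)
    obtain ⟨g, hgp, hg⟩ := h.exists_exact_order hs hp (D + Finsupp.single p 1)
    have hg0 : g ≠ 0 := p.ne_zero_of_val_eq_exp hgp
    obtain ⟨e, he⟩ : ∃ e, P.val g = exp e := ⟨_, (exp_log (by simpa using hg0)).symm⟩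
    have key : ∀ n : ℤ, D + Finsupp.single p 1 + Finsupp.single P n =
        D + Finsupp.single P n + Finsupp.single p 1 := fun n => add_right_comm _ _ _
    have hmem : ∀ n : ℤ, e - D P ≤ n →
        g ∈ rrSpace (D + Finsupp.single P n + Finsupp.single p 1) := by
      intro n hn q
      rw [← key]
      by_cases hq : IsAtInfinity q
      · rw [h.isAtInfinity_unique hq hP, he, exp_le_exp]
        simp [Finsupp.single_eq_of_ne hpP.symm]; omega
      · have hqP : q ≠ P := fun h' => hq (h' ▸ hP)
        rw [Finsupp.add_apply, Finsupp.single_eq_of_ne hqP, add_zero]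
        exact hg q hq
    have hval : ∀ n : ℤ, p.val g = exp ((D + Finsupp.single P n) p + 1) := by
      intro n
      rw [hgp]
      simp [Finsupp.single_eq_of_ne hpP]
    have hres : ∀ f, p.val f ≤ 1 → ∃ c, p.HasValue f c := fun f hf => h.exists_hasValue hs p hf
    constructor
    · rintro ⟨h1, n₀, h2⟩
      have hfd : ∀ n : ℤ, FiniteDimensional ℂ (rrSpace (D + Finsupp.single P n)) := fun n => by
        refine finiteDimensional_of_le (rrSpace_mono ?_) (h1 n)
        rw [key]; simp
      refine ⟨hfd, max n₀ (e - D P), fun n hn => ?_⟩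
      have := hfd n
      rw [← h2 n ((le_max_left _ _).trans hn), key]
      exact (defect_add_single hres (hmem n ((le_max_right _ _).trans hn)) (hval n)).symm
    · rintro ⟨h1, n₀, h2⟩
      refine ⟨fun n => ?_, max n₀ (e - D P), fun n hn => ?_⟩
      · have := h1 (max n (e - D P))
        refine finiteDimensional_of_le (rrSpace_mono ?_)
          (finrank_rrSpace_add_single hres (hmem _ (le_max_right n _)) (hval _)).1
        rw [← key]
        exact add_le_add_right (Finsupp.single_le_single.2 (le_max_left _ _)) _
      · have := h1 n
        rw [← h2 n ((le_max_left _ _).trans hn), key]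
        exact defect_add_single hres (hmem n ((le_max_right _ _).trans hn)) (hval n)

lemma hasLimitDefect_of (c : ℤ) {E : Divisor (FunField F)} (hE : HasLimitDefect P c E)
    (D : Divisor (FunField F)) : HasLimitDefect P c D := by
  have key : ∀ D' D₀ : Divisor (FunField F), HasLimitDefect P c D₀ →
      HasLimitDefect P c (D₀ + D') := by
    intro D'
    induction D' using Finsupp.induction_linear with
    | zero => intro D₀ h0; simpa using h0
    | add f g hf hg => intro D₀ h0; rw [← add_assoc]; exact hg _ (hf _ h0)
    | single p n =>
      intro D₀ h0
      induction n using Int.induction_on with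
      | zero => simpa using h0
      | succ k ih =>
        rw [Finsupp.single_add, ← add_assoc, h.hasLimitDefect_add_single hs hP]
        exact ih
      | pred k ih =>
        rw [← h.hasLimitDefect_add_single hs hP p, add_assoc, ← Finsupp.single_add,
          sub_add_cancel]
        exact ih
  have := key (D - E) E hE
  rwa [add_sub_cancel] at this

/-- The genus is the degree of a divisor `E` such that `L(E - P) = 0` and `L(E)` contains
functions with a pole of every order at `P`. -/
theorem genus_eq {E : Divisor (FunField F)}
    (hbot : rrSpace (E + Finsupp.single P (-1)) = ⊥)
    (hex : ∀ n : ℕ, ∃ g ∈ rrSpace (E + Finsupp.single P (n : ℤ)), P.val g = exp (E P + n)) :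
    genus (FunField F) = degree E := by
  have hres : ∀ f, P.val f ≤ 1 → ∃ c, P.HasValue f c := fun f hf => h.exists_hasValue hs P hf
  -- The index n - 1 starts the induction at L(E - P) = 0, where the defect is deg E; from then on
  -- every step gains exactly one dimension.
  have key : ∀ n : ℕ, FiniteDimensional ℂ (rrSpace (E + Finsupp.single P ((n : ℤ) - 1))) ∧
      defect (E + Finsupp.single P ((n : ℤ) - 1)) = degree E := by
    intro n
    induction n with
    | zero =>
      have hb : rrSpace (E + Finsupp.single P (((0 : ℕ) : ℤ) - 1)) = ⊥ := by simpa using hbot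
      rw [defect, hb, degree_add, degree_single, finrank_bot]
      exact ⟨inferInstance, by push_cast; ring⟩
    | succ n ih =>
      obtain ⟨h1, h2⟩ := ih
      obtain ⟨g, hg, hgP⟩ := hex n
      have h3 : E + Finsupp.single P (((n + 1 : ℕ) : ℤ) - 1) =
          E + Finsupp.single P ((n : ℤ) - 1) + Finsupp.single P 1 := by
        rw [add_assoc, ← Finsupp.single_add]; congr 2; push_cast; ring
      have h4 : E + Finsupp.single P (n : ℤ) =
          E + Finsupp.single P ((n : ℤ) - 1) + Finsupp.single P 1 := by
        rw [add_assoc, ← Finsupp.single_add]; congr 2; ring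
      have h5 : P.val g = exp ((E + Finsupp.single P ((n : ℤ) - 1)) P + 1) := by
        rw [hgP]; congr 1; simp; ring
      rw [h4] at hg
      rw [h3]
      exact ⟨(finrank_rrSpace_add_single hres hg h5).1,
        (defect_add_single hres hg h5).trans h2⟩
  have hE : HasLimitDefect P (degree E) E := by
    refine ⟨fun n => ?_, 0, fun n hn => ?_⟩
    · refine finiteDimensional_of_le (rrSpace_mono ?_) (key (n + 1).toNat).1
      refine add_le_add_right (Finsupp.single_le_single.2 ?_) _
      have := Int.self_le_toNat (n + 1)
      omega
    · have := (key (n + 1).toNat).2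
      rwa [Int.toNat_of_nonneg (by omega), add_sub_cancel_right] at this
  -- The defect does not decrease along D + nP, and its eventual value is the common limit deg E.
  have hle : ∀ D : Divisor (FunField F), defect D ≤ degree E := by
    intro D
    obtain ⟨h1, n₀, h2⟩ := h.hasLimitDefect_of hs hP _ hE D
    have hmono : ∀ n : ℕ, defect D ≤ defect (D + Finsupp.single P (n : ℤ)) := by
      intro n
      induction n with
      | zero => simp
      | succ n ih =>
        refine ih.trans ?_
        have := h1 n
        rw [Nat.cast_succ, Finsupp.single_add, ← add_assoc]
        exact defect_le_add_single hres
    refine (hmono n₀.toNat).trans (h2 _ (Int.self_le_toNat _)).le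
  have hdE : defect E = degree E := by
    have := (key 1).2
    simpa using this
  refine (IsGreatest.csSup_eq ⟨⟨E, hdE.symm⟩, ?_⟩)
  rintro n ⟨D, rfl⟩
  exact hle D

end IsTriangular

/-! ### Lax factors -/

/-- The value of `y` at which `diag(d) + S(y)` is singular. -/
def singularY (N : ℕ) (d : ℤ → ℂ) : ℂ := (-1) ^ N * ∏ i : Fin N, d ((i : ℕ) + 1)

/-- Expansion along the first column leaves an upper triangular minor, with the product of the d's,
and a lower triangular one, multiplied by y. For N = 1 the corner entry y lies on the diagonal, so
that case is separate. -/
lemma det_laxFactor {N : ℕ} (hN : 0 < N) (d : ℤ → ℂ) :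
    (laxFactor N d).det = -(-1) ^ N * (X - C (singularY N d)) := by
  have hval : -(-1) ^ N * (X - C (singularY N d)) =
      C (∏ i : Fin N, d ((i : ℕ) + 1)) + (-1) ^ (N + 1) * (X : ℂ[X]) := by
    have : ((-1 : ℂ[X]) ^ N) * (-1) ^ N = 1 := by
      rw [← mul_pow]; simp
    rw [singularY, C_mul, C_pow, C_neg, C_1, pow_succ]
    linear_combination (C (∏ i : Fin N, d ((i : ℕ) + 1))) * this
  rw [hval]
  obtain ⟨n, rfl⟩ : ∃ n, N = n + 1 := ⟨N - 1, by omega⟩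
  rcases n with _ | k
  · simp [laxFactor, shiftMatrix]
  rw [Matrix.det_succ_column_zero, Fin.sum_univ_succ, Fin.sum_univ_castSucc,
    Finset.sum_eq_zero, zero_add]
  · have hup : ((laxFactor (k + 2) d).submatrix (Fin.succAbove 0) Fin.succ).det =
        ∏ i : Fin (k + 1), C (d (((i : ℕ) + 1 : ℕ) + 1)) := by
      rw [Matrix.det_of_isUpperTriangular]
      · refine Finset.prod_congr rfl fun i _ => ?_
        simp [laxFactor, shiftMatrix]
      · intro i j hij
        have hij' : (j : ℕ) < i := hij
        have h1 : i.succ ≠ j.succ := by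
          rw [Ne, Fin.succ_inj]; rintro rfl; exact lt_irrefl _ hij'
        simp [laxFactor, shiftMatrix, Matrix.diagonal_apply_ne _ h1]
        omega
    have hlow : ((laxFactor (k + 2) d).submatrix (Fin.succAbove (Fin.last k).succ) Fin.succ).det =
        1 := by
      rw [Matrix.det_of_isLowerTriangular]
      · refine Finset.prod_eq_one fun i _ => ?_
        have h1 : i.castSucc ≠ i.succ := (Fin.castSucc_lt_succ).ne
        simp [laxFactor, shiftMatrix, Matrix.diagonal_apply_ne _ h1]
      · intro i j hij
        have hij' : (i : ℕ) < j := hij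
        have h1 : i.castSucc ≠ j.succ := by
          intro h; have := congrArg Fin.val h; simp at this; omega
        simp [laxFactor, shiftMatrix, Matrix.diagonal_apply_ne _ h1]
        omega
    have hp : ∏ i : Fin (k + 1 + 1), d ((i : ℕ) + 1) =
        d 1 * ∏ i : Fin (k + 1), d (((i : ℕ) + 1 : ℕ) + 1) := by
      rw [Fin.prod_univ_succ]; simp
    rw [hup, hlow, hp, C_mul, map_prod]
    simp [laxFactor, shiftMatrix]
    ring
  · intro i _
    have h1 : (i : ℕ) ≠ k := i.2.ne
    simp [laxFactor, shiftMatrix, h1]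

lemma shiftMatrix_mul_diagonal {N : ℕ} (d : ℤ → ℂ) (hd : ∀ n, d (n + N) = d n) :
    shiftMatrix N * Matrix.diagonal (fun i : Fin N => C (d ((i : ℕ) + 1))) =
      Matrix.diagonal (fun i : Fin N => C (d ((i : ℕ) + 1 + 1))) * shiftMatrix N := by
  ext1 i j
  rw [Matrix.mul_diagonal, Matrix.diagonal_mul]
  simp only [shiftMatrix, Matrix.of_apply]
  split_ifs with h1 h2
  · rw [← h1]; push_cast; ring
  · obtain ⟨h2, h3⟩ := h2
    rw [h3, mul_comm]
    congr 2
    have : ((i : ℕ) : ℤ) + 1 + 1 = 1 + N := by omega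
    rw [this, hd]; simp
  · simp

lemma shiftMatrix_mul_laxFactor {N : ℕ} (d : ℤ → ℂ) (hd : ∀ n, d (n + N) = d n) :
    shiftMatrix N * laxFactor N d = laxFactor N (fun n => d (n + 1)) * shiftMatrix N := by
  rw [laxFactor, laxFactor, mul_add, add_mul, shiftMatrix_mul_diagonal d hd]

/-- A normal form with diagonal coefficients to the left of powers of S: two such products agree as
soon as their coefficients at 1 and at S do. -/
lemma laxFactor_mul {N : ℕ} (a b : ℤ → ℂ) (hb : ∀ n, b (n + N) = b n) :
    laxFactor N a * laxFactor N b =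
      Matrix.diagonal (fun i : Fin N => C (a ((i : ℕ) + 1) * b ((i : ℕ) + 1))) +
      Matrix.diagonal (fun i : Fin N => C (a ((i : ℕ) + 1) + b ((i : ℕ) + 1 + 1))) *
        shiftMatrix N + shiftMatrix N * shiftMatrix N := by
  have h1 : Matrix.diagonal (fun i : Fin N => C (a ((i : ℕ) + 1) + b ((i : ℕ) + 1 + 1))) =
      Matrix.diagonal (fun i : Fin N => C (a ((i : ℕ) + 1))) +
      Matrix.diagonal (fun i : Fin N => C (b ((i : ℕ) + 1 + 1))) := by
    rw [Matrix.diagonal_add]; simp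
  have h2 : Matrix.diagonal (fun i : Fin N => C (a ((i : ℕ) + 1) * b ((i : ℕ) + 1))) =
      Matrix.diagonal (fun i : Fin N => C (a ((i : ℕ) + 1))) *
      Matrix.diagonal (fun i : Fin N => C (b ((i : ℕ) + 1))) := by
    rw [Matrix.diagonal_mul_diagonal]; simp
  rw [h1, h2, add_mul, ← shiftMatrix_mul_diagonal b hb, laxFactor, laxFactor]
  noncomm_ring

lemma shiftMatrix_eq_laxFactor (N : ℕ) : shiftMatrix N = laxFactor N (fun _ => 0) := by
  simp [laxFactor]

/-- A product of Lax factors. -/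
def prodLax (N : ℕ) (ds : List (ℤ → ℂ)) : Matrix (Fin N) (Fin N) ℂ[X] :=
  (ds.map (laxFactor N)).prod

lemma prodLax_cons (N : ℕ) (d : ℤ → ℂ) (ds : List (ℤ → ℂ)) :
    prodLax N (d :: ds) = laxFactor N d * prodLax N ds := by
  simp [prodLax]

/-- What matters later is the nonzero top coefficient, which provides the vertex (0, m) of the
Newton polygon. -/
lemma det_prodLax {N : ℕ} (hN : 0 < N) (ds : List (ℤ → ℂ)) :
    ∃ q : ℂ[X], q.Monic ∧ q.natDegree = ds.length ∧
      (prodLax N ds).det = (-(-1) ^ N) ^ ds.length * q := by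
  induction ds with
  | nil => exact ⟨1, monic_one, by simp, by simp [prodLax]⟩
  | cons d ds ih =>
    obtain ⟨q, hq, hqd, hdet⟩ := ih
    refine ⟨(X - C (singularY N d)) * q, (monic_X_sub_C _).mul hq, ?_, ?_⟩
    · rw [(monic_X_sub_C _).natDegree_mul hq, natDegree_X_sub_C, hqd, List.length_cons, add_comm]
    · rw [prodLax_cons, Matrix.det_mul, det_laxFactor hN, hdet, List.length_cons, pow_succ]
      ring

/-! ### Weights -/

/-- Give y the weight N and the matrix position (i, j) the weight j - i. Then the diagonal has
weight 0 and S, corner included, has weight 1; weights add in products. -/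
lemma coeff_laxFactor {N : ℕ} (d : ℤ → ℂ) (i j : Fin N) (l : ℕ)
    (h : (laxFactor N d i j).coeff l ≠ 0) : N * l + j ≤ 1 + i := by
  rw [laxFactor, Matrix.add_apply, coeff_add] at h
  by_cases h1 : (Matrix.diagonal (fun i : Fin N => C (d ((i : ℕ) + 1))) i j).coeff l = 0
  · rw [h1, zero_add, shiftMatrix, Matrix.of_apply] at h
    split_ifs at h with h2 h3
    · rw [coeff_one] at h
      have : l = 0 := by by_contra h4; simp [h4] at h
      subst this; omega
    · rw [coeff_X] at h
      have : l = 1 := by by_contra h4; exact h (by simp [Ne.symm h4])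
      subst this; omega
    · simp at h
  · rw [Matrix.diagonal_apply] at h1
    split_ifs at h1 with h2
    · rw [coeff_C] at h1
      have : l = 0 := by by_contra h4; simp [h4] at h1
      subst this; subst h2; omega
    · simp at h1

lemma coeff_prodLax {N : ℕ} (ds : List (ℤ → ℂ)) (i j : Fin N) (l : ℕ)
    (h : (prodLax N ds i j).coeff l ≠ 0) : N * l + j ≤ ds.length + i := by
  induction ds generalizing i l with
  | nil =>
    rw [prodLax, List.map_nil, List.prod_nil, Matrix.one_apply] at h
    split_ifs at h with h2
    · rw [coeff_one] at h
      have : l = 0 := by by_contra h4; simp [h4] at h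
      subst this; subst h2; simp
    · simp at h
  | cons d ds ih =>
    rw [prodLax_cons, Matrix.mul_apply, finsetSum_coeff] at h
    obtain ⟨k, -, hk⟩ := Finset.exists_ne_zero_of_sum_ne_zero h
    rw [coeff_mul] at hk
    obtain ⟨⟨a, b⟩, hab, hk'⟩ := Finset.exists_ne_zero_of_sum_ne_zero hk
    have h1 := coeff_laxFactor d i k a (left_ne_zero_of_mul hk')
    have h2 := ih k b (right_ne_zero_of_mul hk')
    have hab' : a + b = l := Finset.HasAntidiagonal.mem_antidiagonal.1 hab
    rw [List.length_cons, ← hab', mul_add]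
    omega

/-- All monomials `x^i y^j` of `g` satisfy `m i + N j ≤ w`. -/
def WeightLE (m N : ℕ) (w : ℤ) (g : ℂ[X][X]) : Prop :=
  ∀ i j, (g.coeff i).coeff j ≠ 0 → (m * i + N * j : ℤ) ≤ w

namespace WeightLE

variable {m N : ℕ}

lemma sum {ι : Type*} {s : Finset ι} {f : ι → ℂ[X][X]} {w : ℤ}
    (h : ∀ i ∈ s, WeightLE m N w (f i)) : WeightLE m N w (∑ i ∈ s, f i) := by
  intro i j hij
  rw [finsetSum_coeff, finsetSum_coeff] at hij
  obtain ⟨k, hk, hk'⟩ := Finset.exists_ne_zero_of_sum_ne_zero hij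
  exact h k hk i j hk'

lemma mul {v w : ℤ} {f g : ℂ[X][X]} (hf : WeightLE m N v f) (hg : WeightLE m N w g) :
    WeightLE m N (v + w) (f * g) := by
  intro i j hij
  rw [coeff_mul, finsetSum_coeff] at hij
  obtain ⟨⟨a, b⟩, hab, hk⟩ := Finset.exists_ne_zero_of_sum_ne_zero hij
  rw [coeff_mul] at hk
  obtain ⟨⟨c, d⟩, hcd, hk'⟩ := Finset.exists_ne_zero_of_sum_ne_zero hk
  have h1 := hf a c (left_ne_zero_of_mul hk')
  have h2 := hg b d (right_ne_zero_of_mul hk')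
  rw [Finset.HasAntidiagonal.mem_antidiagonal] at hab hcd
  rw [← hab, ← hcd]; push_cast
  linarith

lemma prod {ι : Type*} {s : Finset ι} {f : ι → ℂ[X][X]} {w : ι → ℤ}
    (h : ∀ i ∈ s, WeightLE m N (w i) (f i)) : WeightLE m N (∑ i ∈ s, w i) (∏ i ∈ s, f i) := by
  classical
  induction s using Finset.induction_on with
  | empty =>
    intro i j hij
    rw [Finset.prod_empty, coeff_one] at hij
    split_ifs at hij with h0
    · rw [coeff_one] at hij
      have : j = 0 := by by_contra h4; simp [h4] at hij
      simp [h0, this]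
    · simp at hij
  | insert a s ha ih =>
    rw [Finset.sum_insert ha, Finset.prod_insert ha]
    exact (h a (by simp)).mul (ih fun i hi => h i (by simp [hi]))

end WeightLE

/-- With x of weight m, the entry (i, j) of x - X has weight at most m + i - j. In each term of the
Leibniz expansion the differences of indices cancel, leaving the bound mN; the vertex (0, m) comes
from det X. -/
theorem isTriangular_charpoly {N : ℕ} (hN : 0 < N) (ds : List (ℤ → ℂ)) (hds : 0 < ds.length)
    (hcop : Nat.Coprime ds.length N) : IsTriangular ds.length N (prodLax N ds).charpoly where
  m_pos := hds
  N_pos := hN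
  coprime := hcop
  monic := Matrix.charpoly_monic _
  natDegree := by rw [Matrix.charpoly_natDegree_eq_dim, Fintype.card_fin]
  weight := by
    have key : WeightLE ds.length N (ds.length * N) (prodLax N ds).charpoly := by
      rw [Matrix.charpoly, Matrix.det_apply]
      refine WeightLE.sum fun σ _ => ?_
      have h1 : WeightLE ds.length N
          (∑ i : Fin N, ((ds.length : ℤ) + ((σ i : Fin N) : ℕ) - ((i : Fin N) : ℕ)))
          (∏ i : Fin N, (prodLax N ds).charmatrix (σ i) i) := by
        refine WeightLE.prod fun i _ => ?_
        intro a b hab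
        rw [Matrix.charmatrix_apply, coeff_sub, coeff_sub] at hab
        by_cases h2 : ((Matrix.diagonal (fun _ : Fin N => (X : ℂ[X][X])) (σ i) i).coeff a).coeff b = 0
        · rw [h2, zero_sub, neg_ne_zero, coeff_C] at hab
          split_ifs at hab with ha
          · have := coeff_prodLax ds (σ i) i b hab
            subst ha; push_cast; zify at this; linarith
          · simp at hab
        · rw [Matrix.diagonal_apply] at h2
          split_ifs at h2 with h3
          · rw [coeff_X] at h2
            split_ifs at h2 with h4
            · rw [coeff_one] at h2
              have : b = 0 := by by_contra h4; simp [h4] at h2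
              subst this; subst h4; rw [h3]; push_cast; linarith
            · simp at h2
          · simp at h2
      have h2 : ∑ i : Fin N, ((ds.length : ℤ) + ((σ i : Fin N) : ℕ) - ((i : Fin N) : ℕ)) =
          ds.length * N := by
        rw [Finset.sum_sub_distrib, Finset.sum_add_distrib,
          Equiv.sum_comp σ (fun i : Fin N => (((i : Fin N) : ℕ) : ℤ))]
        simp [mul_comm]
      rw [h2] at h1
      intro a b hab
      refine h1 a b fun h0 => hab ?_
      rcases Int.units_eq_one_or (Equiv.Perm.sign σ) with h3 | h3 <;> rw [h3] <;> simp [h0]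
    intro i j hij
    exact_mod_cast key i j hij
  lead := by
    obtain ⟨q, hq, hqd, hdet⟩ := det_prodLax hN ds
    have h1 := Matrix.det_eq_sign_charpoly_coeff (prodLax N ds)
    rw [hdet, Fintype.card_fin] at h1
    have h2 : (-(-1 : ℂ[X]) ^ N) ^ ds.length = C ((-(-1 : ℂ) ^ N) ^ ds.length) := by simp
    have h3 : ((-1 : ℂ[X]) ^ N) = C ((-1 : ℂ) ^ N) := by simp
    rw [h2, h3] at h1
    have h4 := congrArg (fun p => p.coeff ds.length) h1
    simp only [coeff_C_mul] at h4
    have h5 : q.coeff ds.length = 1 := by rw [← hqd]; exact hq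
    rw [h5, mul_one] at h4
    intro h0
    rw [h0, mul_zero] at h4
    have h6 : (-(-1 : ℂ) ^ N) ≠ 0 := neg_ne_zero.2 (pow_ne_zero _ (by norm_num))
    exact pow_ne_zero _ h6 h4

/-! ### Factorizations of the Lax matrix -/

/-- The list of the diagonals of the factors of `X_t`. -/
def laxList (M K : ℕ) (I V : ℤ → ℤ → ℂ) (t : ℤ) : List (ℤ → ℂ) :=
  ((List.range K).reverse.map fun k : ℕ => fun n => V n (t - k * M)) ++
    (List.range M).map fun k : ℕ => fun n => I n (t - k * K)

lemma laxX_eq_prodLax (M K N : ℕ) (I V : ℤ → ℤ → ℂ) (t : ℤ) :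
    laxX M K N I V t = prodLax N (laxList M K I V t) := by
  have hcast : ∀ l : List ℕ, (l >>= fun a => pure (a : ℤ)) = l.map fun a : ℕ => (a : ℤ) := by
    intro l
    induction l with
    | nil => rfl
    | cons a l ih => rw [List.map_cons, ← ih]; rfl
  simp only [laxX, prodLax, laxList, List.map_append, List.prod_append, List.map_map, hcast]
  rfl

lemma length_laxList (M K : ℕ) (I V : ℤ → ℤ → ℂ) (t : ℤ) :
    (laxList M K I V t).length = M + K := by
  simp [laxList, add_comm]

lemma IsSolution.periodic_of_mem {M K N : ℕ} {I V : ℤ → ℤ → ℂ} (h : IsSolution M K N I V) {t : ℤ}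
    {d : ℤ → ℂ} (hd : d ∈ laxList M K I V t) (n : ℤ) : d (n + N) = d n := by
  simp only [laxList, List.mem_append, List.mem_map] at hd
  rcases hd with ⟨k, -, rfl⟩ | ⟨k, -, rfl⟩
  · exact h.periodic_V _ _
  · exact h.periodic_I _ _

/-- The Lax form of the system: `eq_V` matches the coefficients at 1 and `eq_I` those at S. -/
lemma IsSolution.laxL_mul_laxR {M K N : ℕ} {I V : ℤ → ℤ → ℂ} (h : IsSolution M K N I V) (t : ℤ) :
    laxL N V t * laxR N I t = laxR N I (t - M) * laxL N V (t - K) := by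
  rw [laxL, laxR, laxR, laxL, laxFactor_mul _ _ fun n => h.periodic_I n _,
    laxFactor_mul _ _ fun n => h.periodic_V n _]
  have h1 : ∀ n, V n t * I n t = I n (t - M) * V n (t - K) := by
    intro n
    rw [h.eq_V n t, div_mul_cancel₀ _ (h.I_ne_zero n t)]
  have h2 : ∀ n, V n t + I (n + 1) t = I n (t - M) + V (n + 1) (t - K) := by
    intro n
    have := h.eq_I (n + 1) t
    rw [add_sub_cancel_right] at this
    rw [this]; ring
  simp only [h1, h2]

/-- The product `L_{t-(r-1)M} ⋯ L_{t-M} L_t`. -/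
def prodL (M N : ℕ) (V : ℤ → ℤ → ℂ) (t : ℤ) (r : ℕ) : Matrix (Fin N) (Fin N) ℂ[X] :=
  ((List.range r).reverse.map fun k : ℕ => laxL N V (t - k * M)).prod

/-- The product `R_t R_{t-K} ⋯ R_{t-(r-1)K}`. -/
def prodR (K N : ℕ) (I : ℤ → ℤ → ℂ) (t : ℤ) (r : ℕ) : Matrix (Fin N) (Fin N) ℂ[X] :=
  ((List.range r).map fun k : ℕ => laxR N I (t - k * K)).prod

lemma laxX_eq_mul (M K N : ℕ) (I V : ℤ → ℤ → ℂ) (t : ℤ) :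
    laxX M K N I V t = prodL M N V t K * prodR K N I t M := by
  rw [laxX_eq_prodLax, prodLax, laxList, List.map_append, List.prod_append, List.map_map,
    List.map_map]
  rfl

lemma prodL_succ (M N : ℕ) (V : ℤ → ℤ → ℂ) (t : ℤ) (r : ℕ) :
    prodL M N V t (r + 1) = laxL N V (t - r * M) * prodL M N V t r := by
  rw [prodL, List.range_succ, List.reverse_append, List.map_append, List.prod_append]
  simp [prodL]

lemma prodL_succ' (M N : ℕ) (V : ℤ → ℤ → ℂ) (t : ℤ) (r : ℕ) :
    prodL M N V t (r + 1) = prodL M N V (t - M) r * laxL N V t := by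
  induction r with
  | zero => simp [prodL]
  | succ r ih =>
    rw [prodL_succ, ih, prodL_succ, mul_assoc]
    congr 2
    push_cast; ring

lemma prodR_succ (K N : ℕ) (I : ℤ → ℤ → ℂ) (t : ℤ) (r : ℕ) :
    prodR K N I t (r + 1) = prodR K N I t r * laxR N I (t - r * K) := by
  rw [prodR, List.range_succ, List.map_append, List.prod_append]
  simp [prodR]

lemma prodR_succ' (K N : ℕ) (I : ℤ → ℤ → ℂ) (t : ℤ) (r : ℕ) :
    prodR K N I t (r + 1) = laxR N I t * prodR K N I (t - K) r := by
  induction r with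
  | zero => simp [prodR]
  | succ r ih =>
    rw [prodR_succ, ih, prodR_succ, mul_assoc]
    congr 3
    push_cast; ring

/-- Repeated exchange carries one L to the right through a block of R's; each R loses M in time and
L loses K at every exchange. -/
lemma IsSolution.laxL_mul_prodR {M K N : ℕ} {I V : ℤ → ℤ → ℂ} (h : IsSolution M K N I V) (t : ℤ)
    (r : ℕ) : laxL N V t * prodR K N I t r = prodR K N I (t - M) r * laxL N V (t - r * K) := by
  induction r with
  | zero => simp [prodR]
  | succ r ih =>
    have h1 : t - r * K - M = t - M - r * K := by ring
    have h2 : t - r * K - K = t - (r + 1 : ℕ) * K := by push_cast; ring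
    rw [prodR_succ, ← mul_assoc, ih, mul_assoc, h.laxL_mul_laxR, ← mul_assoc, prodR_succ, h1, h2]

lemma IsSolution.prodL_mul_laxR {M K N : ℕ} {I V : ℤ → ℤ → ℂ} (h : IsSolution M K N I V) (t : ℤ)
    (r : ℕ) : prodL M N V t r * laxR N I t = laxR N I (t - r * M) * prodL M N V (t - K) r := by
  induction r with
  | zero => simp [prodL]
  | succ r ih =>
    rw [prodL_succ, mul_assoc, ih, ← mul_assoc, h.laxL_mul_laxR, mul_assoc, prodL_succ]
    congr 2
    · push_cast; ring
    · congr 1; ring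

/-- `X_t = B R` and `X_{t+K} = R B`. -/
lemma IsSolution.laxX_factor_R {M K N : ℕ} (hM : 0 < M) {I V : ℤ → ℤ → ℂ}
    (h : IsSolution M K N I V) (t : ℤ) : ∃ B,
      laxX M K N I V t = B * laxR N I (t - (M - 1) * K) ∧
      laxX M K N I V (t + K) = laxR N I (t - (M - 1) * K) * B := by
  obtain ⟨r, rfl⟩ : ∃ r, M = r + 1 := ⟨M - 1, by omega⟩
  refine ⟨prodL (r + 1) N V t K * prodR K N I t r, ?_, ?_⟩
  · rw [laxX_eq_mul, prodR_succ, mul_assoc]; congr 3; push_cast; ring_nf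
  · rw [laxX_eq_mul, prodR_succ', ← mul_assoc, h.prodL_mul_laxR, add_sub_cancel_right, mul_assoc]
    congr 2; push_cast; ring

/-- `X_t = B L` and `X_{t-M} = L B`. -/
lemma IsSolution.laxX_factor_L {M K N : ℕ} (hK : 0 < K) {I V : ℤ → ℤ → ℂ}
    (h : IsSolution M K N I V) (t : ℤ) : ∃ B,
      laxX M K N I V t = B * laxL N V (t - M * K) ∧
      laxX M K N I V (t - M) = laxL N V (t - M * K) * B := by
  obtain ⟨r, rfl⟩ : ∃ r, K = r + 1 := ⟨K - 1, by omega⟩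
  refine ⟨prodL M N V (t - M) r * prodR (r + 1) N I (t - M) M, ?_, ?_⟩
  · rw [laxX_eq_mul, prodL_succ', mul_assoc, h.laxL_mul_prodR, mul_assoc]
  · rw [laxX_eq_mul, prodL_succ, mul_assoc]
    congr 2; push_cast; ring

lemma IsSolution.shift {M K N : ℕ} {I V : ℤ → ℤ → ℂ} (h : IsSolution M K N I V) :
    IsSolution M K N (fun n s => I (n + 1) s) (fun n s => V (n + 1) s) := by
  have hprod : ∀ f : ℤ → ℂ, (∀ n, f (n + N) = f n) →
      ∏ n ∈ Finset.Icc (1 : ℤ) N, f (n + 1) = ∏ n ∈ Finset.Icc (1 : ℤ) N, f n := by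
    intro f hf
    rcases Nat.eq_zero_or_pos N with rfl | hN
    · simp
    have h1 : ∏ n ∈ Finset.Icc (1 : ℤ) N, f (n + 1) = ∏ n ∈ Finset.Icc (2 : ℤ) (N + 1), f n := by
      refine Finset.prod_bij (fun n _ => n + 1) ?_ ?_ ?_ ?_
      · intro a ha; simp only [Finset.mem_Icc] at *; omega
      · intro a _ b _ hab; simpa using hab
      · intro b hb
        refine ⟨b - 1, ?_, by ring⟩
        simp only [Finset.mem_Icc] at *; omega
      · intro a _; rfl
    have h2 : Finset.Icc (1 : ℤ) N = insert 1 (Finset.Icc (2 : ℤ) N) := by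
      ext a; simp only [Finset.mem_insert, Finset.mem_Icc]; omega
    have h3 : Finset.Icc (2 : ℤ) (N + 1) = insert ((N : ℤ) + 1) (Finset.Icc (2 : ℤ) N) := by
      ext a; simp only [Finset.mem_insert, Finset.mem_Icc]; omega
    rw [h1, h2, h3, Finset.prod_insert (by simp), Finset.prod_insert (by simp), add_comm (N : ℤ) 1,
      hf]
  exact
  { periodic_I := fun n t => by
      rw [add_right_comm, h.periodic_I]
    periodic_V := fun n t => by
      rw [add_right_comm, h.periodic_V]
    I_ne_zero := fun n t => h.I_ne_zero _ _
    eq_I := fun n t => by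
      have := h.eq_I (n + 1) t
      rw [add_sub_cancel_right] at this
      simpa using this
    eq_V := fun n t => h.eq_V _ _
    prod_I := fun t => by
      rw [hprod (fun n => I n (t + M)) fun n => h.periodic_I _ _,
        hprod (fun n => I n t) fun n => h.periodic_I _ _]
      exact h.prod_I t
    prod_V := fun t => by
      rw [hprod (fun n => V n (t + K)) fun n => h.periodic_V _ _,
        hprod (fun n => V n t) fun n => h.periodic_V _ _]
      exact h.prod_V t }

lemma IsSolution.prod_I_of_modEq {M K N : ℕ} {I V : ℤ → ℤ → ℂ} (h : IsSolution M K N I V)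
    {s t : ℤ} (hst : s ≡ t [ZMOD M]) :
    ∏ n ∈ Finset.Icc (1 : ℤ) N, I n s = ∏ n ∈ Finset.Icc (1 : ℤ) N, I n t := by
  have hper : Function.Periodic (fun t => ∏ n ∈ Finset.Icc (1 : ℤ) N, I n t) (M : ℤ) := h.prod_I
  obtain ⟨k, hk⟩ := hst.dvd
  have h1 := hper.int_mul k s
  have h2 : t = s + k * M := by rw [mul_comm, ← hk]; ring
  rw [h2]; exact h1.symm

lemma IsSolution.prod_V_of_modEq {M K N : ℕ} {I V : ℤ → ℤ → ℂ} (h : IsSolution M K N I V)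
    {s t : ℤ} (hst : s ≡ t [ZMOD K]) :
    ∏ n ∈ Finset.Icc (1 : ℤ) N, V n s = ∏ n ∈ Finset.Icc (1 : ℤ) N, V n t := by
  have hper : Function.Periodic (fun t => ∏ n ∈ Finset.Icc (1 : ℤ) N, V n t) (K : ℤ) := h.prod_V
  obtain ⟨k, hk⟩ := hst.dvd
  have h1 := hper.int_mul k s
  have h2 : t = s + k * K := by rw [mul_comm, ← hk]; ring
  rw [h2]; exact h1.symm

lemma singularY_eq (N : ℕ) (d : ℤ → ℂ) :
    singularY N d = (-1) ^ N * ∏ n ∈ Finset.Icc (1 : ℤ) N, d n := by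
  rw [singularY]
  congr 1
  refine Finset.prod_bij (fun i _ => ((i : ℕ) : ℤ) + 1) ?_ ?_ ?_ ?_
  · intro i _; simp only [Finset.mem_Icc]; omega
  · intro i _ j _ hij; exact Fin.ext (by simpa using hij)
  · intro b hb
    simp only [Finset.mem_Icc] at hb
    refine ⟨⟨(b - 1).toNat, by omega⟩, Finset.mem_univ _, ?_⟩
    simp only []; omega
  · intro i _; rfl

lemma shiftMatrix_mul_prodLax {N : ℕ} (ds : List (ℤ → ℂ)) (hds : ∀ d ∈ ds, ∀ n, d (n + N) = d n) :
    shiftMatrix N * prodLax N ds =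
      prodLax N (ds.map fun d n => d (n + 1)) * shiftMatrix N := by
  induction ds with
  | nil => simp [prodLax]
  | cons d ds ih =>
    rw [prodLax_cons, List.map_cons, prodLax_cons, ← mul_assoc,
      shiftMatrix_mul_laxFactor d (hds d (by simp)), mul_assoc,
      ih fun e he => hds e (by simp [he]), mul_assoc]

lemma map_shift_laxList (M K : ℕ) (I V : ℤ → ℤ → ℂ) (t : ℤ) :
    ((laxList M K I V t).map fun d n => d (n + 1)) =
      laxList M K (fun n s => I (n + 1) s) (fun n s => V (n + 1) s) t := by
  simp [laxList, List.map_append, List.map_map, Function.comp_def]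

/-- At `y = 0` the first basis vector is an eigenvector. -/
lemma prodLax_apply_zero {N : ℕ} (hN : 0 < N) (ds : List (ℤ → ℂ)) (i : Fin N) :
    (prodLax N ds i ⟨0, hN⟩).eval 0 = if i = ⟨0, hN⟩ then (ds.map fun d => d 1).prod else 0 := by
  induction ds generalizing i with
  | nil =>
    rw [prodLax, List.map_nil, List.prod_nil, Matrix.one_apply]
    split_ifs <;> simp
  | cons d ds ih =>
    rw [prodLax_cons, Matrix.mul_apply, eval_finsetSum, Finset.sum_eq_single ⟨0, hN⟩]
    · rw [eval_mul, ih, if_pos rfl, List.map_cons, List.prod_cons]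
      by_cases hi : i = ⟨0, hN⟩
      · subst hi
        rw [if_pos rfl]
        congr 1
        simp [laxFactor, shiftMatrix]
        split_ifs <;> simp
      · rw [if_neg hi]
        simp [laxFactor, shiftMatrix, Matrix.diagonal_apply_ne _ hi]
        left
        split_ifs <;> simp
    · intro j _ hj
      rw [eval_mul, ih, if_neg hj, mul_zero]
    · simp

lemma laxList_prod (M K : ℕ) (I V : ℤ → ℤ → ℂ) (t : ℤ) :
    ((laxList M K I V t).map fun d => d 1).prod =
      (∏ k ∈ Finset.range K, V 1 (t - k * M)) * ∏ k ∈ Finset.range M, I 1 (t - k * K) := by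
  rw [laxList, List.map_append, List.prod_append, List.map_map, List.map_map, List.map_reverse,
    List.prod_reverse, Finset.prod_eq_multiset_prod, Finset.prod_eq_multiset_prod]
  rfl

/-- A matrix whose first column vanishes at `y = 0` is divisible by `S(y)` on the right. -/
lemma exists_eq_mul_shiftMatrix {N : ℕ} (hN : 0 < N) (A : Matrix (Fin N) (Fin N) ℂ[X])
    (hA : ∀ i, (A i ⟨0, hN⟩).eval 0 = 0) : ∃ B, A = B * shiftMatrix N := by
  refine ⟨Matrix.of fun i j => if hj : (j : ℕ) + 1 < N then A i ⟨j + 1, hj⟩ else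
    (A i ⟨0, hN⟩).divX, ?_⟩
  ext1 i j
  rw [Matrix.mul_apply]
  by_cases hj : (j : ℕ) = 0
  · have hj' : j = ⟨0, hN⟩ := Fin.ext hj
    subst hj'
    rw [Finset.sum_eq_single ⟨N - 1, by omega⟩]
    · have h1 : N - 1 + 1 = N := by omega
      have h2 := divX_mul_X_add (A i ⟨0, hN⟩)
      rw [coeff_zero_eq_eval_zero, hA, C_0, add_zero] at h2
      simp [shiftMatrix, h1, h2]
      intro h3; omega
    · intro k _ hk
      have : (k : ℕ) + 1 ≠ N := fun h => hk (Fin.ext (by simp; omega))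
      simp [shiftMatrix, this]
    · simp
  · rw [Finset.sum_eq_single ⟨j - 1, by omega⟩]
    · have h1 : (j : ℕ) - 1 + 1 = j := by omega
      simp [shiftMatrix, h1]
    · intro k _ hk
      have : (k : ℕ) + 1 ≠ j := fun h => hk (Fin.ext (by simp; omega))
      simp [shiftMatrix, this, hj]
    · simp

/-- `X_t = U_1 + B S` and the shifted matrix is `U_1 + S B`. -/
lemma IsSolution.laxX_factor_S {M K N : ℕ} (hN : 0 < N) {I V : ℤ → ℤ → ℂ}
    (h : IsSolution M K N I V) (t : ℤ) {U : ℂ}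
    (hU : U = (∏ k ∈ Finset.range K, V 1 (t - k * M)) * ∏ k ∈ Finset.range M, I 1 (t - k * K)) :
    ∃ B, laxX M K N I V t = Matrix.scalar (Fin N) (C U) + B * shiftMatrix N ∧
      laxX M K N (fun n s => I (n + 1) s) (fun n s => V (n + 1) s) t =
        Matrix.scalar (Fin N) (C U) + shiftMatrix N * B := by
  obtain ⟨B, hB⟩ := exists_eq_mul_shiftMatrix hN
    (laxX M K N I V t - Matrix.scalar (Fin N) (C U)) (fun i => by
      rw [Matrix.sub_apply, eval_sub, laxX_eq_prodLax, prodLax_apply_zero, laxList_prod, ← hU,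
        Matrix.scalar_apply, Matrix.diagonal_apply]
      split_ifs <;> simp)
  have hB' : laxX M K N I V t = Matrix.scalar (Fin N) (C U) + B * shiftMatrix N := by
    rw [← hB]; abel
  refine ⟨B, hB', ?_⟩
  -- Here S X_t = X' S for the shifted matrix X'. Inserting X_t = U + BS and cancelling S on the
  -- right, by its adjugate and det S ≠ 0, gives X' = U + SB.
  have h1 := shiftMatrix_mul_prodLax (N := N) (laxList M K I V t)
    fun d hd n => h.periodic_of_mem hd n
  rw [map_shift_laxList, ← laxX_eq_prodLax, ← laxX_eq_prodLax, hB'] at h1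
  have hdet : (shiftMatrix N).det ≠ 0 := by
    rw [shiftMatrix_eq_laxFactor, det_laxFactor hN]
    exact mul_ne_zero (neg_ne_zero.2 (pow_ne_zero _ (by simp))) (X_sub_C_ne_zero _)
  have hcomm : shiftMatrix N * Matrix.scalar (Fin N) (C U) =
      Matrix.scalar (Fin N) (C U) * shiftMatrix N :=
    (Matrix.scalar_commute _ (fun r' => Commute.all _ _) _).eq.symm
  have h2 : (laxX M K N (fun n s => I (n + 1) s) (fun n s => V (n + 1) s) t -
      (Matrix.scalar (Fin N) (C U) + shiftMatrix N * B)) * shiftMatrix N = 0 := by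
    rw [sub_mul, ← h1, mul_add, hcomm, add_mul, mul_assoc, sub_self]
  have h3 := congrArg (fun A => A * (shiftMatrix N).adjugate) h2
  simp only [mul_assoc, Matrix.mul_adjugate, zero_mul] at h3
  rw [Matrix.mul_smul, mul_one, smul_eq_zero] at h3
  exact sub_eq_zero.1 (h3.resolve_left hdet)

/-! ### Eigenvectors at infinity -/

section Infinity

variable {𝕂 : Type*} [Field 𝕂] {N : ℕ}

/-- The quasi-periodic extension of a vector, with `w_{i+N} = y w_i`. -/
def extend (hN : 0 < N) (y : 𝕂) (w : Fin N → 𝕂) (i : ℕ) : 𝕂 :=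
  y ^ (i / N) * w ⟨i % N, Nat.mod_lt _ hN⟩

lemma extend_of_lt (hN : 0 < N) (y : 𝕂) (w : Fin N → 𝕂) (i : Fin N) : extend hN y w i = w i := by
  simp [extend, Nat.div_eq_of_lt i.2, Nat.mod_eq_of_lt i.2]

lemma extend_add (hN : 0 < N) (y : 𝕂) (w : Fin N → 𝕂) (i : ℕ) :
    extend hN y w (i + N) = y * extend hN y w i := by
  simp [extend, Nat.add_div_right _ hN, pow_succ]; ring

lemma extend_smul (hN : 0 < N) (y : 𝕂) (w : Fin N → 𝕂) (c : 𝕂) (i : ℕ) :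
    extend hN y (c • w) i = c * extend hN y w i := by
  simp [extend]; ring

variable [Algebra ℂ 𝕂]

/-- On quasi-periodic extensions S acts as the index shift; the corner entry y is the wrap-around.
-/
lemma laxFactor_mulVec (hN : 0 < N) (y : 𝕂) (d : ℤ → ℂ) (w : Fin N → 𝕂) (i : Fin N) :
    ((laxFactor N d).map (aeval y)).mulVec w i =
      algebraMap ℂ 𝕂 (d ((i : ℕ) + 1)) * w i + extend hN y w (i + 1) := by
  have h1 : (laxFactor N d).map (aeval y) =
      Matrix.diagonal (fun i : Fin N => algebraMap ℂ 𝕂 (d ((i : ℕ) + 1))) +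
        (shiftMatrix N).map (aeval y) := by
    rw [laxFactor]
    ext1 i j
    simp only [Matrix.map_apply, Matrix.add_apply, map_add, Matrix.diagonal_apply]
    split_ifs <;> simp
  rw [h1, Matrix.add_mulVec, Pi.add_apply, Matrix.mulVec_diagonal]
  congr 1
  simp only [Matrix.mulVec, dotProduct, Matrix.map_apply, shiftMatrix, Matrix.of_apply]
  by_cases hi : (i : ℕ) + 1 < N
  · rw [Finset.sum_eq_single ⟨i + 1, hi⟩]
    · have := extend_of_lt hN y w ⟨i + 1, hi⟩
      simp only at this
      rw [this]; simp
    · intro j _ hj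
      have h2 : (i : ℕ) + 1 ≠ j := fun h => hj (Fin.ext h.symm)
      have h3 : ¬ ((i : ℕ) + 1 = N ∧ (j : ℕ) = 0) := fun h => by omega
      rw [if_neg h2, if_neg h3]; simp
    · simp
  · have hi' : (i : ℕ) + 1 = N := by have := i.2; omega
    rw [Finset.sum_eq_single ⟨0, hN⟩]
    · rw [hi']
      have h2 := extend_add hN y w 0
      have h3 := extend_of_lt hN y w ⟨0, hN⟩
      simp only at h3
      rw [zero_add, h3] at h2
      simp [h2, hN.ne']
    · intro j _ hj
      have h2 : (i : ℕ) + 1 ≠ j := fun h => by have := j.2; omega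
      have h3 : ¬ ((i : ℕ) + 1 = N ∧ (j : ℕ) = 0) := fun h => hj (Fin.ext h.2)
      rw [if_neg h2, if_neg h3]; simp
    · simp

lemma extend_laxFactor (hN : 0 < N) (y : 𝕂) (d : ℤ → ℂ) (w : Fin N → 𝕂) (i : ℕ) :
    extend hN y (((laxFactor N d).map (aeval y)).mulVec w) i =
      algebraMap ℂ 𝕂 (d ((i % N : ℕ) + 1)) * extend hN y w i + extend hN y w (i + 1) := by
  have h1 : extend hN y w (i + 1) = y ^ (i / N) * extend hN y w (i % N + 1) := by
    conv_lhs => rw [← Nat.mod_add_div i N]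
    generalize i / N = q
    generalize i % N = r
    induction q with
    | zero => simp
    | succ q ih =>
      have : r + N * (q + 1) + 1 = r + N * q + 1 + N := by ring
      rw [this, extend_add, ih, pow_succ]; ring
  rw [h1]
  conv_lhs => rw [extend]
  rw [laxFactor_mulVec hN]
  conv_rhs => rw [extend]
  ring

variable {p : Point 𝕂} {y : 𝕂}

/-- Under this growth bound the diagonal term is strictly smaller than the bound for w_{i+1}. So
equality in the new bound at i is decided by equality in the old one at i + 1. -/
lemma extend_laxFactor_val (hN : 0 < N) {ρ : ℤᵐ⁰} (hρ : ρ ≠ 0) (d : ℤ → ℂ) {w : Fin N → 𝕂}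
    (hw : ∀ i, p.val (extend hN y w i) ≤ ρ * exp (i : ℤ)) (i : ℕ) :
    p.val (extend hN y (((laxFactor N d).map (aeval y)).mulVec w) i) ≤ ρ * exp 1 * exp (i : ℤ) ∧
    (p.val (extend hN y (((laxFactor N d).map (aeval y)).mulVec w) i) = ρ * exp 1 * exp (i : ℤ) ↔
      p.val (extend hN y w (i + 1)) = ρ * exp ((i + 1 : ℕ) : ℤ)) := by
  have h1 : p.val (algebraMap ℂ 𝕂 (d ((i % N : ℕ) + 1)) * extend hN y w i) <
      ρ * exp ((i + 1 : ℕ) : ℤ) := by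
    rw [map_mul]
    refine (mul_le_of_le_one_left' (p.val_algebraMap_le_one _)).trans_lt ((hw i).trans_lt ?_)
    exact mul_lt_mul_of_pos_left (exp_lt_exp.2 (by push_cast; omega)) (zero_lt_iff.2 hρ)
  have h2 : ρ * exp 1 * exp (i : ℤ) = ρ * exp ((i + 1 : ℕ) : ℤ) := by
    rw [mul_assoc, ← exp_add]; congr 2; push_cast; ring
  rw [h2, extend_laxFactor]
  refine ⟨p.val.map_add_le h1.le (hw _), ?_, ?_⟩
  · intro h3
    by_contra h4
    exact (p.val.map_add_lt h1 (lt_of_le_of_ne (hw _) h4)).ne h3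
  · intro h3
    rw [Valuation.map_add_eq_of_lt_right _ (by rw [h3]; exact h1)]
    exact h3

lemma extend_prodLax_val (hN : 0 < N) {ρ : ℤᵐ⁰} (hρ : ρ ≠ 0) (ds : List (ℤ → ℂ)) {w : Fin N → 𝕂}
    (hw : ∀ i, p.val (extend hN y w i) ≤ ρ * exp (i : ℤ)) (i : ℕ) :
    p.val (extend hN y (((prodLax N ds).map (aeval y)).mulVec w) i) ≤
      ρ * exp (ds.length : ℤ) * exp (i : ℤ) ∧
    (p.val (extend hN y (((prodLax N ds).map (aeval y)).mulVec w) i) =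
        ρ * exp (ds.length : ℤ) * exp (i : ℤ) ↔
      p.val (extend hN y w (i + ds.length)) = ρ * exp ((i + ds.length : ℕ) : ℤ)) := by
  induction ds generalizing i with
  | nil =>
    have : (prodLax N []).map (aeval y) = (1 : Matrix (Fin N) (Fin N) 𝕂) := by
      simp [prodLax]
    rw [this, Matrix.one_mulVec]
    simpa using hw i
  | cons d ds ih =>
    have h1 : (prodLax N (d :: ds)).map (aeval y) =
        (laxFactor N d).map (aeval y) * (prodLax N ds).map (aeval y) := by
      rw [prodLax_cons, Matrix.map_mul]
    have h2 := extend_laxFactor_val (p := p) (y := y) hN (ρ := ρ * exp (ds.length : ℤ))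
      (mul_ne_zero hρ exp_ne_zero) d (fun i => (ih i).1) i
    have h3 : ρ * exp (ds.length : ℤ) * exp 1 = ρ * exp ((d :: ds).length : ℤ) := by
      rw [mul_assoc, ← exp_add]; simp
    rw [h1, ← Matrix.mulVec_mulVec]
    rw [h3] at h2
    refine ⟨h2.1, h2.2.trans ((ih (i + 1)).2.trans ?_)⟩
    have h4 : i + 1 + ds.length = i + (d :: ds).length := by simp; ring
    rw [h4]

/-- Behaviour at infinity of an eigenvector. -/
theorem val_eigenvector (hN : 0 < N) {x : 𝕂} {ds : List (ℤ → ℂ)}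
    (hlen : 0 < ds.length)
    (hcop : Nat.Coprime ds.length N) (hx : p.val x = exp (ds.length : ℤ))
    (hy : p.val y = exp (N : ℤ)) {w : Fin N → 𝕂} (hw0 : w ≠ 0)
    (hw : ((prodLax N ds).map (aeval y)).mulVec w = x • w) :
    w ⟨0, hN⟩ ≠ 0 ∧ ∀ i, p.val (extend hN y w i) = p.val (w ⟨0, hN⟩) * exp (i : ℤ) := by
  have : Nonempty (Fin N) := ⟨⟨0, hN⟩⟩
  obtain ⟨k, -, hk⟩ := Finset.exists_max_image Finset.univ
    (fun i : Fin N => p.val (w i) * exp (-((i : ℕ) : ℤ))) Finset.univ_nonempty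
  set ρ := p.val (w k) * exp (-((k : ℕ) : ℤ)) with hρdef
  have hρ : ρ ≠ 0 := by
    intro h0
    apply hw0
    funext i
    have h1 := hk i (Finset.mem_univ _)
    rw [h0, le_zero_iff, mul_eq_zero] at h1
    simpa using h1.resolve_right exp_ne_zero
  have hperiod : ∀ i q : ℕ, p.val (extend hN y w (i + N * q)) =
      exp ((N * q : ℕ) : ℤ) * p.val (extend hN y w i) := by
    intro i q
    induction q with
    | zero => simp
    | succ q ih =>
      rw [mul_add, mul_one, ← add_assoc, extend_add, map_mul, ih, hy, ← mul_assoc, ← exp_add]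
      congr 2; push_cast; ring
  have hbound : ∀ i, p.val (extend hN y w i) ≤ ρ * exp (i : ℤ) := by
    intro i
    have h1 := hk ⟨i % N, Nat.mod_lt _ hN⟩ (Finset.mem_univ _)
    have h2 : p.val (extend hN y w (i % N)) ≤ ρ * exp ((i % N : ℕ) : ℤ) := by
      have h3 := extend_of_lt hN y w ⟨i % N, Nat.mod_lt _ hN⟩
      simp only at h3
      rw [h3]
      have := mul_le_mul_left h1 (exp ((i % N : ℕ) : ℤ))
      rwa [mul_assoc, ← exp_add, neg_add_cancel, exp_zero, mul_one] at this
    conv_lhs => rw [← Nat.mod_add_div i N]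
    rw [hperiod]
    refine (mul_le_mul_right h2 _).trans ?_
    rw [mul_left_comm, ← exp_add]
    refine mul_le_mul_right (exp_le_exp.2 ?_) _
    have := Nat.mod_add_div i N
    omega
  -- The indices with equality in `hbound` are stable under translation by N, by quasi-periodicity,
  -- and under translation by the number of factors, by the eigenvalue equation (`hTm`). They
  -- include k, so coprimality yields all indices.
  have hTN : ∀ i q : ℕ, p.val (extend hN y w (i + N * q)) = ρ * exp ((i + N * q : ℕ) : ℤ) ↔
      p.val (extend hN y w i) = ρ * exp (i : ℤ) := by
    intro i q
    have h1 : ρ * exp ((i + N * q : ℕ) : ℤ) = exp ((N * q : ℕ) : ℤ) * (ρ * exp (i : ℤ)) := by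
      rw [mul_left_comm, ← exp_add]; congr 2; push_cast; ring
    rw [hperiod, h1, mul_right_inj' exp_ne_zero]
  have hTm : ∀ i : ℕ, p.val (extend hN y w (i + ds.length)) = ρ * exp ((i + ds.length : ℕ) : ℤ) ↔
      p.val (extend hN y w i) = ρ * exp (i : ℤ) := by
    intro i
    rw [← (extend_prodLax_val hN hρ ds hbound i).2, hw, extend_smul, map_mul, hx, mul_comm ρ,
      mul_assoc, mul_right_inj' exp_ne_zero]
  have hTmq : ∀ i q : ℕ, p.val (extend hN y w (i + ds.length * q)) =
      ρ * exp ((i + ds.length * q : ℕ) : ℤ) ↔ p.val (extend hN y w i) = ρ * exp (i : ℤ) := by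
    intro i q
    induction q with
    | zero => simp
    | succ q ih => rw [← ih, ← hTm (i + ds.length * q), mul_add, mul_one, ← add_assoc]
  have hTk : p.val (extend hN y w (k : ℕ)) = ρ * exp ((k : ℕ) : ℤ) := by
    rw [extend_of_lt, hρdef, mul_assoc, ← exp_add, neg_add_cancel, exp_zero, mul_one]
  have hall : ∀ i : ℕ, p.val (extend hN y w i) = ρ * exp (i : ℤ) := by
    intro i
    -- A common index reached from k in steps of the length and from i in steps of N; a multiple of
    -- both moduli is added to put it beyond k and i.
    obtain ⟨c, hc1, hc2⟩ := Nat.chineseRemainder hcop (k : ℕ) i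
    have hle : (k : ℕ) + i ≤ c + ds.length * N * (k + i) := by
      have : 1 * ((k : ℕ) + i) ≤ ds.length * N * (k + i) :=
        Nat.mul_le_mul_right _ (Nat.mul_pos hlen hN)
      omega
    have h1 : (k : ℕ) ≡ c + ds.length * N * (k + i) [MOD ds.length] := by
      have : c + ds.length * N * (k + i) ≡ c + 0 [MOD ds.length] :=
        Nat.ModEq.add_left _ (Nat.modEq_zero_iff_dvd.2 ⟨N * (k + i), by ring⟩)
      exact (this.trans hc1).symm
    have h2 : i ≡ c + ds.length * N * (k + i) [MOD N] := by
      have : c + ds.length * N * (k + i) ≡ c + 0 [MOD N] :=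
        Nat.ModEq.add_left _ (Nat.modEq_zero_iff_dvd.2 ⟨ds.length * (k + i), by ring⟩)
      exact (this.trans hc2).symm
    obtain ⟨a, ha⟩ := (Nat.modEq_iff_dvd' (by omega)).1 h1
    obtain ⟨q, hq⟩ := (Nat.modEq_iff_dvd' (by omega)).1 h2
    rw [← hTN i q, show i + N * q = k + ds.length * a by omega, hTmq]
    exact hTk
  have h0 := hall 0
  have h00 := extend_of_lt hN y w ⟨0, hN⟩
  simp only at h00
  rw [h00, Nat.cast_zero, exp_zero, mul_one] at h0
  refine ⟨fun h => ?_, fun i => by rw [h0]; exact hall i⟩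
  rw [h, map_zero] at h0
  exact hρ h0.symm

end Infinity

/-! ### Orders and divisors of vector functions -/

section Vector

variable {𝕂 : Type*} [Field 𝕂] [Algebra ℂ 𝕂] {N : ℕ}

/-- The value of a vector: the maximum of the values of its entries. -/
def Point.valVec (p : Point 𝕂) (v : Fin N → 𝕂) : ℤᵐ⁰ := Finset.univ.sup fun i => p.val (v i)

namespace Point

variable (p : Point 𝕂)

lemma val_le_valVec (v : Fin N → 𝕂) (i : Fin N) : p.val (v i) ≤ p.valVec v :=
  Finset.le_sup (f := fun i => p.val (v i)) (Finset.mem_univ i)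

lemma valVec_le {v : Fin N → 𝕂} {z : ℤᵐ⁰} (h : ∀ i, p.val (v i) ≤ z) : p.valVec v ≤ z :=
  Finset.sup_le fun i _ => h i

lemma valVec_ne_zero {v : Fin N → 𝕂} (hv : v ≠ 0) : p.valVec v ≠ 0 := by
  obtain ⟨i, hi⟩ := Function.ne_iff.1 hv
  intro h
  have := p.val_le_valVec v i
  rw [h, le_zero_iff] at this
  exact hi (by simpa using this)

lemma exists_val_eq_valVec {v : Fin N → 𝕂} (hv : v ≠ 0) :
    ∃ i, v i ≠ 0 ∧ p.val (v i) = p.valVec v := by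
  obtain ⟨j, hj⟩ := Function.ne_iff.1 hv
  obtain ⟨i, -, hi⟩ := Finset.exists_mem_eq_sup Finset.univ ⟨j, Finset.mem_univ j⟩
    fun i => p.val (v i)
  refine ⟨i, fun h0 => p.valVec_ne_zero hv ?_, hi.symm⟩
  rw [valVec, hi, h0, map_zero]

lemma valVec_eq_exp {v : Fin N → 𝕂} (hv : v ≠ 0) : p.valVec v = exp (-p.ordVec v) := by
  rw [ordVec, neg_neg]; exact (exp_log (p.valVec_ne_zero hv)).symm

lemma ordVec_eq {v : Fin N → 𝕂} {n : ℤ} (h : p.valVec v = exp n) : p.ordVec v = -n := by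
  have : p.ordVec v = -log (p.valVec v) := rfl
  rw [this, h, log_exp]

lemma val_eq_exp_ord {f : 𝕂} (hf : f ≠ 0) : p.val f = exp (-p.ord f) := by
  rw [ord, neg_neg]; exact (exp_log (by simpa using hf)).symm

lemma ord_mul {f g : 𝕂} (hf : f ≠ 0) (hg : g ≠ 0) : p.ord (f * g) = p.ord f + p.ord g := by
  rw [ord, ord, ord, map_mul, log_mul (by simpa using hf) (by simpa using hg)]; ring

lemma ord_inv (f : 𝕂) : p.ord f⁻¹ = -p.ord f := by
  rw [ord, ord, map_inv₀, log_inv]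

lemma valVec_smul (c : 𝕂) (v : Fin N → 𝕂) : p.valVec (c • v) = p.val c * p.valVec v := by
  by_cases hv : v = 0
  · have h0 : ∀ w : Fin N → 𝕂, w = 0 → p.valVec w = 0 := by
      rintro w rfl
      exact le_zero_iff.1 (p.valVec_le (by simp))
    rw [h0 v hv, h0 _ (by rw [hv, smul_zero]), mul_zero]
  apply le_antisymm
  · refine p.valVec_le fun i => ?_
    rw [Pi.smul_apply, smul_eq_mul, map_mul]
    exact mul_le_mul_right (p.val_le_valVec v i) _
  · obtain ⟨i, -, hi⟩ := p.exists_val_eq_valVec hv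
    rw [← hi, ← map_mul]
    exact p.val_le_valVec (c • v) i

lemma ordVec_smul {c : 𝕂} (hc : c ≠ 0) {v : Fin N → 𝕂} (hv : v ≠ 0) :
    p.ordVec (c • v) = p.ord c + p.ordVec v := by
  have := p.ordVec_eq (v := c • v) (n := -p.ord c + -p.ordVec v) (by
    rw [valVec_smul, p.valVec_eq_exp hv, p.val_eq_exp_ord hc, exp_add])
  rw [this]; ring

lemma valVec_mulVec_le {A : Matrix (Fin N) (Fin N) 𝕂} (hA : ∀ i j, p.val (A i j) ≤ 1)
    (v : Fin N → 𝕂) : p.valVec (A.mulVec v) ≤ p.valVec v := by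
  refine p.valVec_le fun i => ?_
  rw [Matrix.mulVec, dotProduct]
  refine p.val.map_sum_le fun j _ => ?_
  rw [map_mul]
  exact (mul_le_of_le_one_left' (hA i j)).trans (p.val_le_valVec v j)

end Point

end Vector

namespace IsTriangular

variable {m N : ℕ} {F : ℂ[X][X]} [IsDomain (AdjoinRoot F)]

lemma isAtInfinity_val (h : IsTriangular m N F) {P : Point (FunField F)} (hP : IsAtInfinity P) :
    P.val (xFun F) = exp (m : ℤ) ∧ P.val (yFun F) = exp (N : ℤ) := by
  obtain ⟨Q, hx, hy, -⟩ := h.exists_infinity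
  have hQ : IsAtInfinity Q := by
    constructor
    · rw [Point.HasPole, hx, ← exp_zero, exp_lt_exp]; exact_mod_cast h.m_pos
    · rw [Point.HasPole, hy, ← exp_zero, exp_lt_exp]; exact_mod_cast h.N_pos
  rw [h.isAtInfinity_unique hP hQ]; exact ⟨hx, hy⟩

lemma exists_isAtInfinity (h : IsTriangular m N F) : ∃ P : Point (FunField F), IsAtInfinity P := by
  obtain ⟨Q, hx, hy, -⟩ := h.exists_infinity
  refine ⟨Q, ?_, ?_⟩
  · rw [Point.HasPole, hx, ← exp_zero, exp_lt_exp]; exact_mod_cast h.m_pos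
  · rw [Point.HasPole, hy, ← exp_zero, exp_lt_exp]; exact_mod_cast h.N_pos

variable (h : IsTriangular m N F) (hs : IsSmoothAffine F)
include h hs

/-- The divisor of a nonzero vector function. -/
lemma exists_ordVec_divisor {k : ℕ} {v : Fin k → FunField F} (hv : v ≠ 0) :
    ∃ D : Divisor (FunField F), ∀ p, D p = p.ordVec v := by
  have hfin : (Function.support fun p : Point (FunField F) => p.ordVec v).Finite := by
    refine (Set.finite_iUnion (ι := {i : Fin k // v i ≠ 0})
      (f := fun i => {p : Point (FunField F) | p.val (v i) ≠ 1})
      fun i => h.finite_val_ne_one hs i.2).subset ?_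
    intro p hp
    obtain ⟨i, hi, hi'⟩ := p.exists_val_eq_valVec hv
    refine Set.mem_iUnion.2 ⟨⟨i, hi⟩, fun h1 => hp ?_⟩
    have h1' : p.val (v i) = 1 := h1
    have := p.ordVec_eq (v := v) (n := 0) (by rw [← hi', h1', exp_zero])
    simpa using this
  exact ⟨Finsupp.ofSupportFinite _ hfin, fun p => rfl⟩

lemma exists_ord_divisor {f : FunField F} (hf : f ≠ 0) :
    ∃ D : Divisor (FunField F), ∀ p, D p = p.ord f :=
  ⟨Finsupp.ofSupportFinite (fun p => p.ord f) ((h.finite_val_ne_one hs hf).subset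
    fun p hp h1 => hp (by
      have h1' : p.val f = 1 := h1
      simp [Point.ord, h1'])), fun p => rfl⟩

end IsTriangular

/-! ### Eigenvectors on the spectral curve and the module of their entries -/

section Eigenvector

variable {N : ℕ} {F : ℂ[X][X]} [IsDomain (AdjoinRoot F)]

lemma exists_isEigenvector {A : Matrix (Fin N) (Fin N) ℂ[X]} (hA : A.charpoly = F) :
    ∃ v, IsEigenvector F A v := by
  have h1 : (Matrix.scalar (Fin N) (xFun F) - A.map (aeval (yFun F))).det = 0 := by
    rw [← Matrix.eval_charpoly]
    have h2 := Matrix.charpoly_map A (aeval (yFun F) : ℂ[X] →ₐ[ℂ] FunField F).toRingHom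
    have h3 : A.map (aeval (yFun F)) =
        A.map (aeval (yFun F) : ℂ[X] →ₐ[ℂ] FunField F).toRingHom := rfl
    rw [h3, h2, hA, eval_map]
    exact IsTriangular.eval₂_eq_zero F
  obtain ⟨v, hv, hv'⟩ := Matrix.exists_mulVec_eq_zero_iff.2 h1
  refine ⟨v, hv, ?_⟩
  rw [Matrix.sub_mulVec, sub_eq_zero] at hv'
  rw [← hv', Matrix.scalar_apply]
  ext i; simp [Matrix.mulVec_diagonal]

variable {ds : List (ℤ → ℂ)} (h : IsTriangular ds.length N F)
  {P : Point (FunField F)} (hP : IsAtInfinity P)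
include h hP

lemma IsEigenvector.val_extend {v : Fin N → FunField F} (hv : IsEigenvector F (prodLax N ds) v) :
    v ⟨0, h.N_pos⟩ ≠ 0 ∧
      ∀ i, P.val (extend h.N_pos (yFun F) v i) = P.val (v ⟨0, h.N_pos⟩) * exp (i : ℤ) :=
  val_eigenvector h.N_pos h.m_pos h.coprime (h.isAtInfinity_val hP).1 (h.isAtInfinity_val hP).2
    hv.1 hv.2

lemma IsEigenvector.val_apply {v : Fin N → FunField F} (hv : IsEigenvector F (prodLax N ds) v)
    (i : Fin N) : P.val (v i) = P.val (v ⟨0, h.N_pos⟩) * exp ((i : ℕ) : ℤ) := by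
  rw [← (hv.val_extend h hP).2, extend_of_lt]

/-- Eigenvectors are unique up to a factor. -/
lemma IsEigenvector.exists_smul_eq {v w : Fin N → FunField F}
    (hv : IsEigenvector F (prodLax N ds) v) (hw : IsEigenvector F (prodLax N ds) w) :
    ∃ c : FunField F, c ≠ 0 ∧ w = c • v := by
  have hv0 := (hv.val_extend h hP).1
  have hw0 := (hw.val_extend h hP).1
  refine ⟨w ⟨0, h.N_pos⟩ / v ⟨0, h.N_pos⟩, div_ne_zero hw0 hv0, ?_⟩
  by_contra hne
  set c := w ⟨0, h.N_pos⟩ / v ⟨0, h.N_pos⟩ with hc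
  -- This difference would be an eigenvector with vanishing first entry, which the behaviour at
  -- infinity forbids.
  have hu : IsEigenvector F (prodLax N ds) (w - c • v) := by
    refine ⟨sub_ne_zero.2 hne, ?_⟩
    rw [Matrix.mulVec_sub, Matrix.mulVec_smul, hv.2, hw.2, smul_sub, smul_comm]
  apply (hu.val_extend h hP).1
  simp [hc, div_mul_cancel₀ _ hv0]

/-- The pole order grows by one from entry to entry, so the last entry decides. This is the source
of N - 1 in the degree of the class. -/
lemma IsEigenvector.valVec_infinity {v : Fin N → FunField F}
    (hv : IsEigenvector F (prodLax N ds) v) :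
    P.valVec v = P.val (v ⟨0, h.N_pos⟩) * exp ((N : ℤ) - 1) := by
  have hN := h.N_pos
  apply le_antisymm
  · refine P.valVec_le fun i => ?_
    rw [hv.val_apply h hP]
    exact mul_le_mul_right (exp_le_exp.2 (by have := i.2; omega)) _
  · have h1 := hv.val_apply h hP ⟨N - 1, by omega⟩
    have h2 : ((N - 1 : ℕ) : ℤ) = (N : ℤ) - 1 := by omega
    simp only [h2] at h1
    rw [← h1]
    exact P.val_le_valVec v _

/-- The action of one Lax factor on an eigenvector, at infinity. -/
lemma IsEigenvector.valVec_laxFactor {v : Fin N → FunField F}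
    (hv : IsEigenvector F (prodLax N ds) v) (d : ℤ → ℂ) :
    P.valVec (((laxFactor N d).map (aeval (yFun F))).mulVec v) = P.valVec v * exp 1 := by
  have hN := h.N_pos
  have hρ : P.val (v ⟨0, h.N_pos⟩) ≠ 0 := by simpa using (hv.val_extend h hP).1
  have key : ∀ i : Fin N, P.val ((((laxFactor N d).map (aeval (yFun F))).mulVec v) i) =
      P.val (v ⟨0, h.N_pos⟩) * exp 1 * exp ((i : ℕ) : ℤ) := by
    intro i
    rw [← extend_of_lt h.N_pos (yFun F) (((laxFactor N d).map (aeval (yFun F))).mulVec v) i]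
    refine (extend_laxFactor_val h.N_pos hρ d (fun i => ((hv.val_extend h hP).2 i).le) i).2.2 ?_
    exact (hv.val_extend h hP).2 _
  rw [hv.valVec_infinity h hP]
  apply le_antisymm
  · refine P.valVec_le fun i => ?_
    rw [key, mul_assoc, mul_assoc, ← exp_add, ← exp_add]
    exact mul_le_mul_right (exp_le_exp.2 (by have := i.2; omega)) _
  · have h1 := key ⟨N - 1, by omega⟩
    have h2 : ((N - 1 : ℕ) : ℤ) = (N : ℤ) - 1 := by omega
    simp only [h2] at h1
    rw [mul_assoc, mul_comm (exp ((N : ℤ) - 1)), ← mul_assoc, ← h1]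
    exact P.val_le_valVec _ _

/-- A nonzero combination of the entries of an eigenvector over `ℂ[y]` does not vanish at
infinity. -/
lemma IsEigenvector.one_le_val {v : Fin N → FunField F} (hv : IsEigenvector F (prodLax N ds) v)
    (hv0 : v ⟨0, h.N_pos⟩ = 1) (r : Fin N → ℂ[X]) (hne : ∑ i, aeval (yFun F) (r i) * v i ≠ 0) :
    1 ≤ P.val (∑ i, aeval (yFun F) (r i) * v i) := by
  have hN : (0 : ℤ) < N := by exact_mod_cast h.N_pos
  have hterm : ∀ i, r i ≠ 0 → P.val (aeval (yFun F) (r i) * v i) =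
      exp ((N * (r i).natDegree + (i : ℕ) : ℕ) : ℤ) := by
    intro i hi
    rw [map_mul, hv.val_apply h hP, hv0, map_one, one_mul,
      IsTriangular.valuation_aeval P.val (fun c hc => P.val_algebraMap hc) hN
        (h.isAtInfinity_val hP).2 hi, ← exp_add]
    congr 1
  -- The pole orders N deg(r_i) + i are distinct modulo N, so nothing cancels, and all are
  -- nonnegative.
  rw [valuation_sum_eq_sup]
  · obtain ⟨i, -, hi⟩ := Finset.exists_ne_zero_of_sum_ne_zero hne
    have hri : r i ≠ 0 := by rintro h0; simp [h0] at hi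
    refine le_trans ?_ (Finset.le_sup (f := fun i => P.val (aeval (yFun F) (r i) * v i))
      (Finset.mem_univ i))
    rw [hterm i hri, ← exp_zero, exp_le_exp]; positivity
  · intro i _ j _ hij hne'
    have hri : r i ≠ 0 := by rintro h0; simp [h0] at hne'
    have hrj : r j ≠ 0 := by rintro h0; rw [hij] at hne'; simp [h0] at hne'
    rw [hterm i hri, hterm j hrj, exp_inj] at hij
    have h1 : N * (r i).natDegree + (i : ℕ) = N * (r j).natDegree + (j : ℕ) := by exact_mod_cast hij
    have h2 := congrArg (· % N) h1
    simp only [Nat.mul_add_mod, Nat.mod_eq_of_lt i.2, Nat.mod_eq_of_lt j.2] at h2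
    exact Fin.ext h2

omit hP in
/-- A function whose affine poles are bounded by those of an eigenvector is a combination of its
entries over `ℂ[y]`. -/
lemma IsEigenvector.exists_combination (hs : IsSmoothAffine F) {v : Fin N → FunField F}
    (hv : IsEigenvector F (prodLax N ds) v) {f : FunField F}
    (hf : ∀ p : Point (FunField F), ¬ IsAtInfinity p → p.val f ≤ p.valVec v) :
    ∃ r : Fin N → ℂ[X], f = ∑ i, aeval (yFun F) (r i) * v i := by
  -- A local-global argument: if the ideal `I` of denominators of f modulo `J` were proper, it would
  -- vanish at some affine point; but there the entry of largest value divides f in the local ring.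
  set J : Submodule (AdjoinRoot F) (FunField F) := Submodule.span _ (Set.range v) with hJ
  have hvJ : ∀ (s : AdjoinRoot F) i, algebraMap _ (FunField F) s * v i ∈ J := fun s i => by
    rw [← Algebra.smul_def]
    exact J.smul_mem _ (Submodule.subset_span ⟨i, rfl⟩)
  set I : Ideal (AdjoinRoot F) := J.comap (LinearMap.toSpanSingleton _ _ f) with hI
  have hmemI : ∀ t, t ∈ I ↔ algebraMap _ (FunField F) t * f ∈ J := fun t => by
    rw [hI, Submodule.mem_comap, LinearMap.toSpanSingleton_apply, Algebra.smul_def]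
  have hfJ : f ∈ J := by
    have htop : I = ⊤ := by
      by_contra hne
      obtain ⟨k, hk⟩ := Function.ne_iff.1 hv.1
      have hk' : v k ≠ 0 := hk
      obtain ⟨s, t, ht, hst⟩ := IsFractionRing.div_surjective (A := AdjoinRoot F) (f / v k)
      have ht0 : t ≠ 0 := nonZeroDivisors.ne_zero ht
      have ht' : algebraMap _ (FunField F) t ≠ 0 := by simpa using ht0
      have htI : t ∈ I := by
        rw [hmemI]
        have : algebraMap _ (FunField F) t * f = algebraMap _ (FunField F) s * v k := by
          field_simp at hst; rw [hst]
        rw [this]; exact hvJ s k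
      obtain ⟨a, b, hab, hvan⟩ := h.exists_point_of_ne_top hne ht0 htI
      obtain ⟨p, hp⟩ := h.exists_isOver_of_evalEval hs hab
      have hpinf : ¬ IsAtInfinity p := fun h1 => absurd hp.1.val_le_one (not_le.2 h1.1)
      obtain ⟨l, hl, hl'⟩ := p.exists_val_eq_valVec hv.1
      obtain ⟨s', t', ht1, hst'⟩ := h.exists_frac hs hp (f := f / v l) (by
        rw [map_div₀, div_le_one₀ (zero_lt_iff.2 (by simpa using hl)), hl']
        exact hf p hpinf)
      apply ht1
      apply hvan
      have ht0' : algebraMap _ (FunField F) t' ≠ 0 := by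
        intro h0
        have : t' = 0 := by simpa using h0
        exact ht1 (by rw [this, map_zero])
      rw [hmemI]
      have : algebraMap _ (FunField F) t' * f = algebraMap _ (FunField F) s' * v l := by
        field_simp at hst'; rw [mul_comm, hst']; ring
      rw [this]; exact hvJ s' l
    have h1 : (1 : AdjoinRoot F) ∈ I := by rw [htop]; trivial
    rw [hmemI, map_one, one_mul] at h1
    exact h1
  -- The eigenvalue equation expresses x times an entry through the entries, so their ℂ[y]-span is
  -- already a module over the coordinate ring.
  have hx : ∀ g : FunField F, (∃ r : Fin N → ℂ[X], g = ∑ i, aeval (yFun F) (r i) * v i) →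
      ∃ r : Fin N → ℂ[X], xFun F * g = ∑ i, aeval (yFun F) (r i) * v i := by
    rintro g ⟨r, rfl⟩
    refine ⟨Matrix.vecMul r (prodLax N ds), ?_⟩
    have h1 : ∀ i, xFun F * v i = ∑ j, aeval (yFun F) (prodLax N ds i j) * v j := fun i =>
      (congrFun hv.2 i).symm
    rw [Finset.mul_sum]
    simp_rw [mul_left_comm (xFun F), h1, Finset.mul_sum, Matrix.vecMul, dotProduct, map_sum,
      map_mul, Finset.sum_mul, mul_assoc]
    exact Finset.sum_comm
  have hy : ∀ (q : ℂ[X]) (g : FunField F),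
      (∃ r : Fin N → ℂ[X], g = ∑ i, aeval (yFun F) (r i) * v i) →
      ∃ r : Fin N → ℂ[X], aeval (yFun F) q * g = ∑ i, aeval (yFun F) (r i) * v i := by
    rintro q g ⟨r, rfl⟩
    refine ⟨fun i => q * r i, ?_⟩
    rw [Finset.mul_sum]
    simp only [map_mul, mul_assoc]
  have hadd : ∀ g g' : FunField F,
      (∃ r : Fin N → ℂ[X], g = ∑ i, aeval (yFun F) (r i) * v i) →
      (∃ r : Fin N → ℂ[X], g' = ∑ i, aeval (yFun F) (r i) * v i) →
      ∃ r : Fin N → ℂ[X], g + g' = ∑ i, aeval (yFun F) (r i) * v i := by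
    rintro g g' ⟨r, rfl⟩ ⟨r', rfl⟩
    refine ⟨r + r', ?_⟩
    simp only [Pi.add_apply, map_add, add_mul, Finset.sum_add_distrib]
  have hsmul : ∀ (a : AdjoinRoot F) (g : FunField F),
      (∃ r : Fin N → ℂ[X], g = ∑ i, aeval (yFun F) (r i) * v i) →
      ∃ r : Fin N → ℂ[X], a • g = ∑ i, aeval (yFun F) (r i) * v i := by
    intro a g hg
    obtain ⟨a, rfl⟩ := AdjoinRoot.mk_surjective a
    induction a using Polynomial.induction_on' with
    | add a b ha hb => rw [map_add, add_smul]; exact hadd _ _ ha hb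
    | monomial n q =>
      have h1 : ∀ n : ℕ, ∃ r : Fin N → ℂ[X], xFun F ^ n * g = ∑ i, aeval (yFun F) (r i) * v i := by
        intro n
        induction n with
        | zero => simpa using hg
        | succ n ih =>
          rw [pow_succ', mul_assoc]
          exact hx _ ih
      have h2 : AdjoinRoot.mk F (monomial n q) • g = aeval (yFun F) q * (xFun F ^ n * g) := by
        rw [Algebra.smul_def, IsTriangular.algebraMap_mk, eval₂_monomial, mul_assoc]; rfl
      rw [h2]
      exact hy _ _ (h1 n)
  have key : ∀ g ∈ J, ∃ r : Fin N → ℂ[X], g = ∑ i, aeval (yFun F) (r i) * v i := by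
    intro g hg
    induction hg using Submodule.span_induction with
    | mem g hg =>
      obtain ⟨k, rfl⟩ := hg
      refine ⟨Pi.single k 1, ?_⟩
      rw [Finset.sum_eq_single k]
      · simp
      · intro j _ hj; simp [Pi.single_eq_of_ne hj]
      · simp
    | zero => exact ⟨0, by simp⟩
    | add g g' _ _ hg hg' => exact hadd _ _ hg hg'
    | smul a g _ hg => exact hsmul a g hg
  exact key f hfJ

end Eigenvector

/-! ### The class of the eigenvector map and its degree -/

lemma cls_eq_iff {𝕂 : Type*} [Field 𝕂] [Algebra ℂ 𝕂] {D E : Divisor 𝕂} :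
    cls D = cls E ↔ ∃ f : 𝕂, f ≠ 0 ∧ ∀ p, E p - D p = p.ord f := by
  rw [cls, cls, QuotientAddGroup.eq]
  refine exists_congr fun f => and_congr_right fun _ => forall_congr' fun p => ?_
  rw [Finsupp.add_apply, Finsupp.neg_apply, neg_add_eq_sub]

section Class

variable {N : ℕ} {F : ℂ[X][X]} [IsDomain (AdjoinRoot F)]
  {ds : List (ℤ → ℂ)} (h : IsTriangular ds.length N F) (hs : IsSmoothAffine F)
  {P : Point (FunField F)} (hP : IsAtInfinity P)
include h hs hP

/-- The class of the eigenvector map, computed from any eigenvector. -/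
lemma IsEigenvector.isEigenvectorClass_iff {v : Fin N → FunField F}
    (hv : IsEigenvector F (prodLax N ds) v) {D : Divisor (FunField F)}
    (hD : ∀ p, D p = p.ordVec v) (c : Pic (FunField F)) :
    IsEigenvectorClass F (prodLax N ds) c ↔ c = cls (-D) := by
  constructor
  · rintro ⟨w, hw, a, ha, E, hE, rfl⟩
    obtain ⟨g, hg, rfl⟩ := hv.exists_smul_eq h hP hw
    have hsum : ∑ i, a i • (g • v) i = g * ∑ i, a i • v i := by
      rw [Finset.mul_sum]
      simp only [Pi.smul_apply, smul_eq_mul, mul_smul_comm]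
    rw [hsum] at ha hE
    refine cls_eq_iff.2 ⟨(∑ i, a i • v i)⁻¹, inv_ne_zero (right_ne_zero_of_mul ha), fun p => ?_⟩
    rw [Finsupp.neg_apply, hE, hD, p.ord_mul hg (right_ne_zero_of_mul ha), p.ordVec_smul hg hv.1,
      p.ord_inv]
    ring
  · rintro rfl
    have hv0 := (hv.val_extend h hP).1
    obtain ⟨E, hE⟩ := h.exists_ord_divisor hs hv0
    have hsum : ∑ i, (Pi.single ⟨0, h.N_pos⟩ 1 : Fin N → ℂ) i • v i = v ⟨0, h.N_pos⟩ := by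
      rw [Finset.sum_eq_single ⟨0, h.N_pos⟩]
      · simp
      · intro j _ hj; simp [Pi.single_eq_of_ne hj]
      · simp
    refine ⟨v, hv, Pi.single ⟨0, h.N_pos⟩ 1, by rwa [hsum], E - D, fun p => ?_, ?_⟩
    · rw [hsum, Finsupp.sub_apply, hE, hD]
    · refine cls_eq_iff.2 ⟨(v ⟨0, h.N_pos⟩)⁻¹, inv_ne_zero hv0, fun p => ?_⟩
      rw [Finsupp.neg_apply, Finsupp.sub_apply, hE, p.ord_inv]
      ring

/-- The eigenvector map is well defined and its degree is `g + N - 1`. -/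
theorem exists_eigenvectorClass (hF : (prodLax N ds).charpoly = F) :
    ∃ c ∈ PicDeg (FunField F) (genus (FunField F) + N - 1),
      ∀ c', IsEigenvectorClass F (prodLax N ds) c' ↔ c' = c := by
  obtain ⟨u, hu⟩ := exists_isEigenvector hF
  have hu0 := (hu.val_extend h hP).1
  set v := (u ⟨0, h.N_pos⟩)⁻¹ • u with hvdef
  have hv : IsEigenvector F (prodLax N ds) v := by
    refine ⟨smul_ne_zero (inv_ne_zero hu0) hu.1, ?_⟩
    rw [hvdef, Matrix.mulVec_smul, hu.2, smul_comm]
  have hv0 : v ⟨0, h.N_pos⟩ = 1 := by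
    rw [hvdef, Pi.smul_apply, smul_eq_mul, inv_mul_cancel₀ hu0]
  obtain ⟨D, hD⟩ := h.exists_ordVec_divisor hs hv.1
  have hDval : ∀ p : Point (FunField F), p.valVec v = exp (-D p) := fun p => by
    rw [p.valVec_eq_exp hv.1, hD]
  have hDP : D P = -((N : ℤ) - 1) := by
    rw [hD]
    apply P.ordVec_eq
    rw [hv.valVec_infinity h hP, hv0, map_one, one_mul]
  refine ⟨cls (-D), ⟨-D, ?_, rfl⟩, hv.isEigenvectorClass_iff h hs hP hD⟩
  set E : Divisor (FunField F) := -D + Finsupp.single P (-((N : ℤ) - 1)) with hE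
  have hEP : E P = 0 := by
    rw [hE, Finsupp.add_apply, Finsupp.neg_apply, hDP, Finsupp.single_eq_same]; ring
  have hEp : ∀ p : Point (FunField F), p ≠ P → E p = -D p := fun p hp => by
    rw [hE, Finsupp.add_apply, Finsupp.neg_apply, Finsupp.single_eq_of_ne hp, add_zero]
  have hgenus := h.genus_eq hs hP (E := E) ?_ ?_
  · rw [hgenus, hE, degree_add, degree_single]; ring
  · rw [Submodule.eq_bot_iff]
    intro f hf
    obtain ⟨r, hr⟩ := hv.exists_combination h hs (f := f) (fun p hp => by
      have hpP : p ≠ P := by rintro rfl; exact hp hP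
      have := hf p
      rwa [Finsupp.add_apply, Finsupp.single_eq_of_ne hpP, add_zero, hEp p hpP, ← hDval] at this)
    by_contra hf0
    have h1 := hv.one_le_val h hP hv0 r (by rwa [← hr])
    rw [← hr] at h1
    have h2 := h1.trans (hf P)
    rw [Finsupp.add_apply, hEP, Finsupp.single_eq_same, ← exp_zero, exp_le_exp] at h2
    omega
  · intro n
    have hn : P.val (extend h.N_pos (yFun F) v n) = exp (n : ℤ) := by
      rw [(hv.val_extend h hP).2, hv0, map_one, one_mul]
    refine ⟨extend h.N_pos (yFun F) v n, fun p => ?_, by rw [hn, hEP, zero_add]⟩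
    by_cases hp : p = P
    · rw [hp, hn, Finsupp.add_apply, hEP, Finsupp.single_eq_same, zero_add]
    · rw [Finsupp.add_apply, Finsupp.single_eq_of_ne hp, add_zero, hEp p hp, ← hDval, extend,
        map_mul, map_pow]
      refine (mul_le_of_le_one_left' (pow_le_one₀ zero_le ?_)).trans (p.val_le_valVec v _)
      exact (h.val_le_one_of_not_isAtInfinity fun h1 => hp (h.isAtInfinity_unique h1 hP)).2

end Class

/-! ### Kernels at smooth points -/

section Kernel

variable {N : ℕ}

/-- If the adjugate of a matrix function vanishes at a zero of the determinant, this zero is at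
least double. -/
lemma derivative_det_eq_zero (G : Matrix (Fin N) (Fin N) ℂ[X]) {a : ℂ} (hdet : G.det.eval a = 0)
    (hadj : (G.map (evalRingHom a)).adjugate = 0) : G.det.derivative.eval a = 0 := by
  have h1 : ∀ i j, (G.adjugate i j).eval a = 0 := fun i j => by
    have := RingHom.map_adjugate (evalRingHom a) G
    rw [RingHom.mapMatrix_apply, RingHom.mapMatrix_apply, hadj] at this
    exact congrFun (congrFun this i) j
  choose H hH using fun i j => dvd_iff_isRoot.2 (h1 i j)
  obtain ⟨D, hD⟩ := dvd_iff_isRoot.2 hdet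
  have h2 : G.adjugate = (X - C a) • Matrix.of H := by
    ext1 i j
    rw [hH, Matrix.smul_apply, Matrix.of_apply, smul_eq_mul]
  have h3 : G * Matrix.of H = D • (1 : Matrix (Fin N) (Fin N) ℂ[X]) := by
    have h4 := G.mul_adjugate
    rw [h2, Matrix.mul_smul, hD, mul_smul] at h4
    exact smul_right_injective _ (X_sub_C_ne_zero a) h4
  -- Taking determinants gives det G · det H = D^N, so D vanishes at a together with det G = (X - a)
  -- D.
  have h5 := congrArg (fun A => (evalRingHom a) (Matrix.det A)) h3
  simp only [Matrix.det_mul, Matrix.det_smul, map_mul, coe_evalRingHom, hdet, zero_mul,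
    Matrix.det_one, mul_one, eval_pow, Fintype.card_fin] at h5
  have h6 : D.eval a = 0 := eq_zero_of_pow_eq_zero h5.symm
  rw [hD]
  simp [h6]

lemma eval_charpoly_C (A : Matrix (Fin N) (Fin N) ℂ[X]) (a : ℂ) :
    A.charpoly.eval (C a) = (Matrix.scalar (Fin N) (C a) - A).det :=
  Matrix.eval_charpoly A _

/-- A vanishing adjugate would make both partial derivatives of F vanish at (a, b), by
`derivative_det_eq_zero` along the lines y = b and x = a. Hence eigenspaces over points of a smooth
curve are lines. -/
lemma adjugate_ne_zero (A : Matrix (Fin N) (Fin N) ℂ[X]) (hs : IsSmoothAffine A.charpoly) {a b : ℂ}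
    (hab : A.charpoly.evalEval b a = 0) :
    (Matrix.scalar (Fin N) a - A.map (evalRingHom b)).adjugate ≠ 0 := by
  intro hadj
  rcases hs a b hab with h1 | h1 <;> apply h1
  · rw [← Matrix.charpoly_map, Matrix.charpoly]
    have h2 : (Matrix.charmatrix (A.map (evalRingHom b))).map (evalRingHom a) =
        Matrix.scalar (Fin N) a - A.map (evalRingHom b) := by
      ext1 i j
      by_cases hij : i = j
      · subst hij; simp [Matrix.charmatrix_apply_eq]
      · simp [Matrix.charmatrix_apply_ne _ _ _ hij, Matrix.diagonal_apply_ne _ hij]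
    refine derivative_det_eq_zero _ ?_ (by rw [h2, hadj])
    have h3 := hab
    rw [← map_evalRingHom_eval] at h3
    rw [← Matrix.charpoly, Matrix.charpoly_map, h3]
  · rw [eval_charpoly_C]
    have h2 : (Matrix.scalar (Fin N) (C a) - A).map (evalRingHom b) =
        Matrix.scalar (Fin N) a - A.map (evalRingHom b) := by
      ext1 i j
      by_cases hij : i = j
      · subst hij; simp
      · simp [Matrix.diagonal_apply_ne _ hij]
    refine derivative_det_eq_zero _ ?_ (by rw [h2, hadj])
    rw [← eval_charpoly_C]
    exact hab

/-- A matrix with nonzero adjugate has at most a line as its kernel. -/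
lemma exists_smul_eq_of_adjugate_ne_zero {G : Matrix (Fin N) (Fin N) ℂ} (hG : G.adjugate ≠ 0)
    {u w : Fin N → ℂ} (hu0 : u ≠ 0) (hu : G.mulVec u = 0) (hw : G.mulVec w = 0) :
    ∃ c : ℂ, w = c • u := by
  obtain ⟨i, j, hij⟩ : ∃ i j, G.adjugate i j ≠ 0 := by
    by_contra! h
    exact hG (Matrix.ext h)
  rw [Matrix.adjugate_apply] at hij
  -- The nonzero adjugate entry is the determinant of G with row j replaced by the i-th coordinate
  -- functional; so the i-th entry determines a kernel vector.
  have hker : ∀ z, G.mulVec z = 0 → z i = 0 → z = 0 := by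
    intro z hz hzi
    by_contra hz0
    apply hij
    refine Matrix.exists_mulVec_eq_zero_iff.1 ⟨z, hz0, ?_⟩
    ext k
    by_cases hk : k = j
    · subst hk
      simp [Matrix.mulVec, hzi]
    · have := congrFun hz k
      simpa [Matrix.mulVec, Matrix.updateRow_ne hk] using this
  have hui : u i ≠ 0 := fun h => hu0 (hker u hu h)
  refine ⟨w i / u i, sub_eq_zero.1 (hker _ ?_ ?_)⟩
  · rw [Matrix.mulVec_sub, Matrix.mulVec_smul, hu, hw]; simp
  · simp [hui]

end Kernel

/-! ### Interchanging the factors -/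

section Interchange

variable {N : ℕ} {c : ℂ} {A B X Y : Matrix (Fin N) (Fin N) ℂ[X]}

lemma charpoly_interchange (hX : X = Matrix.scalar (Fin N) (C c) + B * A)
    (hY : Y = Matrix.scalar (Fin N) (C c) + A * B) : Y.charpoly = X.charpoly := by
  have key : ∀ G : Matrix (Fin N) (Fin N) ℂ[X], (Matrix.scalar (Fin N) (C c) + G).charpoly =
      G.charpoly.comp (Polynomial.X + C (-C c)) := by
    intro G
    rw [← Matrix.charpoly_sub_scalar, map_neg, sub_neg_eq_add, add_comm]
  rw [hX, hY, key, key, Matrix.charpoly_mul_comm]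

lemma interchange (hX : X = Matrix.scalar (Fin N) (C c) + B * A)
    (hY : Y = Matrix.scalar (Fin N) (C c) + A * B) : Y * A = A * X := by
  rw [hX, hY, add_mul, mul_add, mul_assoc, (Matrix.scalar_commute (C c) (Commute.all _) A).eq]

lemma map_eq_conj (hA : A.det ≠ 0) (h : Y * A = A * X) :
    Y.map (algebraMap ℂ[X] (RatFunc ℂ)) = conj A X := by
  have h1 : IsUnit (A.map (algebraMap ℂ[X] (RatFunc ℂ))).det := by
    have := RingHom.map_det (algebraMap ℂ[X] (RatFunc ℂ)) A
    rw [RingHom.mapMatrix_apply] at this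
    rw [← this, isUnit_iff_ne_zero]
    simpa using hA
  rw [conj, ← Matrix.map_mul, ← h, Matrix.map_mul, Matrix.mul_nonsing_inv_cancel_right _ _ h1]

lemma evalEval_interchange (hX : X = Matrix.scalar (Fin N) (C c) + B * A) {b : ℂ}
    (hb : A.det.eval b = 0) : X.charpoly.evalEval b c = 0 := by
  rw [evalEval, eval_charpoly_C, hX, sub_add_cancel_left, ← neg_mul, Matrix.det_mul, eval_mul, hb,
    mul_zero]

/-- A nonzero kernel vector of A(b) is a c-eigenvector of X(b). By smoothness that eigenspace is a
line, so A(b) kills all of it. -/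
lemma ker_interchange (hX : X = Matrix.scalar (Fin N) (C c) + B * A)
    (hs : IsSmoothAffine X.charpoly) {b : ℂ} (hb : A.det.eval b = 0) {w : Fin N → ℂ}
    (hw : (X.map (evalRingHom b)).mulVec w = c • w) : (A.map (evalRingHom b)).mulVec w = 0 := by
  have h1 : (A.map (evalRingHom b)).det = 0 := by
    have := RingHom.map_det (evalRingHom b) A
    rw [RingHom.mapMatrix_apply] at this
    rw [← this]; exact hb
  obtain ⟨u, hu0, hu⟩ := Matrix.exists_mulVec_eq_zero_iff.2 h1
  have h2 : ∀ z : Fin N → ℂ, (Matrix.scalar (Fin N) c - X.map (evalRingHom b)).mulVec z =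
      c • z - (X.map (evalRingHom b)).mulVec z := by
    intro z
    rw [Matrix.sub_mulVec, Matrix.scalar_apply]
    congr 1
    ext i; simp [Matrix.mulVec_diagonal]
  have h3 : X.map (evalRingHom b) = Matrix.scalar (Fin N) c +
      B.map (evalRingHom b) * A.map (evalRingHom b) := by
    rw [hX, ← Matrix.map_mul]
    ext1 i j
    by_cases hij : i = j
    · subst hij; simp
    · simp [Matrix.diagonal_apply_ne _ hij]
  have h4 : (X.map (evalRingHom b)).mulVec u = c • u := by
    rw [h3, Matrix.add_mulVec, ← Matrix.mulVec_mulVec, hu, Matrix.mulVec_zero, add_zero,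
      Matrix.scalar_apply]
    ext i; simp [Matrix.mulVec_diagonal]
  obtain ⟨k, rfl⟩ := exists_smul_eq_of_adjugate_ne_zero
    (adjugate_ne_zero X hs (evalEval_interchange hX hb)) hu0 (by rw [h2, h4, sub_self])
    (w := w) (by rw [h2, hw, sub_self])
  rw [Matrix.mulVec_smul, hu, smul_zero]

end Interchange

/-! ### The effect of one Lax factor on the divisor of an eigenvector -/

section Step

variable {N : ℕ} {F : ℂ[X][X]} [IsDomain (AdjoinRoot F)] {c : ℂ} {d : ℤ → ℂ}
  {B X Y : Matrix (Fin N) (Fin N) ℂ[X]}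

omit [IsDomain (AdjoinRoot F)] in
lemma map_aeval_scalar_add (hX : X = Matrix.scalar (Fin N) (C c) + B * laxFactor N d) :
    X.map (aeval (yFun F)) = Matrix.scalar (Fin N) (algebraMap ℂ (FunField F) c) +
      B.map (aeval (yFun F)) * (laxFactor N d).map (aeval (yFun F)) := by
  have h1 : (B * laxFactor N d).map (aeval (yFun F)) =
      B.map (aeval (yFun F)) * (laxFactor N d).map (aeval (yFun F)) := Matrix.map_mul
  rw [hX, ← h1, Matrix.map_add _ (map_add _)]
  congr 1
  ext1 i j
  by_cases hij : i = j
  · subst hij; simp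
  · simp [Matrix.diagonal_apply_ne _ hij]

omit [IsDomain (AdjoinRoot F)] in
lemma IsEigenvector.mulVec_mulVec (hX : X = Matrix.scalar (Fin N) (C c) + B * laxFactor N d)
    {v : Fin N → FunField F} (hv : IsEigenvector F X v) :
    (B.map (aeval (yFun F))).mulVec (((laxFactor N d).map (aeval (yFun F))).mulVec v) =
      (xFun F - algebraMap ℂ _ c) • v := by
  have h1 := hv.2
  rw [map_aeval_scalar_add hX, Matrix.add_mulVec, ← eq_sub_iff_add_eq', Matrix.scalar_apply] at h1
  rw [Matrix.mulVec_mulVec, h1, sub_smul]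
  congr 1
  ext i; simp [Matrix.mulVec_diagonal]

omit [IsDomain (AdjoinRoot F)] in
lemma IsEigenvector.laxFactor_mulVec (h : Y * laxFactor N d = laxFactor N d * X)
    {v : Fin N → FunField F} (hv : IsEigenvector F X v)
    (h0 : ((laxFactor N d).map (aeval (yFun F))).mulVec v ≠ 0) :
    IsEigenvector F Y (((laxFactor N d).map (aeval (yFun F))).mulVec v) := by
  refine ⟨h0, ?_⟩
  rw [Matrix.mulVec_mulVec, ← Matrix.map_mul, h, Matrix.map_mul, ← Matrix.mulVec_mulVec, hv.2,
    Matrix.mulVec_smul]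

omit [IsDomain (AdjoinRoot F)] in
lemma adjugate_laxFactor_mulVec (hN : 0 < N) (v : Fin N → FunField F) :
    ((laxFactor N d).adjugate.map (aeval (yFun F))).mulVec
      (((laxFactor N d).map (aeval (yFun F))).mulVec v) =
      (-(-1) ^ N * (yFun F - algebraMap ℂ _ (singularY N d))) • v := by
  rw [Matrix.mulVec_mulVec, ← Matrix.map_mul, Matrix.adjugate_mul, det_laxFactor hN]
  have h1 : ((-(-1) ^ N * (Polynomial.X - C (singularY N d))) •
      (1 : Matrix (Fin N) (Fin N) ℂ[X])).map (aeval (yFun F)) =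
      (-(-1) ^ N * (yFun F - algebraMap ℂ _ (singularY N d))) •
        (1 : Matrix (Fin N) (Fin N) (FunField F)) := by
    ext1 i j
    by_cases hij : i = j
    · subst hij; simp
    · simp [Matrix.one_apply_ne hij]
  rw [h1, Matrix.smul_mulVec, Matrix.one_mulVec]

variable {p : Point (FunField F)}

lemma val_map_aeval_le_one (hy : p.val (yFun F) ≤ 1) (A : Matrix (Fin N) (Fin N) ℂ[X])
    (i j : Fin N) : p.val (A.map (aeval (yFun F)) i j) ≤ 1 := by
  rw [Matrix.map_apply, aeval_eq_sum_range]
  refine p.val.map_sum_le fun k _ => (p.val_smul_le _ _).trans ?_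
  rw [map_pow]
  exact pow_le_one₀ zero_le hy

/-- Away from infinity a Lax factor changes the order of an eigenvector only at its zero. -/
lemma IsEigenvector.valVec_laxFactor_bounds (hN : 0 < N) (hy : p.val (yFun F) ≤ 1)
    (hX : X = Matrix.scalar (Fin N) (C c) + B * laxFactor N d)
    {v : Fin N → FunField F} (hv : IsEigenvector F X v) :
    p.valVec (((laxFactor N d).map (aeval (yFun F))).mulVec v) ≤ p.valVec v ∧
    p.val (xFun F - algebraMap ℂ _ c) * p.valVec v ≤
      p.valVec (((laxFactor N d).map (aeval (yFun F))).mulVec v) ∧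
    p.val (yFun F - algebraMap ℂ _ (singularY N d)) * p.valVec v ≤
      p.valVec (((laxFactor N d).map (aeval (yFun F))).mulVec v) := by
  refine ⟨p.valVec_mulVec_le (val_map_aeval_le_one hy _) v, ?_, ?_⟩
  · rw [← p.valVec_smul, ← hv.mulVec_mulVec hX]
    exact p.valVec_mulVec_le (val_map_aeval_le_one hy _) _
  · have h1 : p.val (-(-1) ^ N * (yFun F - algebraMap ℂ _ (singularY N d))) =
        p.val (yFun F - algebraMap ℂ _ (singularY N d)) := by
      rw [map_mul, Valuation.map_neg, map_pow, Valuation.map_neg, map_one, one_pow, one_mul]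
    rw [← h1, ← p.valVec_smul, ← adjugate_laxFactor_mulVec hN]
    exact p.valVec_mulVec_le (val_map_aeval_le_one hy _) _

lemma Point.HasValue.mulVec {y : FunField F} {b : ℂ} (hy : p.HasValue y b)
    (A : Matrix (Fin N) (Fin N) ℂ[X]) {w : Fin N → FunField F} {ω : Fin N → ℂ}
    (hw : ∀ i, p.HasValue (w i) (ω i)) (i : Fin N) :
    p.HasValue ((A.map (Polynomial.aeval y)).mulVec w i) ((A.map (evalRingHom b)).mulVec ω i) := by
  rw [Matrix.mulVec, Matrix.mulVec, dotProduct, dotProduct]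
  exact Point.HasValue.sum _ fun j _ => (hy.aeval (A i j)).mul (hw j)

variable {m : ℕ} (h : IsTriangular m N F) (hs : IsSmoothAffine F)
include h hs

/-- Scaled to be regular and nonzero at `p`, the eigenvector takes as its value there a
c-eigenvector of X(b), which A(b) annihilates by `ker_interchange`. -/
lemma IsEigenvector.valVec_laxFactor_le (hXF : X.charpoly = F)
    (hX : X = Matrix.scalar (Fin N) (C c) + B * laxFactor N d)
    (hp : IsOver p c (singularY N d)) {v : Fin N → FunField F} (hv : IsEigenvector F X v) :
    p.valVec (((laxFactor N d).map (aeval (yFun F))).mulVec v) ≤ exp (-1) * p.valVec v := by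
  obtain ⟨k, hk, hk'⟩ := p.exists_val_eq_valVec hv.1
  set w := (v k)⁻¹ • v with hw
  have hvw : v = v k • w := by rw [hw, smul_inv_smul₀ hk]
  have hwX : (X.map (aeval (yFun F))).mulVec w = xFun F • w := by
    rw [hw, Matrix.mulVec_smul, hv.2, smul_comm]
  have hw1 : p.valVec w = 1 := by
    rw [hw, p.valVec_smul, map_inv₀, hk', inv_mul_cancel₀ (p.valVec_ne_zero hv.1)]
  choose ω hω using fun i => h.exists_hasValue hs p (f := w i)
    ((p.val_le_valVec w i).trans hw1.le)
  have hker : ((laxFactor N d).map (evalRingHom (singularY N d))).mulVec ω = 0 := by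
    refine ker_interchange hX (by rwa [hXF]) (by simp [det_laxFactor h.N_pos]) ?_
    ext i
    refine (hp.2.mulVec X hω i).unique ?_
    rw [hwX]
    exact hp.1.mul (hω i)
  have hAw : p.valVec (((laxFactor N d).map (aeval (yFun F))).mulVec w) ≤ exp (-1) := by
    refine p.valVec_le fun i => ?_
    rw [← lt_exp_add_one_iff, neg_add_cancel, exp_zero, ← p.hasValue_zero_iff]
    have := hp.2.mulVec (laxFactor N d) hω i
    rwa [hker] at this
  rw [hvw, Matrix.mulVec_smul, p.valVec_smul, p.valVec_smul, hw1, mul_one, mul_comm]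
  exact mul_le_mul_left hAw _

end Step

/-- Interchanging the two factors of `X - c` moves the class of the eigenvector map by `P - Q`,
where `Q` is the point at which the eigenvector is annihilated by the right factor. -/
theorem exists_point_interchange {N : ℕ} {F : ℂ[X][X]} [IsDomain (AdjoinRoot F)]
    {dX dY : List (ℤ → ℂ)} (h : IsTriangular dX.length N F) (hlen : dY.length = dX.length)
    (hs : IsSmoothAffine F) {P : Point (FunField F)} (hP : IsAtInfinity P)
    (hXF : (prodLax N dX).charpoly = F) {c : ℂ} {d : ℤ → ℂ} {B : Matrix (Fin N) (Fin N) ℂ[X]}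
    (hX : prodLax N dX = Matrix.scalar (Fin N) (C c) + B * laxFactor N d)
    (hY : prodLax N dY = Matrix.scalar (Fin N) (C c) + laxFactor N d * B) :
    ∃ Q : Point (FunField F), (∀ p, IsOver p c (singularY N d) ↔ p = Q) ∧
      ∀ cX cY, IsEigenvectorClass F (prodLax N dX) cX → IsEigenvectorClass F (prodLax N dY) cY →
        cY = cX + cls (diff P Q) := by
  classical
  have hy0 : (laxFactor N d).det.eval (singularY N d) = 0 := by simp [det_laxFactor h.N_pos]
  obtain ⟨Q, hQ⟩ := h.exists_isOver_of_evalEval hs (a := c) (b := singularY N d) (by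
    rw [← hXF]; exact evalEval_interchange hX hy0)
  have hPQ : P ≠ Q := by
    rintro rfl
    exact absurd hQ.1.val_le_one (not_le.2 hP.1)
  refine ⟨Q, fun p => ⟨fun hp => h.isOver_unique hs hp hQ, fun hp => hp ▸ hQ⟩, ?_⟩
  intro cX cY hcX hcY
  obtain ⟨v, hv⟩ := exists_isEigenvector hXF
  obtain ⟨D, hD⟩ := h.exists_ordVec_divisor hs hv.1
  have hDval : ∀ p : Point (FunField F), p.valVec v = exp (-D p) := fun p => by
    rw [p.valVec_eq_exp hv.1, hD]
  set u := ((laxFactor N d).map (aeval (yFun F))).mulVec v with hu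
  have hPval : P.valVec u = P.valVec v * exp 1 := hv.valVec_laxFactor h hP d
  have hu0 : u ≠ 0 := by
    intro h0
    have h1 : P.valVec u = 0 := le_zero_iff.1 (P.valVec_le (by simp [h0]))
    rw [h1] at hPval
    exact mul_ne_zero (P.valVec_ne_zero hv.1) exp_ne_zero hPval.symm
  -- Relative to v, the vector u has one more pole at `P`, one more zero at `Q`, and the same order
  -- elsewhere.
  have hDu : ∀ p, (D - diff P Q) p = p.ordVec u := by
    intro p
    suffices hp : p.valVec u = exp (-(D - diff P Q) p) by rw [p.ordVec_eq hp, neg_neg]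
    have hdiff : (D - diff P Q) p = D p - (Finsupp.single P 1 p - Finsupp.single Q 1 p) := rfl
    rw [hdiff]
    by_cases hpP : p = P
    · rw [hpP, hPval, hDval, Finsupp.single_eq_same, Finsupp.single_eq_of_ne hPQ, ← exp_add]
      congr 1; ring
    have hpinf : ¬ IsAtInfinity p := fun h1 => hpP (h.isAtInfinity_unique h1 hP)
    obtain ⟨h1, h2, h3⟩ := hv.valVec_laxFactor_bounds h.N_pos
      (h.val_le_one_of_not_isAtInfinity hpinf).2 hX
    rw [Finsupp.single_eq_of_ne hpP]
    by_cases hpQ : p = Q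
    · rw [hpQ] at h1 h2 h3 ⊢
      rw [Finsupp.single_eq_same]
      have hle := hv.valVec_laxFactor_le h hs hXF hX hQ
      -- The gained zero is simple because x - c or y - b is a uniformizer at `Q`.
      have hge : exp (-1) * Q.valVec v ≤ Q.valVec u := by
        rcases h.uniformizer_of_isOver hs hQ with h4 | h4
        · rwa [h4] at h2
        · rwa [h4] at h3
      rw [le_antisymm hle hge, hDval, ← exp_add]
      congr 1; ring
    · rw [Finsupp.single_eq_of_ne hpQ]
      obtain ⟨a, b, hab⟩ := h.exists_isOver hpinf
      have hge : p.valVec v ≤ p.valVec u := by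
        by_cases hac : a = c
        · have hb : b ≠ singularY N d := by
            rintro rfl
            rw [hac] at hab
            exact hpQ (h.isOver_unique hs hab hQ)
          rwa [(hab.2.sub (p.hasValue_algebraMap _)).val_eq_one (sub_ne_zero.2 hb), one_mul] at h3
        · rwa [(hab.1.sub (p.hasValue_algebraMap _)).val_eq_one (sub_ne_zero.2 hac), one_mul] at h2
      rw [le_antisymm h1 hge, hDval]
      congr 1; ring
  have hvY : IsEigenvector F (prodLax N dY) u := hv.laxFactor_mulVec (interchange hX hY) hu0
  rw [(hv.isEigenvectorClass_iff h hs hP hD cX).1 hcX,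
    (hvY.isEigenvectorClass_iff (by rwa [hlen]) hs hP hDu cY).1 hcY]
  change cls (-(D - diff P Q)) = cls (-D + diff P Q)
  congr 1
  abel

end RndKP

end

/-! ### The main theorem -/

open Polynomial RndKP
theorem mainTheorem1 (M K N : ℕ) (hM : 0 < M) (hK : 0 < K) (hN : 0 < N)
    (hMK : Nat.Coprime M K) (hgcd : Nat.Coprime (M + K) N)
    (F : ℂ[X][X]) (hne : (isolevelSet M K N F).Nonempty) (hsmooth : IsSmoothAffine F) :
    -- the spectral curve `C` is irreducible
    ∃ _ : IsDomain (AdjoinRoot F),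
    -- the eigenvector map is well defined, with values in `Pic^(g+N-1)`
    ∃ φ : isolevelSet M K N F → Pic (FunField F),
      (∀ A : isolevelSet M K N F, ∀ c, IsEigenvectorClass F A.1 c ↔ c = φ A) ∧
      (∀ A, φ A ∈ PicDeg (FunField F) (genus (FunField F) + N - 1)) ∧
    -- there is a unique point `P` over `(∞, ∞)`
    ∃ P : Point (FunField F), (∀ p : Point (FunField F), IsAtInfinity p ↔ p = P) ∧
    -- every element of the isolevel set is some `X_t`
    ∀ (I V : ℤ → ℤ → ℂ) (t : ℤ), IsSolution M K N I V →
      ∀ hX : laxX M K N I V t ∈ isolevelSet M K N F,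
      -- the shift `σ`
      (∃ Q₁ : Point (FunField F),
        (∀ p : Point (FunField F),
          IsOver p ((∏ k ∈ Finset.range K, V 1 (t - k * M)) *
            ∏ k ∈ Finset.range M, I 1 (t - k * K)) 0 ↔ p = Q₁) ∧
        ∃ Y : isolevelSet M K N F,
          Y.1 = laxX M K N (fun n s => I (n + 1) s) (fun n s => V (n + 1) s) t ∧
          Y.1.map (algebraMap ℂ[X] (RatFunc ℂ)) = conj (shiftMatrix N) (laxX M K N I V t) ∧
          φ Y = φ ⟨_, hX⟩ + cls (diff P Q₁)) ∧
      -- the time shift `μ_K`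
      (∀ j : ℕ, j < M → t ≡ -((j + 1) * K) [ZMOD M] →
        ∃ A : Point (FunField F),
        (∀ p : Point (FunField F),
          IsOver p 0 ((-1) ^ N * ∏ n ∈ Finset.Icc (1 : ℤ) N, I n (-(j * K))) ↔ p = A) ∧
        ∃ Y : isolevelSet M K N F,
          Y.1 = laxX M K N I V (t + K) ∧
          Y.1.map (algebraMap ℂ[X] (RatFunc ℂ)) =
            conj (laxR N I (t - (M - 1) * K)) (laxX M K N I V t) ∧
          φ Y = φ ⟨_, hX⟩ + cls (diff P A)) ∧
      -- the time shift `μ_{-M}`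
      (∀ j : ℕ, j < K → t ≡ -(j * M) [ZMOD K] →
        ∃ B : Point (FunField F),
        (∀ p : Point (FunField F),
          IsOver p 0 ((-1) ^ N * ∏ n ∈ Finset.Icc (1 : ℤ) N, V n (-(j * M))) ↔ p = B) ∧
        ∃ Y : isolevelSet M K N F,
          Y.1 = laxX M K N I V (t - M) ∧
          Y.1.map (algebraMap ℂ[X] (RatFunc ℂ)) =
            conj (laxL N V (t - M * K)) (laxX M K N I V t) ∧
          φ Y = φ ⟨_, hX⟩ + cls (diff P B)) := by
  have hlaxF : ∀ (I V : ℤ → ℤ → ℂ) (t : ℤ), (laxX M K N I V t).charpoly = F →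
      IsTriangular (laxList M K I V t).length N F := by
    rintro I V t rfl
    rw [laxX_eq_prodLax]
    have hlen := length_laxList M K I V t
    exact isTriangular_charpoly hN _ (by omega) (by rwa [hlen])
  obtain ⟨A₀, I₀, V₀, t₀, -, rfl, hF₀⟩ := hne
  have hdom : IsDomain (AdjoinRoot F) := (hlaxF I₀ V₀ t₀ hF₀).isDomain
  obtain ⟨P, hP⟩ := (hlaxF I₀ V₀ t₀ hF₀).exists_isAtInfinity
  have hclass : ∀ A : isolevelSet M K N F,
      ∃ c ∈ PicDeg (FunField F) (genus (FunField F) + N - 1),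
        ∀ c', IsEigenvectorClass F A.1 c' ↔ c' = c := by
    rintro ⟨A, I, V, t, -, rfl, hF⟩
    have h1 := hlaxF I V t hF
    rw [laxX_eq_prodLax] at hF
    simp only [laxX_eq_prodLax]
    exact exists_eigenvectorClass h1 hsmooth hP hF
  choose φ hφdeg hφ using hclass
  refine ⟨hdom, φ, hφ, hφdeg, P,
    fun p => ⟨fun hp => (hlaxF I₀ V₀ t₀ hF₀).isAtInfinity_unique hp hP, fun hp => hp ▸ hP⟩, ?_⟩
  intro I V t hsol hX
  have hXF : (laxX M K N I V t).charpoly = F := by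
    obtain ⟨I', V', t', -, h1, h2⟩ := hX
    exact h2
  -- One statement for all three moves: the shift takes c = U_1 and d = 0, so that the factor is S;
  -- the time shifts take c = 0 and d from R or L.
  have step : ∀ (I' V' : ℤ → ℤ → ℂ) (t' : ℤ) (c : ℂ) (d : ℤ → ℂ)
      (B : Matrix (Fin N) (Fin N) ℂ[X]), IsSolution M K N I' V' →
      laxX M K N I V t = Matrix.scalar (Fin N) (C c) + B * laxFactor N d →
      laxX M K N I' V' t' = Matrix.scalar (Fin N) (C c) + laxFactor N d * B →
      ∃ Q : Point (FunField F), (∀ p : Point (FunField F), IsOver p c (singularY N d) ↔ p = Q) ∧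
        ∃ Y : isolevelSet M K N F, Y.1 = laxX M K N I' V' t' ∧
          Y.1.map (algebraMap ℂ[X] (RatFunc ℂ)) = conj (laxFactor N d) (laxX M K N I V t) ∧
          φ Y = φ ⟨_, hX⟩ + cls (diff P Q) := by
    intro I' V' t' c d B hsol' hB hB'
    have hYF : (laxX M K N I' V' t').charpoly = F := (charpoly_interchange hB hB').trans hXF
    have hXc := (hφ ⟨_, hX⟩ _).2 rfl
    have hY : laxX M K N I' V' t' ∈ isolevelSet M K N F := ⟨I', V', t', hsol', rfl, hYF⟩
    have hYc := (hφ ⟨_, hY⟩ _).2 rfl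
    have hdet : (laxFactor N d).det ≠ 0 := by
      rw [det_laxFactor hN]
      exact mul_ne_zero (neg_ne_zero.2 (pow_ne_zero _ (neg_ne_zero.2 one_ne_zero)))
        (X_sub_C_ne_zero _)
    have hconj := map_eq_conj hdet (interchange hB hB')
    have hXF' := hXF
    simp only [laxX_eq_prodLax M K N I V, laxX_eq_prodLax M K N I' V'] at hB hB' hXF'
    obtain ⟨Q, hQ, hQ'⟩ := exists_point_interchange (hlaxF I V t hXF)
      (by rw [length_laxList, length_laxList]) hsmooth hP hXF' hB hB'
    rw [← laxX_eq_prodLax, ← laxX_eq_prodLax] at hQ'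
    exact ⟨Q, hQ, ⟨_, hY⟩, rfl, hconj, hQ' _ _ hXc hYc⟩
  refine ⟨?_, ?_, ?_⟩
  · obtain ⟨B, hB, hB'⟩ := hsol.laxX_factor_S hN t rfl
    rw [shiftMatrix_eq_laxFactor] at hB hB'
    have h0 : singularY N (fun _ => 0) = 0 := by simp [singularY, hN.ne']
    have h1 := step _ _ t _ _ B hsol.shift hB hB'
    rw [h0, ← shiftMatrix_eq_laxFactor] at h1
    exact h1
  · intro j hj htj
    obtain ⟨B, hB, hB'⟩ := hsol.laxX_factor_R hM t
    have h1 := step I V (t + K) 0 _ B hsol (by simpa [laxR] using hB) (by simpa [laxR] using hB')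
    -- The time of the interchanged factor matters only modulo M, because the constraint makes the
    -- product of the I's over a period M-periodic in time.
    have h2 : t - ((M : ℤ) - 1) * K ≡ -(j * K) [ZMOD M] := by
      have h3 := htj.sub_right (((M : ℤ) - 1) * K)
      have h4 : -((j + 1 : ℤ) * K) - ((M : ℤ) - 1) * K = -(j * K) + M * (-K) := by ring
      rw [h4] at h3
      exact h3.trans (Int.modEq_iff_dvd.2 ⟨K, by ring⟩)
    rw [singularY_eq, hsol.prod_I_of_modEq h2] at h1
    exact h1
  · intro j hj htj
    obtain ⟨B, hB, hB'⟩ := hsol.laxX_factor_L hK t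
    have h1 := step I V (t - M) 0 _ B hsol (by simpa [laxL] using hB) (by simpa [laxL] using hB')
    have h2 : t - (M : ℤ) * K ≡ -(j * M) [ZMOD K] := by
      refine Int.ModEq.trans ?_ htj
      exact Int.modEq_iff_dvd.2 ⟨M, by ring⟩
    rw [singularY_eq, hsol.prod_V_of_modEq h2] at h1
    exact h1
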